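/- Let $\Bbbk$ be a field of characteristic different from $2$ and let $q\in\Bbbk$ be nonzero. Let $A=\Bbbk\langle u,v\rangle/(uv+vu)$ be the quantum $(-1)$-plane, and let $H$ be the $8$-dimensional Kac–Paljutkin Hopf algebra, i.e. the algebra generated by $x,y,z$ with relations $$x^2=y^2=1,\quad z^2=\tfrac12(1+x+y-xy),\quad yx=xy,\quad zx=yz,\quad zy=xz,$$ with $\Delta(x)=x\otimes x$, $\Delta(y)=y\otimes y$, $\Delta(z)=\tfrac12(1\otimes1+1\otimes x+y\otimes1-y\otimes x)(z\otimes z)$, $\varepsilon(x)=\varepsilon(y)=\varepsilon(z)=1$, $S(x)=x$, $S(y)=y$, $S(z)=z$. Let $H$ act on $A$, making it a left $H$-module algebra, by $x\triangleright w=y\triangleright w=w$ for $w\in A$, $z\triangleright u=q^{-1}v$, $z\triangleright v=qu$, and let $A\#H$ be the smash product. Let $A^!=\Bbbk[u^*,v^*]/(u^{*2},v^{*2})$, graded by degree, and equip $A^!\otimes(A\#H)$ with the differential $$\partial(\xi\otimes b)=u^*\xi\otimes ub+v^*\xi\otimes vb-(-1)^m(\xi u^*\otimes bu+\xi v^*\otimes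 bv),\qquad \xi\in A^!_m .$$ Let $H$ act on the right on $A^!$ by $u^*\triangleleft x=u^*\triangleleft y=u^*$, $v^*\triangleleft x=v^*\triangleleft y=v^*$, $u^*\triangleleft z=qv^*$, $v^*\triangleleft z=q^{-1}u^*$ and $(\xi\eta)\triangleleft h=\sum(\xi\triangleleft h_{(1)})(\eta\triangleleft h_{(2)})$, and on $A^!\otimes(A\#H)$ by $(\xi\otimes b)\blacktriangleleft h=\sum\xi\triangleleft h_{(2)}\otimes S(h_{(1)})\,b\,h_{(3)}$. Restricting Hochschild cochains of $A\#H$ to the Koszul complex of $A$, that is, sending $f$ to $1\otimes f$ in degree $0$, to $u^*\otimes f(u)+v^*\otimes f(v)$ in degree $1$, and to $u^*v^*\otimes(f(u,v)+f(v,u))$ in degree $2$, induces a linear map from $\mathbf{HH}^n(A\#H)$ to $\mathbf H^n(A^!\otimes(A\#H))$. For $n=0,1,2$ this map is injective, and its image is the space of $H$-invariants of $\mathbf H^n(A^!\otimes(A\#H))$ (the classes $c$ with $c\blacktriangleleft h=\varepsilon(h)c$ for all $h\in H$). Identifying $\mathbf{HH}^n(A\#H)$ with its image, the following classes (for $i,j\ge0$)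 form $\Bbbk$-bases, where $(\xi\otimes a)h$ means $\xi\otimes(a\#h)$. $\mathbf{HH}^0(A\#H)$: - $(1\otimes q^{2i}u^{2i}v^{2j}+1\otimes q^{2j}u^{2j}v^{2i})\,h$ for $i\le j$ and each $h\in\{\frac{1+xy}2,\frac{1-xy}2,\frac{x+y}2\}$; - $(1\otimes q^{2i}u^{2i}v^{2j}-1\otimes q^{2j}u^{2j}v^{2i})\frac{x-y}2$ for $i<j$. $\mathbf{HH}^1(A\#H)$: - $(u^*\otimes q^{2i}u^{2i+1}v^{2j}+v^*\otimes q^{2j}u^{2j}v^{2i+1})\,h$ for $i,j\ge0$ and each $h\in\{\frac{1+xy}2,\frac{1-xy}2,\frac{x+y}2\}$; - $(u^*\otimes q^{2i}u^{2i+1}v^{2j}-v^*\otimes q^{2j}u^{2j}v^{2i+1})\frac{x-y}2$ for $i,j\ge0$. $\mathbf{HH}^2(A\#H)$: - $(u^*v^*\otimes q^{2i}u^{2i+1}v^{2j+1}-u^*v^*\otimes q^{2j}u^{2j+1}v^{2i+1})\,h$ for $i<j$ and each $h\in\{\frac{1+xy}2,\frac{1-xy}2,\frac{x+y}2\}$;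 - $(u^*v^*\otimes q^{2i}u^{2i+1}v^{2j+1}+u^*v^*\otimes q^{2j}u^{2j+1}v^{2i+1})\frac{x-y}2$ for $i\le j$; - $u^*v^*\otimes k$ for $k\in\{\frac{1+xy}2,\frac{1-xy}2,\frac{x+y}2,\frac{z+xyz}2,\frac{xz+yz}2\}$. -/

import Mathlib

open scoped TensorProduct

set_option linter.unusedSimpArgs false
set_option linter.unusedSectionVars false
set_option linter.unnecessarySeqFocus false

section Cohomology

variable {k M N : Type*} [Field k] [AddCommGroup M] [Module k M] [AddCommGroup N] [Module k N]

/-- The quotient `Z / (Z ∩ B)` of the cocycles `Z` by the coboundaries `B`. -/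
abbrev Cohomology (Z B : Submodule k M) : Type _ := Z ⧸ B.submoduleOf Z

/-- The map on cohomology induced by a linear map sending cocycles to cocycles and coboundaries to
coboundaries. -/
def Cohomology.map {Z B : Submodule k M} {Z' B' : Submodule k N} (f : M →ₗ[k] N)
    (hZ : ∀ z ∈ Z, f z ∈ Z') (hB : ∀ z ∈ B, f z ∈ B') : Cohomology Z B →ₗ[k] Cohomology Z' B' :=
  Submodule.mapQ _ _ (f.restrict hZ) (fun z hz => hB z hz)

/-- `c` is the cohomology class of the cocycle `w`. -/
def Cohomology.IsClassOf {Z B : Submodule k M} (c : Cohomology Z B) (w : M) : Prop :=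
  ∃ hw : w ∈ Z, c = Submodule.Quotient.mk ⟨w, hw⟩

/-- The subspace of classes of those cocycles that lie in `W`. -/
def Cohomology.classesOf (Z B W : Submodule k M) : Submodule k (Cohomology Z B) :=
  (W.submoduleOf Z).map (B.submoduleOf Z).mkQ

end Cohomology

/-! ### Hochschild cohomology -/

section Hochschild

variable (k : Type*) [Field k] (B : Type*) [Ring B] [Algebra k B]

/-- Hochschild `n`-cochains of `B` with coefficients in `B`. -/
abbrev HochCochain (n : ℕ) : Type _ := MultilinearMap k (fun _ : Fin n => B) B

variable {B}

lemma contractNth_update {n : ℕ} (i : Fin n) (a : Fin (n + 1) → B) (j : Fin (n + 1)) :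
    ∃ (j' : Fin n) (φ : B →ₗ[k] B), ∀ x : B,
      Fin.contractNth i.castSucc (· * ·) (Function.update a j x) =
        Function.update (Fin.contractNth i.castSucc (· * ·) a) j' (φ x) := by
  rcases lt_trichotomy j i.castSucc with h | h | h
  · refine ⟨⟨j, by have := i.2; simp [Fin.lt_def] at h; omega⟩, LinearMap.id, fun x => ?_⟩
    funext l
    simp only [Fin.lt_def, Fin.val_castSucc] at h
    simp only [Fin.contractNth, Function.update_apply, Fin.ext_iff, Fin.val_castSucc,
      Fin.val_succ, LinearMap.id_apply]
    grind
  · refine ⟨i, LinearMap.mulRight k (a i.succ), fun x => ?_⟩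
    funext l
    subst h
    simp only [Fin.contractNth, Function.update_apply, Fin.ext_iff, Fin.val_castSucc,
      Fin.val_succ, LinearMap.mulRight_apply]
    grind
  · by_cases h' : (j : ℕ) = i + 1
    · refine ⟨i, LinearMap.mulLeft k (a i.castSucc), fun x => ?_⟩
      funext l
      simp only [Fin.contractNth, Function.update_apply, Fin.ext_iff, Fin.val_castSucc,
        Fin.val_succ, LinearMap.mulLeft_apply]
      grind
    · refine ⟨⟨j - 1, by have := j.2; simp [Fin.lt_def] at h; omega⟩, LinearMap.id, fun x => ?_⟩
      funext l
      simp only [Fin.lt_def, Fin.val_castSucc] at h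
      simp only [Fin.contractNth, Function.update_apply, Fin.ext_iff, Fin.val_castSucc,
        Fin.val_succ, LinearMap.id_apply]
      grind

/-- `(a₁, …, aₙ₊₁) ↦ f (a₁, …, aᵢ aᵢ₊₁, …, aₙ₊₁)` -/
def hochInner {n : ℕ} (i : Fin n) (f : HochCochain k B n) : HochCochain k B (n + 1) :=
  MultilinearMap.mk' (fun a => f (Fin.contractNth i.castSucc (· * ·) a))
    (fun a j x y => by
      obtain ⟨j', φ, h⟩ := contractNth_update k i a j
      simp [h])
    (fun a j c x => by
      obtain ⟨j', φ, h⟩ := contractNth_update k i a j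
      simp [h])

/-- `(a₁, …, aₙ₊₁) ↦ a₁ f (a₂, …, aₙ₊₁)` -/
def hochLeft {n : ℕ} (f : HochCochain k B n) : HochCochain k B (n + 1) :=
  MultilinearMap.mk' (fun a => a 0 * f (Fin.tail a))
    (fun a j x y => by
      refine Fin.cases ?_ (fun j => ?_) j
      · simp [add_mul]
      · simp [Fin.tail_update_succ, mul_add, Function.update_of_ne (Fin.succ_ne_zero j).symm])
    (fun a j c x => by
      refine Fin.cases ?_ (fun j => ?_) j
      · simp
      · simp [Fin.tail_update_succ, Function.update_of_ne (Fin.succ_ne_zero j).symm])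

/-- `(a₁, …, aₙ₊₁) ↦ f (a₁, …, aₙ) aₙ₊₁` -/
def hochRight {n : ℕ} (f : HochCochain k B n) : HochCochain k B (n + 1) :=
  MultilinearMap.mk' (fun a => f (Fin.init a) * a (Fin.last n))
    (fun a j x y => by
      refine Fin.lastCases ?_ (fun j => ?_) j
      · simp [mul_add]
      · simp [Fin.init_update_castSucc, add_mul, (Fin.castSucc_lt_last j).ne'])
    (fun a j c x => by
      refine Fin.lastCases ?_ (fun j => ?_) j
      · simp
      · simp [Fin.init_update_castSucc, (Fin.castSucc_lt_last j).ne'])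

variable (B)

/-- The Hochschild differential `(δ f)(a₁, …, aₙ₊₁) = a₁ f (a₂, …, aₙ₊₁) +
∑ᵢ (-1)^i f (a₁, …, aᵢ aᵢ₊₁, …, aₙ₊₁) + (-1)^(n+1) f (a₁, …, aₙ) aₙ₊₁`. -/
def hochD (n : ℕ) : HochCochain k B n →ₗ[k] HochCochain k B (n + 1) where
  toFun f := hochLeft k f + ∑ i : Fin n, (-1 : k) ^ ((i : ℕ) + 1) • hochInner k i f
    + (-1 : k) ^ (n + 1) • hochRight k f
  map_add' f g := by
    ext a
    simp [hochLeft, hochInner, hochRight, mul_add, add_mul, Finset.sum_add_distrib]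
    abel
  map_smul' c f := by
    ext a
    simp [hochLeft, hochInner, hochRight, Finset.smul_sum, smul_comm c]

/-- The Hochschild `n`-cocycles. -/
def hochZ (n : ℕ) : Submodule k (HochCochain k B n) := LinearMap.ker (hochD k B n)

/-- The Hochschild `n`-coboundaries. -/
def hochB : (n : ℕ) → Submodule k (HochCochain k B n)
  | 0 => ⊥
  | n + 1 => LinearMap.range (hochD k B n)

/-- The Hochschild cohomology `HH^n(B)` of the `k`-algebra `B`. -/
abbrev HH (n : ℕ) : Type _ := Cohomology (hochZ k B n) (hochB k B n)

end Hochschild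

/-! ### Smash products -/

section Smash

/-- A left action of the bialgebra `H` on `A` making `A` a left `H`-module algebra:
`h ▹ 1 = ε(h) 1` and `h ▹ (a b) = ∑ (h₍₁₎ ▹ a) (h₍₂₎ ▹ b)`. -/
structure ModuleAlgebra (k H A : Type*) [Field k] [Ring H] [Bialgebra k H] [Ring A] [Algebra k A]
    where
  act : H →ₐ[k] Module.End k A
  act_one : ∀ h, act h 1 = algebraMap k A (Coalgebra.counit h)
  act_mul : ∀ h a b, act h (a * b) =
    LinearMap.mul' k A (TensorProduct.map (act.toLinearMap.flip a) (act.toLinearMap.flip b)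
      (Coalgebra.comul h))

variable {k H A : Type*} [Field k] [Ring H] [Bialgebra k H] [Ring A] [Algebra k A]

/-- The smash product `A # H`: the vector space `A ⊗ H` with the multiplication
`(a # h) (b # g) = ∑ a (h₍₁₎ ▹ b) # h₍₂₎ g`. -/
def SmashProduct (_α : ModuleAlgebra k H A) : Type _ := A ⊗[k] H

namespace SmashProduct

variable (α : ModuleAlgebra k H A)

noncomputable instance : AddCommGroup (SmashProduct α) := inferInstanceAs (AddCommGroup (A ⊗[k] H))
noncomputable instance : Module k (SmashProduct α) := inferInstanceAs (Module k (A ⊗[k] H))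

/-- The element `a # h`. -/
def tmul (a : A) (h : H) : SmashProduct α := a ⊗ₜ[k] h

/-- The operator `b # g ↦ ∑ (h₍₁₎ ▹ b) # h₍₂₎ g`, as a function of `h`. -/
noncomputable def opH : H →ₐ[k] Module.End k (A ⊗[k] H) :=
  (Module.endTensorEndAlgHom (R := k) (S := k) (A := k) (M := A) (N := H)).comp
    ((Algebra.TensorProduct.map α.act (Algebra.lmul k H)).comp (Bialgebra.comulAlgHom k H))

/-- `b # g ↦ a b # g`. -/
noncomputable def opA : A →ₐ[k] Module.End k (A ⊗[k] H) :=
  (Module.endTensorEndAlgHom (R := k) (S := k) (A := k) (M := A) (N := H)).comp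
    (Algebra.TensorProduct.includeLeft.comp (Algebra.lmul k A))

/-- Left multiplication: `(a # h) (b # g) = ∑ a (h₍₁₎ ▹ b) # h₍₂₎ g`. -/
noncomputable def opL : A ⊗[k] H →ₗ[k] Module.End k (A ⊗[k] H) :=
  TensorProduct.lift ((LinearMap.mul k (Module.End k (A ⊗[k] H))).compl₁₂
    (opA (k := k) (H := H) (A := A)).toLinearMap (opH α).toLinearMap)

lemma opL_tmul (a : A) (h : H) : opL α (a ⊗ₜ h) = opA a * opH α h := rfl

lemma opA_tmul (a b : A) (g : H) : opA (k := k) a (b ⊗ₜ[k] g) = (a * b) ⊗ₜ g := rfl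

open Coalgebra in
lemma opH_tmul {ι : Type*} (h : H) (r : Coalgebra.Repr k h ι) (b : A) (g : H) :
    opH α h (b ⊗ₜ g) = ∑ i ∈ r.index, α.act (r.left i) b ⊗ₜ[k] (r.right i * g) := by
  simp [opH, ← r.eq, map_sum, LinearMap.sum_apply, Module.endTensorEndAlgHom_apply]

open Coalgebra in
lemma act_mul_repr {ι : Type*} (h : H) (r : Coalgebra.Repr k h ι) (a b : A) :
    α.act h (a * b) = ∑ i ∈ r.index, α.act (r.left i) a * α.act (r.right i) b := by
  rw [α.act_mul, ← r.eq]
  simp [map_sum]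

open Coalgebra in
lemma opH_mul_opA {ι : Type*} (h : H) (r : Coalgebra.Repr k h ι) (b : A) :
    opH α h * opA b = ∑ i ∈ r.index, opA (α.act (r.left i) b) * opH α (r.right i) := by
  apply TensorProduct.ext'
  intro c l
  have key := Coalgebra.sum_tmul_tmul_eq r (fun i => ℛ k (r.left i)) (fun i => ℛ k (r.right i))
  let G : H ⊗[k] (H ⊗[k] H) →ₗ[k] A ⊗[k] H :=
    (LinearMap.rTensor H (LinearMap.mul' k A)) ∘ₗ
    (TensorProduct.assoc k A A H).symm.toLinearMap ∘ₗ
    TensorProduct.map (α.act.toLinearMap.flip b)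
      (TensorProduct.map (α.act.toLinearMap.flip c) (LinearMap.mulRight k l))
  have key' := congrArg G key
  simp only [G, map_sum, LinearMap.comp_apply, TensorProduct.map_tmul, LinearMap.flip_apply,
    AlgHom.toLinearMap_apply, LinearEquiv.coe_coe, TensorProduct.assoc_symm_tmul,
    LinearMap.rTensor_tmul, LinearMap.mul'_apply, LinearMap.mulRight_apply] at key'
  simp only [Module.End.mul_apply, LinearMap.sum_apply, opA_tmul]
  rw [opH_tmul α h r]
  simp only [opH_tmul α _ (ℛ k _), map_sum, opA_tmul]
  rw [← key']
  refine Finset.sum_congr rfl fun i _ => ?_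
  rw [act_mul_repr α _ (ℛ k (r.left i)), TensorProduct.sum_tmul]

lemma opL_opL (X Y : A ⊗[k] H) : opL α (opL α X Y) = opL α X * opL α Y := by
  induction X with
  | zero => simp
  | add X X' hX hX' => simp [add_mul, hX, hX']
  | tmul a h =>
    induction Y with
    | zero => simp
    | add Y Y' hY hY' => simp [mul_add, hY, hY']
    | tmul b g =>
      have r := Coalgebra.Repr.arbitrary k h
      rw [opL_tmul, opL_tmul, Module.End.mul_apply, opH_tmul α h r,
        show opA a * opH α h * (opA b * opH α g) = opA a * (opH α h * opA b) * opH α g by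
          simp only [mul_assoc], opH_mul_opA α h r]
      simp only [map_sum, opA_tmul, opL_tmul, map_mul, Finset.mul_sum, Finset.sum_mul, mul_assoc]

lemma opL_one (X : A ⊗[k] H) : opL α X (1 ⊗ₜ 1) = X := by
  induction X with
  | zero => simp
  | add X X' hX hX' => simp [hX, hX']
  | tmul a h =>
    have r := Coalgebra.Repr.arbitrary k h
    rw [opL_tmul, Module.End.mul_apply, opH_tmul α h r]
    simp only [map_sum, opA_tmul, α.act_one, mul_one, Algebra.algebraMap_eq_smul_one,
      TensorProduct.smul_tmul]
    rw [← TensorProduct.tmul_sum, Coalgebra.sum_counit_smul]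

noncomputable instance : Ring (SmashProduct α) where
  mul X Y := opL α X Y
  one := (1 : A) ⊗ₜ[k] (1 : H)
  left_distrib X Y Z := map_add (opL α X) Y Z
  right_distrib X Y Z := by
    exact DFunLike.congr_fun (map_add (opL α) X Y) Z
  zero_mul X := DFunLike.congr_fun (map_zero (opL α)) X
  mul_zero X := map_zero (opL α X)
  mul_assoc X Y Z := DFunLike.congr_fun (opL_opL α X Y) Z
  one_mul X := by
    change opL α ((1 : A) ⊗ₜ[k] (1 : H)) X = X
    rw [opL_tmul, map_one, map_one, mul_one]; rfl
  mul_one X := opL_one α X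
  neg_add_cancel := neg_add_cancel
  zsmul := (· • ·)
  zsmul_zero' := SubNegMonoid.zsmul_zero'
  zsmul_succ' := SubNegMonoid.zsmul_succ'
  zsmul_neg' := SubNegMonoid.zsmul_neg'
  nsmul := (· • ·)
  nsmul_zero := AddMonoid.nsmul_zero
  nsmul_succ := AddMonoid.nsmul_succ
  sub_eq_add_neg := sub_eq_add_neg

noncomputable instance : Algebra k (SmashProduct α) :=
  Algebra.ofModule
    (fun r X Y => DFunLike.congr_fun (map_smul (opL α) r X) Y)
    (fun r X Y => map_smul (opL α X) r Y)

lemma tmul_mul_tmul (a b : A) (h g : H) : tmul α a h * tmul α b g =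
    opA a (opH α h (b ⊗ₜ g)) := rfl

end SmashProduct
end Smash

section KPdef

/-! ### The Kac–Paljutkin Hopf algebra -/

/-- Names of the generators of `H`. -/
inductive KPGen | x | y | z

variable (k : Type*) [Field k]

open FreeAlgebra in
/-- `x² = y² = 1`, `z² = ½ (1 + x + y - x y)`, `y x = x y`, `z x = y z`, `z y = x z`. -/
inductive KPRel : FreeAlgebra k KPGen → FreeAlgebra k KPGen → Prop
  | xx : KPRel (ι k .x * ι k .x) 1
  | yy : KPRel (ι k .y * ι k .y) 1
  | zz : KPRel (ι k .z * ι k .z)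
      ((2⁻¹ : k) • (1 + ι k .x + ι k .y - ι k .x * ι k .y))
  | yx : KPRel (ι k .y * ι k .x) (ι k .x * ι k .y)
  | zx : KPRel (ι k .z * ι k .x) (ι k .y * ι k .z)
  | zy : KPRel (ι k .z * ι k .y) (ι k .x * ι k .z)

/-- The algebra `H` generated by `x`, `y`, `z` with the above relations. -/
def KP : Type _ := RingQuot (KPRel k)

namespace KP
noncomputable instance : Ring (KP k) := inferInstanceAs (Ring (RingQuot (KPRel k)))
noncomputable instance : Algebra k (KP k) := inferInstanceAs (Algebra k (RingQuot (KPRel k)))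

noncomputable def mk : FreeAlgebra k KPGen →ₐ[k] KP k := RingQuot.mkAlgHom k (KPRel k)

variable {k}
/-- The generators `x`, `y`, `z` of `H`. -/
noncomputable def gen (g : KPGen) : KP k := mk k (FreeAlgebra.ι k g)

lemma mk_rel {a b : FreeAlgebra k KPGen} (h : KPRel k a b) : mk k a = mk k b :=
  RingQuot.mkAlgHom_rel k h

lemma mk_surjective : Function.Surjective (mk k) := RingQuot.mkAlgHom_surjective k (KPRel k)

lemma xx : (gen .x * gen .x : KP k) = 1 := by
  simpa only [gen, map_mul, map_add, map_sub, map_smul, map_one] using mk_rel (KPRel.xx (k := k))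
lemma yy : (gen .y * gen .y : KP k) = 1 := by
  simpa only [gen, map_mul, map_add, map_sub, map_smul, map_one] using mk_rel (KPRel.yy (k := k))
lemma zz : (gen .z * gen .z : KP k) =
    (2⁻¹ : k) • (1 + gen .x + gen .y - gen .x * gen .y) := by
  simpa only [gen, map_mul, map_add, map_sub, map_smul, map_one] using mk_rel (KPRel.zz (k := k))
lemma yx : (gen .y * gen .x : KP k) = gen .x * gen .y := by
  simpa only [gen, map_mul, map_add, map_sub, map_smul, map_one] using mk_rel (KPRel.yx (k := k))
lemma zx : (gen .z * gen .x : KP k) = gen .y * gen .z := by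
  simpa only [gen, map_mul, map_add, map_sub, map_smul, map_one] using mk_rel (KPRel.zx (k := k))
lemma zy : (gen .z * gen .y : KP k) = gen .x * gen .z := by
  simpa only [gen, map_mul, map_add, map_sub, map_smul, map_one] using mk_rel (KPRel.zy (k := k))

section lift
variable {R : Type*} [Ring R] [Algebra k R]

noncomputable def lift (X Y Z : R) (hxx : X * X = 1) (hyy : Y * Y = 1)
    (hzz : Z * Z = (2⁻¹ : k) • (1 + X + Y - X * Y)) (hyx : Y * X = X * Y)
    (hzx : Z * X = Y * Z) (hzy : Z * Y = X * Z) : KP k →ₐ[k] R :=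
  RingQuot.liftAlgHom k ⟨FreeAlgebra.lift k (fun g => KPGen.casesOn g X Y Z), by
    intro a b h
    cases h <;> simpa⟩

variable (X Y Z : R) (hxx : X * X = 1) (hyy : Y * Y = 1)
    (hzz : Z * Z = (2⁻¹ : k) • (1 + X + Y - X * Y)) (hyx : Y * X = X * Y)
    (hzx : Z * X = Y * Z) (hzy : Z * Y = X * Z)

@[simp] lemma lift_x : lift X Y Z hxx hyy hzz hyx hzx hzy (gen .x) = X :=
  (RingQuot.liftAlgHom_mkAlgHom_apply k _ _ _).trans (FreeAlgebra.lift_ι_apply _ _)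
@[simp] lemma lift_y : lift X Y Z hxx hyy hzz hyx hzx hzy (gen .y) = Y :=
  (RingQuot.liftAlgHom_mkAlgHom_apply k _ _ _).trans (FreeAlgebra.lift_ι_apply _ _)
@[simp] lemma lift_z : lift X Y Z hxx hyy hzz hyx hzx hzy (gen .z) = Z :=
  (RingQuot.liftAlgHom_mkAlgHom_apply k _ _ _).trans (FreeAlgebra.lift_ι_apply _ _)

lemma algHom_ext {f g : KP k →ₐ[k] R} (hx : f (gen .x) = g (gen .x))
    (hy : f (gen .y) = g (gen .y)) (hz : f (gen .z) = g (gen .z)) : f = g := by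
  refine RingQuot.ringQuot_ext' (S := k) _ _ ?_
  apply FreeAlgebra.hom_ext
  funext i
  cases i
  exacts [hx, hy, hz]

lemma induction {P : KP k → Prop} (hc : ∀ c : k, P (algebraMap k _ c))
    (hx : P (gen .x)) (hy : P (gen .y)) (hz : P (gen .z))
    (hadd : ∀ a b, P a → P b → P (a + b)) (hmul : ∀ a b, P a → P b → P (a * b))
    (a : KP k) : P a := by
  obtain ⟨a, rfl⟩ := mk_surjective a
  induction a with
  | grade0 r => simpa using hc r
  | grade1 i => cases i; exacts [hx, hy, hz]
  | add a b ha hb => simpa using hadd _ _ ha hb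
  | mul a b ha hb => simpa using hmul _ _ ha hb

end lift

section rew
lemma xx' (a : KP k) : gen .x * (gen .x * a) = a := by rw [← mul_assoc, xx, one_mul]
lemma yy' (a : KP k) : gen .y * (gen .y * a) = a := by rw [← mul_assoc, yy, one_mul]
lemma yx' (a : KP k) : gen .y * (gen .x * a) = gen .x * (gen .y * a) := by
  rw [← mul_assoc, yx, mul_assoc]
lemma zx' (a : KP k) : gen .z * (gen .x * a) = gen .y * (gen .z * a) := by
  rw [← mul_assoc, zx, mul_assoc]
lemma zy' (a : KP k) : gen .z * (gen .y * a) = gen .x * (gen .z * a) := by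
  rw [← mul_assoc, zy, mul_assoc]
lemma zz' (a : KP k) : gen .z * (gen .z * a) =
    (2⁻¹ : k) • (1 + gen .x + gen .y - gen .x * gen .y) * a := by
  rw [← mul_assoc, zz]
end rew

/-- `½ (1 ⊗ 1 + 1 ⊗ x + y ⊗ 1 - y ⊗ x) (z ⊗ z)` -/
noncomputable def comulZ : KP k ⊗[k] KP k :=
  (2⁻¹ : k) • (1 ⊗ₜ 1 + 1 ⊗ₜ gen .x + gen .y ⊗ₜ 1 - gen .y ⊗ₜ gen .x) * (gen .z ⊗ₜ gen .z)

/-- The antipode of `H`, as a homomorphism to the opposite algebra. -/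
noncomputable def antipodeHom : KP k →ₐ[k] (KP k)ᵐᵒᵖ :=
  lift (.op (gen .x)) (.op (gen .y)) (.op (gen .z))
    (by rw [← MulOpposite.op_mul, xx]; rfl) (by rw [← MulOpposite.op_mul, yy]; rfl)
    (by rw [← MulOpposite.op_mul, zz, ← MulOpposite.op_mul, yx]; simp)
    (by rw [← MulOpposite.op_mul, ← MulOpposite.op_mul, yx])
    (by rw [← MulOpposite.op_mul, ← MulOpposite.op_mul, zy])
    (by rw [← MulOpposite.op_mul, ← MulOpposite.op_mul, zx])

noncomputable def antipodeLin : KP k →ₗ[k] KP k :=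
  (MulOpposite.opLinearEquiv k).symm.toLinearMap ∘ₗ antipodeHom.toLinearMap

lemma antipodeLin_mul (a b : KP k) : antipodeLin (a * b) = antipodeLin b * antipodeLin a := by
  simp [antipodeLin]
@[simp] lemma antipodeLin_one : antipodeLin (1 : KP k) = 1 := by simp [antipodeLin]
@[simp] lemma antipodeHom_x : antipodeHom (gen .x : KP k) = .op (gen .x) := lift_x _ _ _ _ _ _ _ _ _
@[simp] lemma antipodeHom_y : antipodeHom (gen .y : KP k) = .op (gen .y) := lift_y _ _ _ _ _ _ _ _ _
@[simp] lemma antipodeHom_z : antipodeHom (gen .z : KP k) = .op (gen .z) := lift_z _ _ _ _ _ _ _ _ _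
@[simp] lemma antipodeLin_x : antipodeLin (gen .x : KP k) = gen .x := by simp [antipodeLin]
@[simp] lemma antipodeLin_y : antipodeLin (gen .y : KP k) = gen .y := by simp [antipodeLin]
@[simp] lemma antipodeLin_z : antipodeLin (gen .z : KP k) = gen .z := by simp [antipodeLin]

lemma antipode_left_aux (T : KP k ⊗[k] KP k) (b c : KP k) :
    LinearMap.mul' k (KP k) (antipodeLin.rTensor (KP k) (T * b ⊗ₜ c)) =
      antipodeLin b * LinearMap.mul' k (KP k) (antipodeLin.rTensor (KP k) T) * c := by
  induction T with
  | zero => simp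
  | add T T' h h' => simp only [add_mul, map_add, h, h', mul_add]
  | tmul s t => simp [antipodeLin_mul, mul_assoc]

lemma antipode_right_aux (T : KP k ⊗[k] KP k) (b c : KP k) :
    LinearMap.mul' k (KP k) (antipodeLin.lTensor (KP k) (b ⊗ₜ c * T)) =
      b * LinearMap.mul' k (KP k) (antipodeLin.lTensor (KP k) T) * antipodeLin c := by
  induction T with
  | zero => simp
  | add T T' h h' => simp only [add_mul, map_add, h, h', mul_add]
  | tmul s t => simp [antipodeLin_mul, mul_assoc]

variable [NeZero (2 : k)]

lemma comulZ_mul_self : (comulZ : KP k ⊗[k] KP k) * comulZ = (2⁻¹ : k) • (1 + gen .x ⊗ₜ gen .x +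
    gen .y ⊗ₜ gen .y - gen .x ⊗ₜ gen .x * gen .y ⊗ₜ gen .y) := by
  have h2 : (2 : k) ≠ 0 := two_ne_zero
  simp only [comulZ, Algebra.TensorProduct.one_def, smul_mul_assoc, mul_smul_comm, add_mul,
    sub_mul, mul_add, mul_sub, Algebra.TensorProduct.tmul_mul_tmul, one_mul, mul_one,
    mul_assoc, xx, yy, zz, yx, zx, zy, xx', yy', yx', zx', zy', zz',
    ← TensorProduct.smul_tmul', TensorProduct.tmul_smul, TensorProduct.add_tmul,
    TensorProduct.tmul_add, TensorProduct.sub_tmul, TensorProduct.tmul_sub]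
  match_scalars <;> field_simp <;> ring

lemma comulZ_mul_x : (comulZ : KP k ⊗[k] KP k) * gen .x ⊗ₜ gen .x =
    gen .y ⊗ₜ gen .y * comulZ := by
  simp [comulZ, add_mul, sub_mul, mul_add, mul_sub, mul_assoc, xx, yy, yx, zx, zy, xx', yy',
    yx', zx', zy']

lemma comulZ_mul_y : (comulZ : KP k ⊗[k] KP k) * gen .y ⊗ₜ gen .y =
    gen .x ⊗ₜ gen .x * comulZ := by
  simp [comulZ, add_mul, sub_mul, mul_add, mul_sub, mul_assoc, xx, yy, yx, zx, zy, xx', yy',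
    yx', zx', zy']

lemma tmul_xx : (gen .x ⊗ₜ gen .x * gen .x ⊗ₜ gen .x : KP k ⊗[k] KP k) = 1 := by
  simp [xx, Algebra.TensorProduct.one_def]

lemma tmul_yy : (gen .y ⊗ₜ gen .y * gen .y ⊗ₜ gen .y : KP k ⊗[k] KP k) = 1 := by
  simp [yy, Algebra.TensorProduct.one_def]

lemma tmul_yx : (gen .y ⊗ₜ gen .y * gen .x ⊗ₜ gen .x : KP k ⊗[k] KP k) =
    gen .x ⊗ₜ gen .x * gen .y ⊗ₜ gen .y := by
  simp [yx]

/-- The comultiplication of `H`, an algebra homomorphism. -/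
noncomputable def comulHom : KP k →ₐ[k] KP k ⊗[k] KP k :=
  lift (gen .x ⊗ₜ gen .x) (gen .y ⊗ₜ gen .y) comulZ tmul_xx tmul_yy comulZ_mul_self tmul_yx
    comulZ_mul_x comulZ_mul_y

@[simp] lemma comulHom_x : comulHom (gen .x : KP k) = gen .x ⊗ₜ gen .x :=
  lift_x _ _ _ tmul_xx tmul_yy comulZ_mul_self tmul_yx comulZ_mul_x comulZ_mul_y
@[simp] lemma comulHom_y : comulHom (gen .y : KP k) = gen .y ⊗ₜ gen .y :=
  lift_y _ _ _ tmul_xx tmul_yy comulZ_mul_self tmul_yx comulZ_mul_x comulZ_mul_y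
@[simp] lemma comulHom_z : comulHom (gen .z : KP k) = comulZ :=
  lift_z _ _ _ tmul_xx tmul_yy comulZ_mul_self tmul_yx comulZ_mul_x comulZ_mul_y

/-- The counit of `H`. -/
noncomputable def counitHom : KP k →ₐ[k] k :=
  lift 1 1 1 (by simp) (by simp)
    (by have h2 : (2 : k) ≠ 0 := two_ne_zero
        simp only [smul_eq_mul]; field_simp; ring)
    (by simp) (by simp) (by simp)

@[simp] lemma counitHom_x : counitHom (gen .x : KP k) = 1 := lift_x _ _ _ _ _ _ _ _ _
@[simp] lemma counitHom_y : counitHom (gen .y : KP k) = 1 := lift_y _ _ _ _ _ _ _ _ _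
@[simp] lemma counitHom_z : counitHom (gen .z : KP k) = 1 := lift_z _ _ _ _ _ _ _ _ _

/-- `Δ(x) = x ⊗ x`, `Δ(y) = y ⊗ y`, `Δ(z) = ½ (1 ⊗ 1 + 1 ⊗ x + y ⊗ 1 - y ⊗ x) (z ⊗ z)` and
`ε(x) = ε(y) = ε(z) = 1`. -/
noncomputable instance : Bialgebra k (KP k) :=
  Bialgebra.ofAlgHom comulHom counitHom
    (by
      apply algHom_ext
      · simp
      · simp
      · simp only [AlgHom.comp_apply, comulHom_z, comulZ, map_mul, map_smul, map_add, map_sub,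
          Algebra.TensorProduct.map_tmul, map_one, comulHom_x, comulHom_y, AlgHom.id_apply,
          add_mul, sub_mul, mul_add, mul_sub,
          TensorProduct.tmul_add, TensorProduct.add_tmul,
          TensorProduct.sub_tmul, TensorProduct.tmul_sub, smul_mul_assoc, mul_smul_comm,
          ← TensorProduct.smul_tmul', TensorProduct.tmul_smul, mul_assoc,
          Algebra.TensorProduct.one_def, Algebra.TensorProduct.tmul_mul_tmul, one_mul, mul_one,
          AlgEquiv.coe_toAlgHom, Algebra.TensorProduct.assoc_tmul,
          xx, yy, zz, yx, zx, zy, xx', yy', yx', zx', zy', zz']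
        module)
    (by
      apply algHom_ext
      · simp
      · simp
      · have h2 : (2 : k) ≠ 0 := two_ne_zero
        simp [comulZ, add_mul, sub_mul]
        match_scalars <;> field_simp <;> ring)
    (by
      apply algHom_ext
      · simp
      · simp
      · have h2 : (2 : k) ≠ 0 := two_ne_zero
        simp [comulZ, add_mul, sub_mul]
        match_scalars <;> field_simp <;> ring)

@[simp] lemma comul_eq (a : KP k) : Coalgebra.comul a = comulHom a := rfl
@[simp] lemma counit_eq (a : KP k) : Coalgebra.counit a = counitHom a := rfl

lemma antipode_left (a : KP k) :
    LinearMap.mul' k (KP k) (antipodeLin.rTensor (KP k) (comulHom a)) =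
      algebraMap k (KP k) (counitHom a) := by
  have h2 : (2 : k) ≠ 0 := two_ne_zero
  induction a using induction with
  | hc c => simp [Algebra.algebraMap_eq_smul_one, Algebra.TensorProduct.one_def]
  | hx => simp [xx]
  | hy => simp [yy]
  | hz =>
    simp [comulZ, add_mul, sub_mul, antipodeLin_mul, mul_assoc, mul_add, mul_sub,
      xx, yy, zz, yx, zx, zy, xx', yy', yx', zx', zy', zz']
    match_scalars <;> field_simp <;> ring
  | hadd a b ha hb => simp only [map_add, ha, hb]
  | hmul a b ha hb =>
    rw [map_mul comulHom, map_mul counitHom, map_mul (algebraMap k (KP k)), ← hb]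
    generalize comulHom b = T
    induction T with
    | zero => simp
    | add T T' h h' => simp only [mul_add, map_add, h, h']
    | tmul s t =>
      rw [antipode_left_aux, ha, ← Algebra.commutes, mul_assoc]
      simp

lemma antipode_right (a : KP k) :
    LinearMap.mul' k (KP k) (antipodeLin.lTensor (KP k) (comulHom a)) =
      algebraMap k (KP k) (counitHom a) := by
  have h2 : (2 : k) ≠ 0 := two_ne_zero
  induction a using induction with
  | hc c => simp [Algebra.algebraMap_eq_smul_one, Algebra.TensorProduct.one_def]
  | hx => simp [xx]
  | hy => simp [yy]
  | hz =>
    simp [comulZ, add_mul, sub_mul, antipodeLin_mul, mul_assoc, mul_add, mul_sub,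
      xx, yy, zz, yx, zx, zy, xx', yy', yx', zx', zy', zz']
    match_scalars <;> field_simp <;> ring
  | hadd a b ha hb => simp only [map_add, ha, hb]
  | hmul a b ha hb =>
    rw [map_mul comulHom, map_mul counitHom, map_mul (algebraMap k (KP k)), ← ha]
    generalize comulHom a = T
    induction T with
    | zero => simp
    | add T T' h h' => simp only [add_mul, map_add, h, h']
    | tmul s t =>
      rw [antipode_right_aux, hb, ← Algebra.commutes, mul_assoc, Algebra.commutes]
      simp

/-- `H` with `S(x) = x`, `S(y) = y`, `S(z) = z`. -/
noncomputable instance : HopfAlgebra k (KP k) where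
  antipode := antipodeLin
  mul_antipode_rTensor_comul := LinearMap.ext antipode_left
  mul_antipode_lTensor_comul := LinearMap.ext antipode_right

end KP

end KPdef
/-! ### The quantum `(-1)`-plane -/

/-- Names of the generators of `A`. -/
inductive PlaneGen | u | v

open FreeAlgebra in
/-- The relation `u v + v u = 0`. -/
inductive PlaneRel (k : Type*) [Field k] : FreeAlgebra k PlaneGen → FreeAlgebra k PlaneGen → Prop
  | anti : PlaneRel k (ι k .u * ι k .v + ι k .v * ι k .u) 0

/-- The quantum `(-1)`-plane `A = k⟨u, v⟩ / (u v + v u)`. -/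
def QPlane (k : Type*) [Field k] : Type _ := RingQuot (PlaneRel k)

namespace QPlane

variable (k : Type*) [Field k]

noncomputable instance : Ring (QPlane k) := inferInstanceAs (Ring (RingQuot (PlaneRel k)))
noncomputable instance : Algebra k (QPlane k) :=
  inferInstanceAs (Algebra k (RingQuot (PlaneRel k)))

noncomputable def mk : FreeAlgebra k PlaneGen →ₐ[k] QPlane k := RingQuot.mkAlgHom k (PlaneRel k)

variable {k}

noncomputable def u : QPlane k := mk k (FreeAlgebra.ι k .u)
noncomputable def v : QPlane k := mk k (FreeAlgebra.ι k .v)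

lemma uv_add_vu : (u * v + v * u : QPlane k) = 0 := by
  have h : mk k _ = mk k _ := RingQuot.mkAlgHom_rel k (PlaneRel.anti (k := k))
  simpa only [u, v, map_mul, map_add, map_zero] using h

variable {R : Type*} [Ring R] [Algebra k R]

noncomputable def lift (U V : R) (h : U * V + V * U = 0) : QPlane k →ₐ[k] R :=
  RingQuot.liftAlgHom k ⟨FreeAlgebra.lift k (fun g => PlaneGen.casesOn g U V), by
    intro a b h
    cases h
    simpa⟩

@[simp] lemma lift_u (U V : R) (h : U * V + V * U = 0) : lift (k := k) U V h u = U :=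
  (RingQuot.liftAlgHom_mkAlgHom_apply k _ _ _).trans (FreeAlgebra.lift_ι_apply _ _)
@[simp] lemma lift_v (U V : R) (h : U * V + V * U = 0) : lift (k := k) U V h v = V :=
  (RingQuot.liftAlgHom_mkAlgHom_apply k _ _ _).trans (FreeAlgebra.lift_ι_apply _ _)

lemma algHom_ext {f g : QPlane k →ₐ[k] R} (hu : f u = g u) (hv : f v = g v) : f = g := by
  refine RingQuot.ringQuot_ext' (S := k) _ _ ?_
  apply FreeAlgebra.hom_ext
  funext i
  cases i
  exacts [hu, hv]

/-- The algebra endomorphism `u ↦ q⁻¹ v`, `v ↦ q u` of `A`. -/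
noncomputable def swap (q : kˣ) : QPlane k →ₐ[k] QPlane k :=
  lift ((q⁻¹ : k) • v) ((q : k) • u) (by
    have h := uv_add_vu (k := k)
    rw [add_comm] at h
    simpa [smul_smul] using h)

lemma swap_comp_swap (q : kˣ) : (swap q).comp (swap q) = AlgHom.id k (QPlane k) := by
  apply algHom_ext <;> simp [swap, smul_smul]

lemma swap_mul_swap (q : kˣ) :
    ((swap q).toLinearMap * (swap q).toLinearMap : Module.End k (QPlane k)) = 1 :=
  congrArg AlgHom.toLinearMap (swap_comp_swap q)

variable [NeZero (2 : k)]

/-- The action of `H` on `A`: `x` and `y` act trivially, and `z ▹ u = q⁻¹ v`, `z ▹ v = q u`. -/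
noncomputable def actHom (q : kˣ) : KP k →ₐ[k] Module.End k (QPlane k) :=
  KP.lift 1 1 (swap q).toLinearMap (by simp) (by simp)
    (by
      have h2 : (2 : k) ≠ 0 := two_ne_zero
      rw [swap_mul_swap, mul_one]
      match_scalars
      field_simp
      ring)
    (by simp) (by simp) (by simp)

@[simp] lemma actHom_x (q : kˣ) : actHom q (KP.gen .x) = 1 := KP.lift_x _ _ _ _ _ _ _ _ _
@[simp] lemma actHom_y (q : kˣ) : actHom q (KP.gen .y) = 1 := KP.lift_y _ _ _ _ _ _ _ _ _
@[simp] lemma actHom_z (q : kˣ) : actHom q (KP.gen .z) = (swap q).toLinearMap :=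
  KP.lift_z _ _ _ _ _ _ _ _ _

lemma actHom_mul_aux (q : kˣ) (T : KP k ⊗[k] KP k) (a b : QPlane k) :
    LinearMap.mul' k (QPlane k) (TensorProduct.map ((actHom q).toLinearMap.flip a)
      ((actHom q).toLinearMap.flip b) T) =
    LinearMap.mul' k (QPlane k) (Module.endTensorEndAlgHom (R := k) (S := k) (A := k)
      (Algebra.TensorProduct.map (actHom q) (actHom q) T) (a ⊗ₜ b)) := by
  induction T with
  | zero => simp
  | add T T' h h' => simp only [map_add, h, h', LinearMap.add_apply]
  | tmul s t => simp [Module.endTensorEndAlgHom_apply]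

lemma actHom_mul (q : kˣ) (h : KP k) :
    LinearMap.mul' k (QPlane k) ∘ₗ (Module.endTensorEndAlgHom (R := k) (S := k) (A := k)
      (Algebra.TensorProduct.map (actHom q) (actHom q) (KP.comulHom h))) =
    actHom q h ∘ₗ LinearMap.mul' k (QPlane k) := by
  have h2 : (2 : k) ≠ 0 := two_ne_zero
  induction h using KP.induction with
  | hc c =>
    apply TensorProduct.ext'
    intro a b
    simp [Algebra.algebraMap_eq_smul_one, Algebra.TensorProduct.one_def,
      Module.endTensorEndAlgHom_apply]
  | hx => apply TensorProduct.ext'; intro a b; simp [Module.endTensorEndAlgHom_apply]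
  | hy => apply TensorProduct.ext'; intro a b; simp [Module.endTensorEndAlgHom_apply]
  | hz =>
    apply TensorProduct.ext'
    intro a b
    simp [Module.endTensorEndAlgHom_apply, KP.comulZ, add_mul, sub_mul]
    match_scalars
    field_simp
    ring
  | hadd a b ha hb => simp only [map_add, LinearMap.comp_add, LinearMap.add_comp, ha, hb]
  | hmul a b ha hb =>
    simp only [map_mul, Module.End.mul_eq_comp]
    rw [← LinearMap.comp_assoc, ha, LinearMap.comp_assoc, hb, LinearMap.comp_assoc]

/-- `A` as a left `H`-module algebra. -/
noncomputable def action (q : kˣ) : ModuleAlgebra k (KP k) (QPlane k) where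
  act := actHom q
  act_one h := by
    have h2 : (2 : k) ≠ 0 := two_ne_zero
    rw [KP.counit_eq]
    induction h using KP.induction with
    | hc c => simp [Algebra.algebraMap_eq_smul_one]
    | hx => simp
    | hy => simp
    | hz => simp
    | hadd a b ha hb => simp [ha, hb]
    | hmul a b ha hb => simp [hb, Algebra.algebraMap_eq_smul_one, ha, smul_smul, mul_comm]
  act_mul h a b := by
    rw [KP.comul_eq, actHom_mul_aux]
    exact (DFunLike.congr_fun (actHom_mul q h) (a ⊗ₜ b)).symm

end QPlane

/-- The smash product `B = A # H`. -/
abbrev KPSmash {k : Type*} [Field k] [NeZero (2 : k)] (q : kˣ) : Type _ :=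
  SmashProduct (QPlane.action q)

/-! ### The Koszul dual -/

/-- The ideal `(u^{*2}, v^{*2})` of the polynomial ring `k[u^*, v^*]`. -/
noncomputable def dualIdeal (k : Type*) [Field k] : Ideal (MvPolynomial (Fin 2) k) :=
  Ideal.span {MvPolynomial.X 0 ^ 2, MvPolynomial.X 1 ^ 2}

/-- The Koszul dual `A^! = k[u^*, v^*] / (u^{*2}, v^{*2})` of `A`. -/
def PlaneDual (k : Type*) [Field k] : Type _ := MvPolynomial (Fin 2) k ⧸ dualIdeal k

namespace PlaneDual

variable (k : Type*) [Field k]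

noncomputable instance : CommRing (PlaneDual k) :=
  inferInstanceAs (CommRing (MvPolynomial (Fin 2) k ⧸ dualIdeal k))
noncomputable instance : Algebra k (PlaneDual k) :=
  inferInstanceAs (Algebra k (MvPolynomial (Fin 2) k ⧸ dualIdeal k))

noncomputable def mk : MvPolynomial (Fin 2) k →ₐ[k] PlaneDual k :=
  Ideal.Quotient.mkₐ k (dualIdeal k)

/-- The homogeneous component `A^!_m`, the image of the homogeneous polynomials of degree `m`. -/
noncomputable def degree (m : ℕ) : Submodule k (PlaneDual k) :=
  (MvPolynomial.homogeneousSubmodule (Fin 2) k m).map (mk k).toLinearMap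

variable {k}

/-- The generator `u^*`. -/
noncomputable def us : PlaneDual k := mk k (MvPolynomial.X 0)
/-- The generator `v^*`. -/
noncomputable def vs : PlaneDual k := mk k (MvPolynomial.X 1)

lemma us_sq : (us * us : PlaneDual k) = 0 := by
  rw [us, ← map_mul, ← pow_two]
  exact Ideal.Quotient.eq_zero_iff_mem.2 (Ideal.subset_span (by simp))
lemma vs_sq : (vs * vs : PlaneDual k) = 0 := by
  rw [vs, ← map_mul, ← pow_two]
  exact Ideal.Quotient.eq_zero_iff_mem.2 (Ideal.subset_span (by simp))

/-- The algebra endomorphism `u^* ↦ q v^*`, `v^* ↦ q⁻¹ u^*` of `A^!`. -/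
noncomputable def swap (q : kˣ) : PlaneDual k →ₐ[k] PlaneDual k :=
  Ideal.Quotient.liftₐ (dualIdeal k) (MvPolynomial.aeval ![(q : k) • vs, (q⁻¹ : k) • us]) (by
    intro a ha
    rw [← RingHom.mem_ker]
    refine (Ideal.span_le.2 ?_) ha
    rintro p (rfl | rfl) <;>
      simp [RingHom.mem_ker, pow_two, smul_mul_smul_comm, us_sq, vs_sq])

@[simp] lemma swap_us (q : kˣ) : swap q us = (q : k) • vs := by
  change MvPolynomial.aeval ![(q : k) • vs, (q⁻¹ : k) • us] (MvPolynomial.X 0) = _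
  simp
@[simp] lemma swap_vs (q : kˣ) : swap q vs = (q⁻¹ : k) • us := by
  change MvPolynomial.aeval ![(q : k) • vs, (q⁻¹ : k) • us] (MvPolynomial.X 1) = _
  simp

lemma swap_comp_swap (q : kˣ) : (swap q).comp (swap q) = AlgHom.id k (PlaneDual k) := by
  apply Ideal.Quotient.algHom_ext
  apply MvPolynomial.algHom_ext
  intro i
  fin_cases i
  · change swap q (swap q us) = us
    simp [smul_smul]
  · change swap q (swap q vs) = vs
    simp [smul_smul]

/-- The right action of `H` on `A^!`, `dualAct q h ξ = ξ ◃ h`, as a homomorphism to the opposite of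
`End A^!`. It is determined by `(ξ ◃ h)(w) = ξ(h ▹ w)` for `ξ` in the dual of the span of `u, v`, and
by `(ξ η) ◃ h = ∑ (ξ ◃ h₍₁₎) (η ◃ h₍₂₎)`: `x`, `y` act as the identity and `z` acts
by the algebra endomorphism `u^* ↦ q v^*`, `v^* ↦ q⁻¹ u^*`. -/
noncomputable def dualActHom [NeZero (2 : k)] (q : kˣ) :
    KP k →ₐ[k] (Module.End k (PlaneDual k))ᵐᵒᵖ :=
  KP.lift 1 1 (.op (swap q).toLinearMap) (by simp) (by simp)
    (by
      have h2 : (2 : k) ≠ 0 := two_ne_zero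
      have h : ((swap q).toLinearMap * (swap q).toLinearMap : Module.End k (PlaneDual k)) = 1 :=
        congrArg AlgHom.toLinearMap (swap_comp_swap q)
      rw [← MulOpposite.op_mul, h, mul_one, MulOpposite.op_one]
      match_scalars
      field_simp
      ring)
    (by simp) (by simp) (by simp)

noncomputable def dualAct [NeZero (2 : k)] (q : kˣ) : KP k →ₗ[k] Module.End k (PlaneDual k) :=
  (MulOpposite.opLinearEquiv k).symm.toLinearMap ∘ₗ (dualActHom q).toLinearMap

end PlaneDual

/-! ### The differential graded algebra `A^! ⊗ B` -/

section Koszul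

open SmashProduct

variable {k : Type*} [Field k] [NeZero (2 : k)] (q : kˣ)

/-- The algebra `A^! ⊗ (A # H)`. -/
abbrev Kos : Type _ := PlaneDual k ⊗[k] KPSmash q

/-- The image of `a ∈ A` in `A # H`. -/
noncomputable def inA (a : QPlane k) : KPSmash q := tmul (QPlane.action q) a 1

/-- The image of `h ∈ H` in `A # H`. -/
noncomputable def inH : KP k →ₗ[k] KPSmash q :=
  TensorProduct.mk k (QPlane k) (KP k) 1

/-- The component `A^!_m ⊗ (A # H)` of cohomological degree `m`. -/
noncomputable def kosCochain (m : ℕ) : Submodule k (Kos q) :=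
  LinearMap.range ((PlaneDual.degree k m).subtype.rTensor (KPSmash q))

/-- `ξ ⊗ b ↦ u^* ξ ⊗ u b + v^* ξ ⊗ v b` -/
noncomputable def kosL : Kos q →ₗ[k] Kos q :=
  TensorProduct.map (LinearMap.mulLeft k (PlaneDual.us : PlaneDual k))
    (LinearMap.mulLeft k (inA q QPlane.u)) +
  TensorProduct.map (LinearMap.mulLeft k (PlaneDual.vs : PlaneDual k))
    (LinearMap.mulLeft k (inA q QPlane.v))

/-- `ξ ⊗ b ↦ ξ u^* ⊗ b u + ξ v^* ⊗ b v` -/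
noncomputable def kosR : Kos q →ₗ[k] Kos q :=
  TensorProduct.map (LinearMap.mulRight k (PlaneDual.us : PlaneDual k))
    (LinearMap.mulRight k (inA q QPlane.u)) +
  TensorProduct.map (LinearMap.mulRight k (PlaneDual.vs : PlaneDual k))
    (LinearMap.mulRight k (inA q QPlane.v))

/-- The differential `ξ ⊗ b ↦ ∑ᵢ (eⁱ ξ ⊗ eᵢ b - (-1)^m ξ eⁱ ⊗ b eᵢ)` in degree `m`, where `(e₁, e₂)`
is `(u, v)` and `(e¹, e²)` is `(u^*, v^*)`. -/
noncomputable def kosD (m : ℕ) : Kos q →ₗ[k] Kos q := kosL q - (-1 : k) ^ m • kosR q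

/-- The `m`-cocycles of `A^! ⊗ (A # H)`. -/
noncomputable def kosZ (m : ℕ) : Submodule k (Kos q) := kosCochain q m ⊓ LinearMap.ker (kosD q m)

/-- The `m`-coboundaries of `A^! ⊗ (A # H)`. -/
noncomputable def kosB : ℕ → Submodule k (Kos q)
  | 0 => ⊥
  | m + 1 => (kosCochain q m).map (kosD q m)

/-- The cohomology of `A^! ⊗ (A # H)` in degree `m`. -/
abbrev KosH (m : ℕ) : Type _ := Cohomology (kosZ q m) (kosB q m)

/-- The right action of `H` on `A^! ⊗ (A # H)`,
`(ξ ⊗ b) ◂ h = ∑ ξ ◃ h₍₂₎ ⊗ S(h₍₁₎) b h₍₃₎`. -/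
noncomputable def kosAct : KP k →ₗ[k] Module.End k (Kos q) :=
  LinearMap.mul' k (Module.End k (Kos q)) ∘ₗ
  TensorProduct.map
    ((LinearMap.lTensorHom (PlaneDual k)) ∘ₗ LinearMap.mul k (KPSmash q) ∘ₗ inH q ∘ₗ
      HopfAlgebra.antipode k)
    (LinearMap.mul' k (Module.End k (Kos q)) ∘ₗ TensorProduct.map
      ((LinearMap.rTensorHom (KPSmash q)) ∘ₗ PlaneDual.dualAct q)
      ((LinearMap.lTensorHom (PlaneDual k)) ∘ₗ (LinearMap.mul k (KPSmash q)).flip ∘ₗ inH q)) ∘ₗ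
  (Coalgebra.comul (R := k) (A := KP k)).lTensor (KP k) ∘ₗ Coalgebra.comul

/-- The `H`-invariants in the cohomology of `A^! ⊗ (A # H)`: the classes of the cocycles `ζ` for which
`ζ ◂ h` and `ε(h) ζ` are cohomologous for all `h`. -/
noncomputable def kosInvariants (m : ℕ) : Submodule k (KosH q m) :=
  Cohomology.classesOf (kosZ q m) (kosB q m)
    (⨅ h : KP k, (kosB q m).comap (kosAct q h - (Coalgebra.counit h : k) • LinearMap.id))

/-! ### Comparison -/

/-- Restriction of a Hochschild cochain of `A # H` to the Koszul complex of `A`, which is the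
subcomplex of the bar complex of `A` generated by `1` in degree `0`, by `u`, `v` in degree `1`, by
`u ⊗ v + v ⊗ u` in degree `2`, and by `0` in higher degrees. -/
noncomputable def restrictCochain : (n : ℕ) → HochCochain k (KPSmash q) n →ₗ[k] Kos q
  | 0 =>
    { toFun := fun f => 1 ⊗ₜ f ![]
      map_add' := fun f g => by simp [TensorProduct.tmul_add]
      map_smul' := fun c f => by simp }
  | 1 =>
    { toFun := fun f => PlaneDual.us ⊗ₜ f ![inA q QPlane.u] + PlaneDual.vs ⊗ₜ f ![inA q QPlane.v]
      map_add' := fun f g => by simp [TensorProduct.tmul_add]; abel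
      map_smul' := fun c f => by simp }
  | 2 =>
    { toFun := fun f => (PlaneDual.us * PlaneDual.vs) ⊗ₜ
        (f ![inA q QPlane.u, inA q QPlane.v] + f ![inA q QPlane.v, inA q QPlane.u])
      map_add' := fun f g => by simp [TensorProduct.tmul_add]; abel
      map_smul' := fun c f => by simp [TensorProduct.tmul_add] }
  | _ + 3 => 0

lemma us_mem_degree : (PlaneDual.us : PlaneDual k) ∈ PlaneDual.degree k 1 :=
  ⟨MvPolynomial.X 0, MvPolynomial.isHomogeneous_X _ _, rfl⟩
lemma vs_mem_degree : (PlaneDual.vs : PlaneDual k) ∈ PlaneDual.degree k 1 :=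
  ⟨MvPolynomial.X 1, MvPolynomial.isHomogeneous_X _ _, rfl⟩
lemma us_mul_vs_mem_degree : (PlaneDual.us * PlaneDual.vs : PlaneDual k) ∈ PlaneDual.degree k 2 :=
  ⟨MvPolynomial.X 0 * MvPolynomial.X 1,
    (MvPolynomial.isHomogeneous_X _ _).mul (MvPolynomial.isHomogeneous_X _ _), rfl⟩
lemma one_mem_degree : (1 : PlaneDual k) ∈ PlaneDual.degree k 0 :=
  ⟨1, MvPolynomial.isHomogeneous_one _ _, rfl⟩

lemma tmul_mem_kosCochain {m : ℕ} {ξ : PlaneDual k} (hξ : ξ ∈ PlaneDual.degree k m)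
    (b : KPSmash q) : ξ ⊗ₜ b ∈ kosCochain q m :=
  ⟨(⟨ξ, hξ⟩ : PlaneDual.degree k m) ⊗ₜ b, rfl⟩

lemma restrictCochain_mem (n : ℕ) (f : HochCochain k (KPSmash q) n) :
    restrictCochain q n f ∈ kosCochain q n := by
  match n with
  | 0 => exact tmul_mem_kosCochain q one_mem_degree _
  | 1 => exact add_mem (tmul_mem_kosCochain q us_mem_degree _) (tmul_mem_kosCochain q vs_mem_degree _)
  | 2 => exact tmul_mem_kosCochain q us_mul_vs_mem_degree _
  | n + 3 => exact zero_mem _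

lemma inA_add (a b : QPlane k) : inA q (a + b) = inA q a + inA q b :=
  TensorProduct.add_tmul a b 1
lemma inA_mul (a b : QPlane k) : inA q a * inA q b = inA q (a * b) := by
  rw [inA, inA, tmul_mul_tmul, map_one, Module.End.one_apply, opA_tmul]; rfl
lemma inA_zero : inA q (0 : QPlane k) = 0 := TensorProduct.zero_tmul _ _

/-- Restriction to the Koszul complex commutes with the differentials. -/
lemma kosD_restrictCochain (n : ℕ) (f : HochCochain k (KPSmash q) n) :
    kosD q n (restrictCochain q n f) = restrictCochain q (n + 1) (hochD k (KPSmash q) n f) := by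
  have i1 (a : KPSmash q) : Fin.init ![a] = ![] := by funext i; exact i.elim0
  have i2 (a b : KPSmash q) : Fin.init ![a, b] = ![a] := by funext i; fin_cases i; rfl
  have c2 (a b : KPSmash q) : Fin.contractNth 0 (· * ·) ![a, b] = ![a * b] := by
    funext i; fin_cases i; rfl
  match n with
  | 0 =>
    simp [kosD, kosL, kosR, restrictCochain, hochD, hochLeft, hochRight, i1, TensorProduct.tmul_add,
      TensorProduct.tmul_neg]
    abel
  | 1 =>
    have hr : f ![inA q QPlane.u * inA q QPlane.v] + f ![inA q QPlane.v * inA q QPlane.u] = 0 := by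
      have h := f.map_update_add ![0] 0 (inA q QPlane.u * inA q QPlane.v)
        (inA q QPlane.v * inA q QPlane.u)
      have e (b : KPSmash q) : Function.update ![(0 : KPSmash q)] 0 b = ![b] := by
        funext i; fin_cases i; rfl
      rw [e, e, e, inA_mul, inA_mul, ← inA_add, QPlane.uv_add_vu, inA_zero] at h
      rw [inA_mul, inA_mul, ← h]
      exact f.map_coord_zero 0 rfl
    have hr' := eq_neg_of_add_eq_zero_right hr
    simp [kosD, kosL, kosR, restrictCochain, hochD, hochLeft, hochRight, hochInner, i2, c2, PlaneDual.us_sq,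
      PlaneDual.vs_sq, hr', mul_comm PlaneDual.vs PlaneDual.us, TensorProduct.tmul_add,
      TensorProduct.tmul_neg]
    abel
  | 2 =>
    have h1 : (PlaneDual.us * (PlaneDual.us * PlaneDual.vs) : PlaneDual k) = 0 := by
      rw [← mul_assoc, PlaneDual.us_sq, zero_mul]
    have h2 : (PlaneDual.vs * (PlaneDual.us * PlaneDual.vs) : PlaneDual k) = 0 := by
      rw [mul_left_comm, PlaneDual.vs_sq, mul_zero]
    have h3 : (PlaneDual.us * PlaneDual.vs * PlaneDual.us : PlaneDual k) = 0 := by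
      rw [mul_comm, h1]
    have h4 : (PlaneDual.us * PlaneDual.vs * PlaneDual.vs : PlaneDual k) = 0 := by
      rw [mul_comm, h2]
    simp [kosD, kosL, kosR, restrictCochain, h1, h2, h3, h4]
  | n + 3 => simp [restrictCochain]

/-- The canonical map from the Hochschild cohomology of `A # H` to the cohomology of
`A^! ⊗ (A # H)`, induced by restricting cochains to the Koszul complex of `A`. -/
noncomputable def restrictHH (n : ℕ) : HH k (KPSmash q) n →ₗ[k] KosH q n :=
  Cohomology.map (restrictCochain q n)
    (fun f hf => ⟨restrictCochain_mem q n f, by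
      have h := kosD_restrictCochain q n f
      rw [show hochD k (KPSmash q) n f = 0 from hf, map_zero] at h
      exact h⟩)
    (fun f hf => by
      match n with
      | 0 =>
        have h0 : f = 0 := hf
        rw [h0, map_zero]
        exact zero_mem _
      | n + 1 =>
        obtain ⟨g, rfl⟩ := hf
        exact ⟨restrictCochain q n g, restrictCochain_mem q n g, kosD_restrictCochain q n g⟩)

end Koszul

/-! ### The listed elements -/

section Elements

open SmashProduct KP QPlane PlaneDual

variable {k : Type*} [Field k] [NeZero (2 : k)] (q : kˣ)

/-- The element `(ξ ⊗ u^s v^t) h = ξ ⊗ (u^s v^t # h)` of `A^! ⊗ (A # H)`. -/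
noncomputable def elt (ξ : PlaneDual k) (s t : ℕ) (h : KP k) : Kos q :=
  ξ ⊗ₜ tmul (QPlane.action q) (u ^ s * v ^ t) h

/-- `(1 + x y) / 2` -/
noncomputable def onePlus : KP k := (2⁻¹ : k) • (1 + gen .x * gen .y)
/-- `(1 - x y) / 2` -/
noncomputable def oneMinus : KP k := (2⁻¹ : k) • (1 - gen .x * gen .y)
/-- `(x + y) / 2` -/
noncomputable def xPlus : KP k := (2⁻¹ : k) • (gen .x + gen .y)
/-- `(x - y) / 2` -/
noncomputable def xMinus : KP k := (2⁻¹ : k) • (gen .x - gen .y)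
/-- `(z + x y z) / 2` -/
noncomputable def zPlus : KP k := (2⁻¹ : k) • (gen .z + gen .x * gen .y * gen .z)
/-- `(x z + y z) / 2` -/
noncomputable def xzPlus : KP k := (2⁻¹ : k) • (gen .x * gen .z + gen .y * gen .z)

/-- `(1 ⊗ q^{2i} u^{2i} v^{2j} + 1 ⊗ q^{2j} u^{2j} v^{2i}) h` -/
noncomputable def sym0 (i j : ℕ) (h : KP k) : Kos q :=
  (q : k) ^ (2 * i) • elt q 1 (2 * i) (2 * j) h + (q : k) ^ (2 * j) • elt q 1 (2 * j) (2 * i) h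

/-- `(1 ⊗ q^{2i} u^{2i} v^{2j} - 1 ⊗ q^{2j} u^{2j} v^{2i}) h` -/
noncomputable def alt0 (i j : ℕ) (h : KP k) : Kos q :=
  (q : k) ^ (2 * i) • elt q 1 (2 * i) (2 * j) h - (q : k) ^ (2 * j) • elt q 1 (2 * j) (2 * i) h

/-- `(u^* ⊗ q^{2i} u^{2i+1} v^{2j} + v^* ⊗ q^{2j} u^{2j} v^{2i+1}) h` -/
noncomputable def sym1 (i j : ℕ) (h : KP k) : Kos q :=
  (q : k) ^ (2 * i) • elt q us (2 * i + 1) (2 * j) h +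
    (q : k) ^ (2 * j) • elt q vs (2 * j) (2 * i + 1) h

/-- `(u^* ⊗ q^{2i} u^{2i+1} v^{2j} - v^* ⊗ q^{2j} u^{2j} v^{2i+1}) h` -/
noncomputable def alt1 (i j : ℕ) (h : KP k) : Kos q :=
  (q : k) ^ (2 * i) • elt q us (2 * i + 1) (2 * j) h -
    (q : k) ^ (2 * j) • elt q vs (2 * j) (2 * i + 1) h

/-- `(u^* v^* ⊗ q^{2i} u^{2i+1} v^{2j+1} + u^* v^* ⊗ q^{2j} u^{2j+1} v^{2i+1}) h` -/
noncomputable def sym2 (i j : ℕ) (h : KP k) : Kos q :=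
  (q : k) ^ (2 * i) • elt q (us * vs) (2 * i + 1) (2 * j + 1) h +
    (q : k) ^ (2 * j) • elt q (us * vs) (2 * j + 1) (2 * i + 1) h

/-- `(u^* v^* ⊗ q^{2i} u^{2i+1} v^{2j+1} - u^* v^* ⊗ q^{2j} u^{2j+1} v^{2i+1}) h` -/
noncomputable def alt2 (i j : ℕ) (h : KP k) : Kos q :=
  (q : k) ^ (2 * i) • elt q (us * vs) (2 * i + 1) (2 * j + 1) h -
    (q : k) ^ (2 * j) • elt q (us * vs) (2 * j + 1) (2 * i + 1) h

/-- Indices of the basis of `HH⁰`. -/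
inductive Index0
  | c1 (i j : ℕ) (h : i ≤ j)
  | c2 (i j : ℕ) (h : i ≤ j)
  | c3 (i j : ℕ) (h : i ≤ j)
  | c4 (i j : ℕ) (h : i < j)

/-- Indices of the basis of `HH¹`. -/
inductive Index1
  | c1 (i j : ℕ)
  | c2 (i j : ℕ)
  | c3 (i j : ℕ)
  | c4 (i j : ℕ)

/-- Indices of the basis of `HH²`. -/
inductive Index2
  | c1 (i j : ℕ) (h : i < j)
  | c2 (i j : ℕ) (h : i < j)
  | c3 (i j : ℕ) (h : i < j)
  | c4 (i j : ℕ) (h : i ≤ j)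
  | e1 | e2 | e3 | e4 | e5

noncomputable def elements0 : Index0 → Kos q
  | .c1 i j _ => sym0 q i j onePlus
  | .c2 i j _ => sym0 q i j oneMinus
  | .c3 i j _ => sym0 q i j xPlus
  | .c4 i j _ => alt0 q i j xMinus

noncomputable def elements1 : Index1 → Kos q
  | .c1 i j => sym1 q i j onePlus
  | .c2 i j => sym1 q i j oneMinus
  | .c3 i j => sym1 q i j xPlus
  | .c4 i j => alt1 q i j xMinus

noncomputable def elements2 : Index2 → Kos q
  | .c1 i j _ => alt2 q i j onePlus
  | .c2 i j _ => alt2 q i j oneMinus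
  | .c3 i j _ => alt2 q i j xPlus
  | .c4 i j _ => sym2 q i j xMinus
  | .e1 => elt q (us * vs) 0 0 onePlus
  | .e2 => elt q (us * vs) 0 0 oneMinus
  | .e3 => elt q (us * vs) 0 0 xPlus
  | .e4 => elt q (us * vs) 0 0 zPlus
  | .e5 => elt q (us * vs) 0 0 xzPlus

end Elements

/-! ### The monomial basis of the quantum plane. -/

namespace QPlane

variable {k : Type*} [Field k]

/-! As an `A`-bimodule, `A # H` is the direct sum of eight copies of `A`, one for each element of
`KP.bas`. The right action is untwisted on the four copies coming from the span of 1, x, y, xy, and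
twisted by `QPlane.swap` on the four that involve z (`comp_inA_mul`, `comp_mul_inA`). The Koszul
complex splits accordingly into complexes A → A² → A with differentials `d0 α` and `d1 α`, where α
is the identity or `swap`; these are computed on coefficients of monomials.

On the first six components z acts through `swap` and a sign ε (`comp_conjZ`); on the last two x
acts by -1 (`comp_conjX`), which leaves no invariant classes there. As 2 is invertible, an invariant
class is half the sum of itself and its image under z, so invariants are spanned by averages of
monomials (`mem_of_two_smul`). In the untwisted complexes parity restricts the monomials that
contribute, and the averages are the listed elements (`mem_of_d0_id`, `mem_of_d1_id`,
`mem_of_range_d1_id`). In the twisted complexes averaging kills every class except that of the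
constant 1 in degree 2, which accounts for the two elements with z (`eq_zero_of_d0_swap`,
`mem_of_d1_swap`, `mem_of_range_d1_swap`).

The link with Hochschild cohomology rests on the separability of H (`KP.casimir`). Averaging with
the separability idempotent makes a cocycle relative to H, and the restriction of a relative cocycle
is strictly H-invariant (`restrictHH_mem_one`, `restrictHH_mem_two`). The same averaging gives
injectivity: once a cocycle has been corrected to vanish on A, it is a coboundary
(`eq_commutator_of_vanish`, `eq_bilinD_of_vanish`).

Every listed element is the restriction of an explicit cocycle: a central element, an equivariant
derivation extended from A, or the sum over a z-orbit of products of two twisted derivations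
(`exists_class_zero`, `exists_class_one`, `exists_class_two`). The classes are independent because
certain coefficients vanish on coboundaries and separate the list. `range_eq_and_exists_basis`
combines these facts. -/

lemma vu : (v * u : QPlane k) = -(u * v) :=
  eq_neg_of_add_eq_zero_right uv_add_vu

lemma induction {P : QPlane k → Prop} (hc : ∀ c : k, P (algebraMap k _ c))
    (hu : P u) (hv : P v) (hadd : ∀ a b, P a → P b → P (a + b))
    (hmul : ∀ a b, P a → P b → P (a * b)) (a : QPlane k) : P a := by
  obtain ⟨a, rfl⟩ : ∃ x, mk k x = a := RingQuot.mkAlgHom_surjective k (PlaneRel k) a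
  induction a with
  | grade0 r => simpa using hc r
  | grade1 i => cases i; exacts [hu, hv]
  | add a b ha hb => simpa using hadd _ _ ha hb
  | mul a b ha hb => simpa using hmul _ _ ha hb

lemma v_mul_u_pow (i : ℕ) : (v * u ^ i : QPlane k) = (-1 : k) ^ i • (u ^ i * v) := by
  induction i with
  | zero => simp
  | succ i ih => rw [pow_succ, ← mul_assoc, ih, smul_mul_assoc, mul_assoc, vu, pow_succ]; simp [mul_assoc]

lemma v_pow_mul_u (j : ℕ) : (v ^ j * u : QPlane k) = (-1 : k) ^ j • (u * v ^ j) := by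
  induction j with
  | zero => simp
  | succ i ih => rw [pow_succ, mul_assoc, vu, mul_neg, ← mul_assoc, ih, pow_succ]; simp [mul_assoc]

lemma v_pow_mul_u_pow (i j : ℕ) :
    (v ^ j * u ^ i : QPlane k) = (-1 : k) ^ (i * j) • (u ^ i * v ^ j) := by
  induction i with
  | zero => simp
  | succ i ih =>
    rw [pow_succ, ← mul_assoc, ih, smul_mul_assoc, mul_assoc, v_pow_mul_u, add_mul, pow_add]
    simp [smul_smul, mul_assoc]

/-- The monomial `u ^ i v ^ j`. -/
noncomputable def mon (i j : ℕ) : QPlane k := u ^ i * v ^ j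

lemma mon_zero : (mon 0 0 : QPlane k) = 1 := by simp [mon]

lemma u_mul_mon (i j : ℕ) : (u * mon i j : QPlane k) = mon (i + 1) j := by
  rw [mon, mon, ← mul_assoc, pow_succ']
lemma mon_mul_v (i j : ℕ) : (mon i j * v : QPlane k) = mon i (j + 1) := by
  rw [mon, mon, mul_assoc, pow_succ]
lemma v_mul_mon (i j : ℕ) : (v * mon i j : QPlane k) = (-1 : k) ^ i • mon i (j + 1) := by
  rw [mon, mon, ← mul_assoc, v_mul_u_pow, smul_mul_assoc, mul_assoc, pow_succ']
lemma mon_mul_u (i j : ℕ) : (mon i j * u : QPlane k) = (-1 : k) ^ j • mon (i + 1) j := by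
  rw [mon, mon, mul_assoc, v_pow_mul_u, mul_smul_comm, ← mul_assoc, pow_succ]

/-- A subspace that contains 1 and is stable under left multiplication by u and v is everything. -/
lemma span_mon : Submodule.span k (Set.range fun p : ℕ × ℕ => (mon p.1 p.2 : QPlane k)) = ⊤ := by
  set S := Submodule.span k (Set.range fun p : ℕ × ℕ => (mon p.1 p.2 : QPlane k)) with hS
  have hm (i j : ℕ) : mon i j ∈ S := Submodule.subset_span ⟨(i, j), rfl⟩
  have key (a : QPlane k) : ∀ s ∈ S, a * s ∈ S := by
    induction a using induction with
    | hc c => intro s hs; rw [Algebra.algebraMap_eq_smul_one, smul_mul_assoc, one_mul]; exact S.smul_mem c hs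
    | hu =>
      intro s hs
      induction hs using Submodule.span_induction with
      | mem x h => obtain ⟨p, rfl⟩ := h; rw [u_mul_mon]; exact hm _ _
      | zero => simp
      | add x y _ _ hx hy => rw [mul_add]; exact add_mem hx hy
      | smul c x _ hx => rw [mul_smul_comm]; exact S.smul_mem c hx
    | hv =>
      intro s hs
      induction hs using Submodule.span_induction with
      | mem x h => obtain ⟨p, rfl⟩ := h; rw [v_mul_mon]; exact S.smul_mem _ (hm _ _)
      | zero => simp
      | add x y _ _ hx hy => rw [mul_add]; exact add_mem hx hy
      | smul c x _ hx => rw [mul_smul_comm]; exact S.smul_mem c hx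
    | hadd a b ha hb => intro s hs; rw [add_mul]; exact add_mem (ha s hs) (hb s hs)
    | hmul a b ha hb => intro s hs; rw [mul_assoc]; exact ha _ (hb s hs)
  refine eq_top_iff.2 fun a _ => ?_
  have := key a 1 (by rw [← mon_zero]; exact hm 0 0)
  rwa [mul_one] at this

/-- Left multiplication by `u` in monomial coordinates. -/
noncomputable def opU : Module.End k (ℕ × ℕ →₀ k) := Finsupp.lmapDomain k k fun p => (p.1 + 1, p.2)
/-- Left multiplication by `v` in monomial coordinates. -/
noncomputable def opV : Module.End k (ℕ × ℕ →₀ k) :=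
  Finsupp.lsum k fun p => (-1 : k) ^ p.1 • Finsupp.lsingle (p.1, p.2 + 1)

lemma opU_single (i j : ℕ) (c : k) :
    opU (Finsupp.single (i, j) c) = Finsupp.single (i + 1, j) c := by
  simp [opU, Finsupp.lmapDomain_apply, Finsupp.mapDomain_single]
lemma opV_single (i j : ℕ) (c : k) :
    opV (Finsupp.single (i, j) c) = Finsupp.single (i, j + 1) ((-1) ^ i * c) := by
  simp [opV]

/-- The action of `A` on itself by left multiplication, in monomial coordinates. -/
noncomputable def regRep : QPlane k →ₐ[k] Module.End k (ℕ × ℕ →₀ k) :=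
  lift (opU (k := k)) opV (by
    apply Finsupp.lhom_ext
    rintro ⟨i, j⟩ c
    simp only [LinearMap.add_apply, Module.End.mul_apply, opU_single, opV_single,
      LinearMap.zero_apply, ← Finsupp.single_add]
    rw [pow_succ]; simp)

/-- The coordinates of an element of `A` in the basis of monomials `u ^ i v ^ j`. -/
noncomputable def coef : QPlane k →ₗ[k] (ℕ × ℕ →₀ k) :=
  (LinearMap.applyₗ (Finsupp.single (0, 0) (1 : k))) ∘ₗ regRep.toLinearMap

lemma coef_u_mul' (a : QPlane k) : coef (u * a) = opU (coef a) := by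
  simp [coef, regRep]
lemma coef_v_mul' (a : QPlane k) : coef (v * a) = opV (coef a) := by
  simp [coef, regRep]

-- This is the linear independence of the monomials: under `regRep` the monomial u^i v^j carries the
-- basis vector at (0, 0) to the one at (i, j).
@[simp] lemma coef_mon (i j : ℕ) : coef (mon i j : QPlane k) = Finsupp.single (i, j) 1 := by
  induction i with
  | succ i ih => rw [← u_mul_mon, coef_u_mul', ih, opU_single]
  | zero =>
    induction j with
    | zero => simp [mon, coef]
    | succ j ih =>
      have : (mon 0 (j + 1) : QPlane k) = v * mon 0 j := by simp [v_mul_mon]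
      rw [this, coef_v_mul', ih, opV_single]; simp

/-- The element of `A` with given coordinates. -/
noncomputable def ofCoef : (ℕ × ℕ →₀ k) →ₗ[k] QPlane k :=
  Finsupp.lsum k fun p => LinearMap.toSpanSingleton k _ (mon p.1 p.2)

lemma ofCoef_single (p : ℕ × ℕ) (c : k) : ofCoef (Finsupp.single p c) = c • mon p.1 p.2 := by
  simp [ofCoef]

lemma coef_ofCoef (f : ℕ × ℕ →₀ k) : coef (ofCoef f) = f := by
  have : (coef ∘ₗ ofCoef : (ℕ × ℕ →₀ k) →ₗ[k] _) = LinearMap.id := by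
    apply Finsupp.lhom_ext
    rintro ⟨i, j⟩ c
    simp [ofCoef_single]
  exact DFunLike.congr_fun this f

lemma hom_ext {M : Type*} [AddCommGroup M] [Module k M] {f g : QPlane k →ₗ[k] M}
    (h : ∀ i j, f (mon i j) = g (mon i j)) : f = g := by
  refine LinearMap.ext_on span_mon ?_
  rintro _ ⟨p, rfl⟩
  exact h _ _

lemma ofCoef_coef (a : QPlane k) : ofCoef (coef a) = a := by
  have : (ofCoef ∘ₗ coef : QPlane k →ₗ[k] _) = LinearMap.id :=
    hom_ext fun i j => by simp [ofCoef_single]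
  exact DFunLike.congr_fun this a

lemma coef_injective : Function.Injective (coef : QPlane k → _) :=
  Function.LeftInverse.injective ofCoef_coef

lemma ext_coef {a b : QPlane k} (h : ∀ i j, coef a (i, j) = coef b (i, j)) : a = b :=
  coef_injective (Finsupp.ext fun p => h p.1 p.2)

/-- Each element of `A` is the sum of its monomials. -/
lemma eq_sum (a : QPlane k) : a = (coef a).sum fun p c => c • mon p.1 p.2 := by
  conv_lhs => rw [← ofCoef_coef a]
  simp [ofCoef, Finsupp.lsum_apply, Finsupp.sum]

section shift

/-- Functionals on A are compared on monomials. The shift formulas obtained this way turn cocycle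
equations into recurrences for coefficients, with separate rules on the edges of ℕ × ℕ, where the
shift has no source. -/
lemma coef_aux {f g : QPlane k →ₗ[k] k} (h : ∀ i j, f (mon i j) = g (mon i j)) (a : QPlane k) :
    f a = g a := DFunLike.congr_fun (hom_ext h) a

@[simp] lemma coef_u_mul_zero (a : QPlane k) (j : ℕ) : coef (u * a) (0, j) = 0 :=
  coef_aux (f := Finsupp.lapply (0, j) ∘ₗ coef ∘ₗ LinearMap.mulLeft k u) (g := 0)
    (fun i j => by simp [u_mul_mon]) a
@[simp] lemma coef_u_mul_succ (a : QPlane k) (i j : ℕ) :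
    coef (u * a) (i + 1, j) = coef a (i, j) :=
  coef_aux (f := Finsupp.lapply (i + 1, j) ∘ₗ coef ∘ₗ LinearMap.mulLeft k u)
    (g := Finsupp.lapply (i, j) ∘ₗ coef)
    (fun i j => by simp [u_mul_mon, Finsupp.single_apply]) a
@[simp] lemma coef_mul_v_zero (a : QPlane k) (i : ℕ) : coef (a * v) (i, 0) = 0 :=
  coef_aux (f := Finsupp.lapply (i, 0) ∘ₗ coef ∘ₗ LinearMap.mulRight k v) (g := 0)
    (fun i j => by simp [mon_mul_v]) a
@[simp] lemma coef_mul_v_succ (a : QPlane k) (i j : ℕ) :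
    coef (a * v) (i, j + 1) = coef a (i, j) :=
  coef_aux (f := Finsupp.lapply (i, j + 1) ∘ₗ coef ∘ₗ LinearMap.mulRight k v)
    (g := Finsupp.lapply (i, j) ∘ₗ coef)
    (fun i j => by simp [mon_mul_v, Finsupp.single_apply]) a
@[simp] lemma coef_v_mul_zero (a : QPlane k) (i : ℕ) : coef (v * a) (i, 0) = 0 :=
  coef_aux (f := Finsupp.lapply (i, 0) ∘ₗ coef ∘ₗ LinearMap.mulLeft k v) (g := 0)
    (fun i j => by simp [v_mul_mon]) a
@[simp] lemma coef_v_mul_succ (a : QPlane k) (i j : ℕ) :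
    coef (v * a) (i, j + 1) = (-1) ^ i * coef a (i, j) :=
  coef_aux (f := Finsupp.lapply (i, j + 1) ∘ₗ coef ∘ₗ LinearMap.mulLeft k v)
    (g := LinearMap.mulLeft k ((-1 : k) ^ i) ∘ₗ Finsupp.lapply (i, j) ∘ₗ coef)
    (fun i' j' => by
      simp only [LinearMap.comp_apply, LinearMap.mulLeft_apply, v_mul_mon, map_smul, coef_mon,
        Finsupp.lapply_apply, Finsupp.single_apply, Prod.mk.injEq]
      by_cases h : i' = i <;> simp [h]) a
@[simp] lemma coef_mul_u_zero (a : QPlane k) (j : ℕ) : coef (a * u) (0, j) = 0 :=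
  coef_aux (f := Finsupp.lapply (0, j) ∘ₗ coef ∘ₗ LinearMap.mulRight k u) (g := 0)
    (fun i j => by simp [mon_mul_u]) a
@[simp] lemma coef_mul_u_succ (a : QPlane k) (i j : ℕ) :
    coef (a * u) (i + 1, j) = (-1) ^ j * coef a (i, j) :=
  coef_aux (f := Finsupp.lapply (i + 1, j) ∘ₗ coef ∘ₗ LinearMap.mulRight k u)
    (g := LinearMap.mulLeft k ((-1 : k) ^ j) ∘ₗ Finsupp.lapply (i, j) ∘ₗ coef)
    (fun i' j' => by
      simp only [LinearMap.comp_apply, LinearMap.mulRight_apply, mon_mul_u, map_smul, coef_mon,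
        Finsupp.lapply_apply, Finsupp.single_apply, Prod.mk.injEq]
      by_cases h : j' = j <;> simp [h]) a

end shift

section swap
variable (q : kˣ)

@[simp] lemma swap_u : swap q u = (q⁻¹ : k) • v := by simp [swap]
@[simp] lemma swap_v : swap q v = (q : k) • u := by simp [swap]
@[simp] lemma swap_swap (a : QPlane k) : swap q (swap q a) = a :=
  DFunLike.congr_fun (swap_comp_swap q) a

lemma swap_mon (i j : ℕ) :
    swap q (mon i j) = ((q⁻¹ : k) ^ i * q ^ j * (-1) ^ (i * j)) • mon j i := by
  rw [mon, map_mul, map_pow, map_pow, swap_u, swap_v, smul_pow, smul_pow, smul_mul_smul_comm,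
    v_pow_mul_u_pow, smul_smul, mon, mul_comm j i]

end swap

end QPlane

/-! ### A basis of the Kac–Paljutkin algebra and its dual functionals. -/

namespace KP
variable {k : Type*} [Field k]

/-- A basis of `H`: `e`, `f`, `x e`, `x f`, `e z`, `x e z`, `f z`, `x f z` for
`e = (1 + x y) / 2` and `f = (1 - x y) / 2`. -/
noncomputable def bas : Fin 8 → KP k :=
  ![onePlus, oneMinus, xPlus, xMinus, zPlus, xzPlus,
    (2⁻¹ : k) • (gen .z - gen .x * gen .y * gen .z), (2⁻¹ : k) • (gen .x * gen .z - gen .y * gen .z)]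

variable [NeZero (2 : k)]

section rep

/-- The values of a character at `x`. -/
def px : Fin 4 → k := ![1, 1, -1, -1]
/-- The values of a character at `y`. -/
def py : Fin 4 → k := ![1, -1, 1, -1]
/-- The values of a character at `z ^ 2`. -/
def pz : Fin 4 → k := ![1, 1, 1, -1]

lemma rep_xx : !![px, 0; 0, py] * !![px, 0; 0, py] = (1 : Matrix (Fin 2) (Fin 2) (Fin 4 → k)) := by
  ext i j l; fin_cases i <;> fin_cases j <;> fin_cases l <;> simp [px, py, pz]
lemma rep_yy : !![py, 0; 0, px] * !![py, 0; 0, px] = (1 : Matrix (Fin 2) (Fin 2) (Fin 4 → k)) := by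
  ext i j l; fin_cases i <;> fin_cases j <;> fin_cases l <;> simp [px, py, pz]
lemma pz_eq (l : Fin 4) :
    (pz l : k) = 2⁻¹ * (1 + px l + py l - px l * py l) := by
  have h2 : (2 : k) ≠ 0 := two_ne_zero
  fin_cases l <;> simp [px, py, pz] <;> field_simp <;> norm_num
lemma rep_zz : !![0, pz; 1, 0] * !![0, pz; 1, 0] =
    (2⁻¹ : k) • ((1 : Matrix (Fin 2) (Fin 2) (Fin 4 → k)) + !![px, 0; 0, py] + !![py, 0; 0, px] -
      !![px, 0; 0, py] * !![py, 0; 0, px]) := by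
  ext i j l
  fin_cases i <;> fin_cases j <;> simp [pz_eq]
  exact Or.inl (by ring)
lemma rep_yx : !![py, 0; 0, px] * !![px, 0; 0, py] =
    (!![px, 0; 0, py] * !![py, 0; 0, px] : Matrix (Fin 2) (Fin 2) (Fin 4 → k)) := by
  simp [mul_comm]
lemma rep_zx : !![0, pz; 1, 0] * !![px, 0; 0, py] =
    (!![py, 0; 0, px] * !![0, pz; 1, 0] : Matrix (Fin 2) (Fin 2) (Fin 4 → k)) := by
  simp [mul_comm]
lemma rep_zy : !![0, pz; 1, 0] * !![py, 0; 0, px] =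
    (!![px, 0; 0, py] * !![0, pz; 1, 0] : Matrix (Fin 2) (Fin 2) (Fin 4 → k)) := by
  simp [mul_comm]

/-- The representation of `H` induced from the regular representation of the span of
`1, x, y, x y`, written in idempotents. -/
noncomputable def rep : KP k →ₐ[k] Matrix (Fin 2) (Fin 2) (Fin 4 → k) :=
  lift !![px, 0; 0, py] !![py, 0; 0, px] !![0, pz; 1, 0] rep_xx rep_yy rep_zz rep_yx rep_zx rep_zy

lemma rep_x : rep (gen .x : KP k) = !![px, 0; 0, py] :=
  lift_x _ _ _ rep_xx rep_yy rep_zz rep_yx rep_zx rep_zy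
lemma rep_y : rep (gen .y : KP k) = !![py, 0; 0, px] :=
  lift_y _ _ _ rep_xx rep_yy rep_zz rep_yx rep_zx rep_zy
lemma rep_z : rep (gen .z : KP k) = !![0, pz; 1, 0] :=
  lift_z _ _ _ rep_xx rep_yy rep_zz rep_yx rep_zx rep_zy

/-- A matrix entry of the representation `rep`. -/
noncomputable def entry (i : Fin 2) (l : Fin 4) : KP k →ₗ[k] k :=
  { toFun := fun a => rep a 0 i l
    map_add' := fun a b => by simp
    map_smul' := fun c a => by simp }

lemma entry_apply (i : Fin 2) (l : Fin 4) (a : KP k) : entry i l a = rep a 0 i l := rfl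

/-- The values of the functionals `entry 0 l` on `bas`. -/
lemma entry_zero_bas (l : Fin 4) (j : Fin 8) : entry 0 l (bas j : KP k) =
    (2⁻¹ : k) * (![1 + px l * py l, 1 - px l * py l, px l + py l, px l - py l, 0, 0, 0, 0]
      : Fin 8 → k) j := by
  fin_cases j <;> simp [bas, entry_apply, onePlus, oneMinus, xPlus, xMinus, zPlus, xzPlus, rep_x, rep_y, rep_z] <;> ring

/-- The values of the functionals `entry 1 l` on `bas`. -/
lemma entry_one_bas (l : Fin 4) (j : Fin 8) : entry 1 l (bas j : KP k) =
    (2⁻¹ : k) * (![0, 0, 0, 0, pz l + px l * py l * pz l, px l * pz l + py l * pz l,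
      pz l - px l * py l * pz l, px l * pz l - py l * pz l] : Fin 8 → k) j := by
  fin_cases j <;> simp [bas, entry_apply, onePlus, oneMinus, xPlus, xMinus, zPlus, xzPlus, rep_x, rep_y, rep_z] <;> ring

/-- The functionals dual to `bas`. -/
noncomputable def dual : Fin 8 → KP k →ₗ[k] k :=
  ![(2⁻¹ : k) • (entry 0 0 + entry 0 3), (2⁻¹ : k) • (entry 0 1 + entry 0 2),
    (2⁻¹ : k) • (entry 0 0 - entry 0 3), (2⁻¹ : k) • (entry 0 1 - entry 0 2),
    -- The signs are opposite to those of the functionals dual to `onePlus` and `xPlus`, because `pz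
    -- 3 = -1`.
    (2⁻¹ : k) • (entry 1 0 - entry 1 3), (2⁻¹ : k) • (entry 1 0 + entry 1 3),
    (2⁻¹ : k) • (entry 1 1 + entry 1 2), (2⁻¹ : k) • (entry 1 1 - entry 1 2)]

lemma dual_bas (i j : Fin 8) : dual i (bas j : KP k) = if i = j then 1 else 0 := by
  have h2 : (2 : k) ≠ 0 := two_ne_zero
  have e : (2⁻¹ : k) * (1 + 1) = 1 := by field_simp; norm_num
  have e''' : (2⁻¹ : k) + 2⁻¹ = 1 := by field_simp; norm_num
  have e' : (2⁻¹ : k) * (-1 - 1) = -1 := by field_simp; norm_num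
  have e'' : (2⁻¹ : k) * (-1 + -1) = -1 := by field_simp; norm_num
  fin_cases i <;> simp [dual, entry_zero_bas, entry_one_bas] <;> fin_cases j <;>
    simp [px, py, pz, e, e', e'', e''']

end rep

lemma gen_mul_bas_mem (g : KPGen) (i : Fin 8) :
    gen g * bas i ∈ Submodule.span k (Set.range (bas : Fin 8 → KP k)) := by
  have h2 : (2 : k) ≠ 0 := two_ne_zero
  set S := Submodule.span k (Set.range (bas : Fin 8 → KP k))
  have hm (i : Fin 8) : bas i ∈ S := Submodule.subset_span ⟨i, rfl⟩
  have tab : ∃ j : Fin 8, gen g * bas i = (bas j : KP k) ∨ gen g * bas i = -(bas j : KP k) := by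
    -- Left multiplication by a generator permutes `bas` up to sign; the three lists are the
    -- permutations for x, y and z.
    refine ⟨(KPGen.casesOn g ![2, 3, 0, 1, 5, 4, 7, 6] ![2, 3, 0, 1, 5, 4, 7, 6]
      ![4, 6, 5, 7, 2, 0, 1, 3] : Fin 8 → Fin 8) i, ?_⟩
    cases g <;> fin_cases i <;> first
    | left
      simp [bas, onePlus, oneMinus, xPlus, xMinus, zPlus, xzPlus, mul_add, mul_sub, add_mul, sub_mul,
        mul_assoc, xx, yy, zz, yx, zx, zy, xx', yy', yx', zx', zy', zz']
      try (match_scalars <;> field_simp <;> norm_num)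
      done
    | right
      simp [bas, onePlus, oneMinus, xPlus, xMinus, zPlus, xzPlus, mul_add, mul_sub, add_mul, sub_mul,
        mul_assoc, xx, yy, zz, yx, zx, zy, xx', yy', yx', zx', zy', zz']
      try (match_scalars <;> field_simp <;> norm_num)
  obtain ⟨j, h⟩ := tab
  rcases h with h | h <;> rw [h]
  exacts [hm j, S.neg_mem (hm j)]

lemma span_bas : Submodule.span k (Set.range (bas : Fin 8 → KP k)) = ⊤ := by
  have h2 : (2 : k) ≠ 0 := two_ne_zero
  set S := Submodule.span k (Set.range (bas : Fin 8 → KP k)) with hS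
  have hm (i : Fin 8) : bas i ∈ S := Submodule.subset_span ⟨i, rfl⟩
  have hg (g : KPGen) : ∀ s ∈ S, gen g * s ∈ S := by
    intro s hs
    induction hs using Submodule.span_induction with
    | mem x h => obtain ⟨p, rfl⟩ := h; exact gen_mul_bas_mem g p
    | zero => simp
    | add x y _ _ hx hy => rw [mul_add]; exact add_mem hx hy
    | smul c x _ hx => rw [mul_smul_comm]; exact S.smul_mem c hx
  have key (a : KP k) : ∀ s ∈ S, a * s ∈ S := by
    induction a using induction with
    | hc c => intro s hs; rw [Algebra.algebraMap_eq_smul_one, smul_mul_assoc, one_mul]; exact S.smul_mem c hs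
    | hx => exact hg _
    | hy => exact hg _
    | hz => exact hg _
    | hadd a b ha hb => intro s hs; rw [add_mul]; exact add_mem (ha s hs) (hb s hs)
    | hmul a b ha hb => intro s hs; rw [mul_assoc]; exact ha _ (hb s hs)
  refine eq_top_iff.2 fun a _ => ?_
  have h1 : (1 : KP k) = bas 0 + bas 1 := by
    simp [bas, onePlus, oneMinus]
    match_scalars <;> field_simp <;> norm_num
  have := key a 1 (by rw [h1]; exact add_mem (hm 0) (hm 1))
  rwa [mul_one] at this

lemma sum_dual_bas (h : KP k) : ∑ i, dual i h • bas i = h := by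
  have : (∑ i, (dual i).smulRight (bas i) : KP k →ₗ[k] KP k) = LinearMap.id := by
    refine LinearMap.ext_on span_bas ?_
    rintro _ ⟨j, rfl⟩
    simp [LinearMap.sum_apply, dual_bas]
  simpa [LinearMap.sum_apply] using DFunLike.congr_fun this h

end KP

/-! ### The decomposition of `A # H` into twisted copies of `A`. -/

section KPSmash

open SmashProduct

variable {k : Type*} [Field k] [NeZero (2 : k)] (q : kˣ)

lemma opH_gen_x (a : QPlane k) (h : KP k) :
    opH (QPlane.action q) (KP.gen .x) (a ⊗ₜ h) = a ⊗ₜ (KP.gen .x * h) := by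
  simp [opH, QPlane.action, Module.endTensorEndAlgHom_apply, KP.comul_eq]
lemma opH_gen_y (a : QPlane k) (h : KP k) :
    opH (QPlane.action q) (KP.gen .y) (a ⊗ₜ h) = a ⊗ₜ (KP.gen .y * h) := by
  simp [opH, QPlane.action, Module.endTensorEndAlgHom_apply, KP.comul_eq]
-- The left tensor factor acts on A, where y is trivial, so the prefactor of Δ(z) collapses: the two
-- terms with x on the right cancel and the other two add up to 1.
lemma opH_gen_z (a : QPlane k) (h : KP k) :
    opH (QPlane.action q) (KP.gen .z) (a ⊗ₜ h) = QPlane.swap q a ⊗ₜ (KP.gen .z * h) := by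
  have h2 : (2 : k) ≠ 0 := two_ne_zero
  simp [opH, QPlane.action, Module.endTensorEndAlgHom_apply, KP.comul_eq, KP.comulZ, add_mul, sub_mul]
  match_scalars <;> field_simp <;> ring
lemma opH_one_tmul (g h : KP k) :
    opH (QPlane.action q) g ((1 : QPlane k) ⊗ₜ h) = 1 ⊗ₜ (g * h) := by
  induction g using KP.induction generalizing h with
  | hc c => simp [Algebra.algebraMap_eq_smul_one, TensorProduct.tmul_smul]
  | hx => exact opH_gen_x q _ _
  | hy => exact opH_gen_y q _ _
  | hz => rw [opH_gen_z, map_one]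
  | hadd a b ha hb => simp only [map_add, LinearMap.add_apply, ha, hb, add_mul, TensorProduct.tmul_add]
  | hmul a b ha hb => rw [map_mul, Module.End.mul_apply, hb, ha, mul_assoc]

/-- The inclusion of `A` into `A # H`. -/
noncomputable def inAHom : QPlane k →ₐ[k] KPSmash q :=
  AlgHom.ofLinearMap ((TensorProduct.mk k (QPlane k) (KP k)).flip 1) rfl
    (fun a b => (inA_mul q a b).symm)

/-- The inclusion of `H` into `A # H`. -/
noncomputable def inHHom : KP k →ₐ[k] KPSmash q :=
  AlgHom.ofLinearMap (inH q) rfl fun g h => by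
    change _ = opA 1 (opH (QPlane.action q) g ((1 : QPlane k) ⊗ₜ h))
    rw [opH_one_tmul, map_one]; rfl

lemma inA_eq (a : QPlane k) : inA q a = inAHom q a := rfl

lemma tmul_eq (a : QPlane k) (h : KP k) :
    tmul (QPlane.action q) a h = inAHom q a * inHHom q h := by
  change _ = opA a (opH (QPlane.action q) 1 ((1 : QPlane k) ⊗ₜ h))
  rw [opH_one_tmul, one_mul, opA_tmul, mul_one]; rfl

lemma smash_induction {P : KPSmash q → Prop} (h0 : P 0) (hadd : ∀ X Y, P X → P Y → P (X + Y))
    (hmul : ∀ a h, P (inAHom q a * inHHom q h)) (X : KPSmash q) : P X := by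
  refine TensorProduct.induction_on (motive := P) X h0 (fun a h => ?_) hadd
  have := hmul a h
  rwa [← tmul_eq] at this

/-- The images of `x`, `y`, `z` in `A # H`. -/
noncomputable def inGen (g : KPGen) : KPSmash q := inHHom q (KP.gen g)

lemma inGen_mul_inA (g : KPGen) (a : QPlane k) :
    inGen q g * inAHom q a =
      opH (QPlane.action q) (KP.gen g) (a ⊗ₜ 1) := by
  change opA 1 (opH (QPlane.action q) (KP.gen g) (a ⊗ₜ 1)) = _
  rw [map_one]; rfl

lemma x_mul_inA (a : QPlane k) : inGen q .x * inAHom q a = inAHom q a * inGen q .x := by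
  rw [inGen_mul_inA, opH_gen_x, mul_one, inGen, ← tmul_eq]; rfl
lemma y_mul_inA (a : QPlane k) : inGen q .y * inAHom q a = inAHom q a * inGen q .y := by
  rw [inGen_mul_inA, opH_gen_y, mul_one, inGen, ← tmul_eq]; rfl
lemma z_mul_inA (a : QPlane k) :
    inGen q .z * inAHom q a = inAHom q (QPlane.swap q a) * inGen q .z := by
  rw [inGen_mul_inA, opH_gen_z, mul_one, inGen, ← tmul_eq]; rfl

/-- The automorphism `α` of `A` with `h a = α(a) h` for `h = KP.bas i`. -/
noncomputable def twist (i : Fin 8) : QPlane k →ₐ[k] QPlane k :=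
  if i < 4 then AlgHom.id k _ else QPlane.swap q

lemma bas_mul_inA (i : Fin 8) (a : QPlane k) :
    inHHom q (KP.bas i) * inAHom q a = inAHom q (twist q i a) * inHHom q (KP.bas i) := by
  have hx := x_mul_inA q a
  have hy := y_mul_inA q a
  have hz := z_mul_inA q a
  have hx' := x_mul_inA q (QPlane.swap q a)
  have hy' := y_mul_inA q (QPlane.swap q a)
  simp only [inGen] at hx hy hz hx' hy'
  fin_cases i <;>
    simp [KP.bas, twist, onePlus, oneMinus, xPlus, xMinus, zPlus, xzPlus, add_mul, sub_mul, mul_add,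
      mul_sub, mul_assoc, hx, hy, hz] <;>
    simp [← mul_assoc, hx, hy, hz, hx', hy']

/-- The coefficient in `A` of `KP.bas i`. -/
noncomputable def comp (i : Fin 8) : KPSmash q →ₗ[k] QPlane k :=
  (TensorProduct.rid k (QPlane k)).toLinearMap ∘ₗ (KP.dual i).lTensor (QPlane k)

lemma comp_mul (i : Fin 8) (a : QPlane k) (h : KP k) :
    comp q i (inAHom q a * inHHom q h) = KP.dual i h • a := by
  rw [← tmul_eq]
  change TensorProduct.rid k (QPlane k) ((KP.dual i).lTensor (QPlane k) (a ⊗ₜ h)) = _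
  simp

lemma comp_bas (i j : Fin 8) (a : QPlane k) :
    comp q i (inAHom q a * inHHom q (KP.bas j)) = if i = j then a else 0 := by
  rw [comp_mul, KP.dual_bas, ite_smul, one_smul, zero_smul]

lemma sum_comp (X : KPSmash q) : ∑ i, inAHom q (comp q i X) * inHHom q (KP.bas i) = X := by
  induction X using smash_induction with
  | h0 => simp
  | hadd X Y hX hY => simp only [map_add, add_mul, Finset.sum_add_distrib, hX, hY]
  | hmul a h =>
    have e (i : Fin 8) : inAHom q (KP.dual i h • a) * inHHom q (KP.bas i) =
        inAHom q a * inHHom q (KP.dual i h • KP.bas i) := by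
      rw [map_smul (inAHom q), map_smul (inHHom q), smul_mul_assoc, mul_smul_comm]
    simp only [comp_mul, e, ← Finset.mul_sum, ← map_sum, KP.sum_dual_bas]

lemma comp_sum (i : Fin 8) (a : Fin 8 → QPlane k) :
    comp q i (∑ j, inAHom q (a j) * inHHom q (KP.bas j)) = a i := by
  simp [comp_bas]

@[simp] lemma comp_inA_mul (i : Fin 8) (a : QPlane k) (X : KPSmash q) :
    comp q i (inAHom q a * X) = a * comp q i X := by
  conv_lhs => rw [← sum_comp q X, Finset.mul_sum]
  simp only [← mul_assoc, ← map_mul]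
  rw [comp_sum]

-- Moving a to the left past `KP.bas i` applies `twist q i`. With `comp_inA_mul` this identifies the
-- bimodule structure of `A # H`, and hence the Koszul differentials on each component.
@[simp] lemma comp_mul_inA (i : Fin 8) (a : QPlane k) (X : KPSmash q) :
    comp q i (X * inAHom q a) = comp q i X * twist q i a := by
  conv_lhs => rw [← sum_comp q X, Finset.sum_mul]
  simp only [mul_assoc, bas_mul_inA]
  simp only [← mul_assoc, ← map_mul]
  rw [comp_sum q i fun j => comp q j X * twist q j a]

/-- `∑ h₍₁₎ b h₍₃₎` for `h = z`, with `h₍₂₎` evaluated on `x = y = 1`. -/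
noncomputable def conjZ : KPSmash q →ₗ[k] KPSmash q :=
  (2⁻¹ : k) • (LinearMap.mulLeftRight k (inGen q .z, inGen q .z) +
    LinearMap.mulLeftRight k (inGen q .z, inGen q .x * inGen q .z) +
    LinearMap.mulLeftRight k (inGen q .z * inGen q .y, inGen q .z) -
    LinearMap.mulLeftRight k (inGen q .z * inGen q .y, inGen q .x * inGen q .z))

lemma conjZ_apply (X : KPSmash q) : conjZ q X = (2⁻¹ : k) •
    (inGen q .z * X * inGen q .z + inGen q .z * X * (inGen q .x * inGen q .z) +
    inGen q .z * inGen q .y * X * inGen q .z -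
    inGen q .z * inGen q .y * X * (inGen q .x * inGen q .z)) := by
  simp [conjZ]

lemma conjZ_inA_mul (a : QPlane k) (X : KPSmash q) :
    conjZ q (inAHom q a * X) = inAHom q (QPlane.swap q a) * conjZ q X := by
  have hz (Y : KPSmash q) : inGen q .z * (inAHom q a * Y) =
      inAHom q (QPlane.swap q a) * (inGen q .z * Y) := by
    rw [← mul_assoc, z_mul_inA, mul_assoc]
  have hy (Y : KPSmash q) : inGen q .y * (inAHom q a * Y) = inAHom q a * (inGen q .y * Y) := by
    rw [← mul_assoc, y_mul_inA, mul_assoc]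
  rw [conjZ_apply, conjZ_apply, mul_smul_comm]
  simp only [mul_assoc, hz, hy, mul_add, mul_sub]

/-- The operator `conjZ` on `H`. -/
noncomputable def conjH (h : KP k) : KP k := (2⁻¹ : k) •
    (KP.gen .z * h * KP.gen .z + KP.gen .z * h * (KP.gen .x * KP.gen .z) +
    KP.gen .z * KP.gen .y * h * KP.gen .z -
    KP.gen .z * KP.gen .y * h * (KP.gen .x * KP.gen .z))

lemma conjZ_inH (h : KP k) : conjZ q (inHHom q h) = inHHom q (conjH h) := by
  simp [conjZ_apply, conjH, inGen]

lemma conjH_one : conjH (1 : KP k) = 1 := by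
  have h2 : (2 : k) ≠ 0 := two_ne_zero
  simp [conjH, mul_assoc, mul_add, mul_sub, KP.xx, KP.yy, KP.zz, KP.yx, KP.zx, KP.zy, KP.xx',
      KP.yy', KP.yx', KP.zx', KP.zy', KP.zz']
  match_scalars <;> field_simp <;> norm_num

/-- The eigenvalues of `conjH` on `KP.bas`, for the indices `< 6`. -/
def conjSign : Fin 8 → k := ![1, 1, 1, -1, 1, 1, 0, 0]

lemma conjH_bas (i : Fin 8) (hi : i < 6) : conjH (KP.bas i : KP k) = (conjSign i : k) • KP.bas i := by
  have h2 : (2 : k) ≠ 0 := two_ne_zero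
  fin_cases i <;> simp at hi <;>
  simp [conjH, conjSign, KP.bas, onePlus, oneMinus, xPlus, xMinus, zPlus, xzPlus, mul_add, mul_sub, add_mul, sub_mul,
        mul_assoc, KP.xx, KP.yy, KP.zz, KP.yx, KP.zx, KP.zy, KP.xx', KP.yy', KP.yx', KP.zx', KP.zy', KP.zz'] <;>
  match_scalars <;> field_simp <;> norm_num

/-- The last two basis elements are not eigenvectors of `conjH`. What matters below is only that
they span a stable plane, so that they do not contribute to the other components. -/
lemma conjH_bas_six : conjH (KP.bas 6 : KP k) = KP.bas 7 := by
  have h2 : (2 : k) ≠ 0 := two_ne_zero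
  simp [conjH, conjSign, KP.bas, onePlus, oneMinus, xPlus, xMinus, zPlus, xzPlus, mul_add, mul_sub, add_mul, sub_mul,
        mul_assoc, KP.xx, KP.yy, KP.zz, KP.yx, KP.zx, KP.zy, KP.xx', KP.yy', KP.yx', KP.zx', KP.zy', KP.zz']
  match_scalars <;> field_simp <;> norm_num

lemma conjH_bas_seven : conjH (KP.bas 7 : KP k) = -KP.bas 6 := by
  have h2 : (2 : k) ≠ 0 := two_ne_zero
  simp [conjH, conjSign, KP.bas, onePlus, oneMinus, xPlus, xMinus, zPlus, xzPlus, mul_add, mul_sub, add_mul, sub_mul,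
        mul_assoc, KP.xx, KP.yy, KP.zz, KP.yx, KP.zx, KP.zy, KP.xx', KP.yy', KP.yx', KP.zx', KP.zy', KP.zz']
  match_scalars <;> field_simp <;> norm_num

lemma comp_conjZ (i : Fin 8) (hi : i < 6) (X : KPSmash q) :
    comp q i (conjZ q X) = (conjSign i : k) • QPlane.swap q (comp q i X) := by
  conv_lhs => rw [← sum_comp q X, map_sum, map_sum]
  simp only [conjZ_inA_mul, conjZ_inH]
  have key (j : Fin 8) : comp q i (inAHom q (QPlane.swap q (comp q j X)) * inHHom q (conjH (KP.bas j))) =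
      if i = j then (conjSign i : k) • QPlane.swap q (comp q i X) else 0 := by
    by_cases hj : j < 6
    · rw [conjH_bas j hj, map_smul, mul_smul_comm, map_smul, comp_bas]
      split_ifs with h <;> simp [h]
    · have hij : i ≠ j := by rintro rfl; exact hj hi
      rw [if_neg hij]
      have : j = 6 ∨ j = 7 := by omega
      rcases this with rfl | rfl
      · rw [conjH_bas_six, comp_bas, if_neg (by rintro rfl; simp at hi)]
      · rw [conjH_bas_seven, map_neg, mul_neg, map_neg, comp_bas, if_neg (by rintro rfl; simp at hi), neg_zero]
  simp [key]

lemma x_bas_x (i : Fin 8) : KP.gen .x * KP.bas i * KP.gen .x =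
    (if i < 6 then KP.bas i else -KP.bas i : KP k) := by
  have h2 : (2 : k) ≠ 0 := two_ne_zero
  fin_cases i <;>
  simp [KP.bas, onePlus, oneMinus, xPlus, xMinus, zPlus, xzPlus, mul_add, mul_sub, add_mul, sub_mul,
        mul_assoc, KP.xx, KP.yy, KP.zz, KP.yx, KP.zx, KP.zy, KP.xx', KP.yy', KP.yx', KP.zx', KP.zy', KP.zz'] <;>
  module

/-- Conjugation by x fixes the first six elements of `KP.bas` and negates the last two. Invariance
under x alone therefore makes components 6 and 7 trivial in cohomology. -/
lemma comp_conjX (i : Fin 8) (hi : ¬ i < 6) (X : KPSmash q) :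
    comp q i (inGen q .x * X * inGen q .x) = -comp q i X := by
  have e (a : QPlane k) (h : KP k) : inGen q .x * (inAHom q a * inHHom q h) * inGen q .x =
      inAHom q a * inHHom q (KP.gen .x * h * KP.gen .x) := by
    rw [← mul_assoc, x_mul_inA, map_mul, map_mul, inGen]; simp only [mul_assoc]
  conv_lhs => rw [← sum_comp q X, Finset.mul_sum, Finset.sum_mul, map_sum]
  simp only [e, x_bas_x]
  have key (j : Fin 8) : comp q i (inAHom q (comp q j X) * inHHom q
      (if j < 6 then KP.bas j else -KP.bas j)) = if i = j then -comp q i X else 0 := by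
    split_ifs with h h' h'
    · exact absurd (h' ▸ h) hi
    · rw [comp_bas, if_neg h']
    · rw [map_neg, mul_neg, map_neg, comp_bas, if_pos h', h']
    · rw [map_neg, mul_neg, map_neg, comp_bas, if_neg h', neg_zero]
  simp [key]

end KPSmash

/-! ### The basis 1, u*, v*, u*v* of the Koszul dual. -/

namespace PlaneDual

variable {k : Type*} [Field k]

/-- The algebra `A^!` maps to the dual numbers in two variables. -/
noncomputable def toDual : PlaneDual k →ₐ[k] DualNumber (DualNumber k) :=
  Ideal.Quotient.liftₐ (dualIdeal k)
    (MvPolynomial.aeval (![TrivSqZeroExt.inl DualNumber.eps, DualNumber.eps] :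
      Fin 2 → DualNumber (DualNumber k))) (by
      intro a ha
      rw [← RingHom.mem_ker]
      refine (Ideal.span_le.2 ?_) ha
      rintro p (rfl | rfl)
      · simp [RingHom.mem_ker, pow_two, ← TrivSqZeroExt.inl_mul]
      · simp [RingHom.mem_ker, pow_two])

lemma toDual_us : toDual (us : PlaneDual k) = TrivSqZeroExt.inl (DualNumber.eps : DualNumber k) := by
  change MvPolynomial.aeval (![TrivSqZeroExt.inl DualNumber.eps, DualNumber.eps] :
      Fin 2 → DualNumber (DualNumber k)) (MvPolynomial.X 0) = _
  simp
lemma toDual_vs : toDual (vs : PlaneDual k) = (DualNumber.eps : DualNumber (DualNumber k)) := by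
  change MvPolynomial.aeval (![TrivSqZeroExt.inl DualNumber.eps, DualNumber.eps] :
      Fin 2 → DualNumber (DualNumber k)) (MvPolynomial.X 1) = _
  simp

/-- The coordinates of `A^!` with respect to `1`, `u^*`, `v^*`, `u^* v^*`. -/
noncomputable def coord (i : Fin 4) : PlaneDual k →ₗ[k] k :=
  { toFun := fun a => ![(toDual a).fst.fst, (toDual a).fst.snd, (toDual a).snd.fst, (toDual a).snd.snd] i
    map_add' := fun a b => by fin_cases i <;> simp
    map_smul' := fun c a => by fin_cases i <;> simp }

lemma coord_apply (i : Fin 4) (a : PlaneDual k) : coord i a =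
  ![(toDual a).fst.fst, (toDual a).fst.snd, (toDual a).snd.fst, (toDual a).snd.snd] i := rfl

lemma coord_one (i : Fin 4) : coord i (1 : PlaneDual k) = ![1, 0, 0, 0] i := by
  fin_cases i <;> simp [coord_apply]
lemma coord_us (i : Fin 4) : coord i (us : PlaneDual k) = ![0, 1, 0, 0] i := by
  fin_cases i <;> simp [coord_apply, toDual_us]
lemma coord_vs (i : Fin 4) : coord i (vs : PlaneDual k) = ![0, 0, 1, 0] i := by
  fin_cases i <;> simp [coord_apply, toDual_vs]
lemma coord_us_vs (i : Fin 4) : coord i (us * vs : PlaneDual k) = ![0, 0, 0, 1] i := by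
  fin_cases i <;> simp [coord_apply, toDual_vs, toDual_us]

/-- A homogeneous polynomial is a combination of monomials of its degree. Since u* and v* square to
zero, this leaves the expected generators in degrees 0, 1 and 2. -/
lemma degree_le_span (m : ℕ) : degree k m ≤
    Submodule.span k ((fun d : ℕ × ℕ => us ^ d.1 * vs ^ d.2) '' {d | d.1 + d.2 = m}) := by
  rintro _ ⟨p, hp, rfl⟩
  rw [MvPolynomial.as_sum p]
  rw [map_sum]
  refine Submodule.sum_mem _ fun d hd => ?_
  have hdeg : d 0 + d 1 = m := by
    have := hp (MvPolynomial.mem_support_iff.1 hd)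
    simpa [Finsupp.weight_apply, Finsupp.sum_fintype] using this
  have : (mk k).toLinearMap (MvPolynomial.monomial d (p.coeff d)) =
      p.coeff d • (us ^ d 0 * vs ^ d 1) := by
    change mk k _ = _
    rw [MvPolynomial.monomial_eq, Finsupp.prod_fintype _ _ (by simp), MvPolynomial.C_eq_smul_one]
    simp [us, vs]
  rw [this]
  exact Submodule.smul_mem _ _ (Submodule.subset_span ⟨(d 0, d 1), hdeg, rfl⟩)

lemma degree_zero_le : degree k 0 ≤ Submodule.span k {1} := by
  refine (degree_le_span 0).trans (Submodule.span_le.2 ?_)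
  rintro _ ⟨⟨i, j⟩, h, rfl⟩
  obtain ⟨rfl, rfl⟩ : i = 0 ∧ j = 0 := by simpa using h
  simp

lemma degree_one_le : degree k 1 ≤ Submodule.span k {us, vs} := by
  refine (degree_le_span 1).trans (Submodule.span_le.2 ?_)
  rintro _ ⟨⟨i, j⟩, h, rfl⟩
  have h : i + j = 1 := h
  have : (i = 1 ∧ j = 0) ∨ (i = 0 ∧ j = 1) := by omega
  rcases this with ⟨rfl, rfl⟩ | ⟨rfl, rfl⟩ <;> exact Submodule.subset_span (by simp)

lemma degree_two_le : degree k 2 ≤ Submodule.span k {us * vs} := by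
  refine (degree_le_span 2).trans (Submodule.span_le.2 ?_)
  rintro _ ⟨⟨i, j⟩, h, rfl⟩
  have h : i + j = 2 := h
  have : (i = 2 ∧ j = 0) ∨ (i = 1 ∧ j = 1) ∨ (i = 0 ∧ j = 2) := by omega
  rcases this with ⟨rfl, rfl⟩ | ⟨rfl, rfl⟩ | ⟨rfl, rfl⟩
  · simp [pow_two, us_sq]
  · simp
  · simp [pow_two, vs_sq]

end PlaneDual

/-! ### The Koszul complex in coordinates, and the action of the generators of `H` on it. -/

section Koszul

open SmashProduct PlaneDual

variable {k : Type*} [Field k] [NeZero (2 : k)] (q : kˣ)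

/-- `b ↦ 1 ⊗ b` -/
noncomputable def kos0 : KPSmash q →ₗ[k] Kos q := TensorProduct.mk k (PlaneDual k) (KPSmash q) 1
/-- `(b, c) ↦ u^* ⊗ b + v^* ⊗ c` -/
noncomputable def kos1 : KPSmash q × KPSmash q →ₗ[k] Kos q :=
  (TensorProduct.mk k (PlaneDual k) (KPSmash q) us).coprod
    (TensorProduct.mk k (PlaneDual k) (KPSmash q) vs)
/-- `b ↦ u^* v^* ⊗ b` -/
noncomputable def kos2 : KPSmash q →ₗ[k] Kos q :=
  TensorProduct.mk k (PlaneDual k) (KPSmash q) (us * vs)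

lemma kos0_apply (b : KPSmash q) : kos0 q b = 1 ⊗ₜ b := rfl
lemma kos1_apply (p : KPSmash q × KPSmash q) : kos1 q p = us ⊗ₜ p.1 + vs ⊗ₜ p.2 := rfl
lemma kos2_apply (b : KPSmash q) : kos2 q b = (us * vs) ⊗ₜ b := rfl

/-- The coefficients in `A # H` with respect to the basis `1`, `u^*`, `v^*`, `u^* v^*`. -/
noncomputable def kosCoord (i : Fin 4) : Kos q →ₗ[k] KPSmash q :=
  (TensorProduct.lid k (KPSmash q)).toLinearMap ∘ₗ (coord i).rTensor (KPSmash q)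

lemma kosCoord_tmul (i : Fin 4) (ξ : PlaneDual k) (b : KPSmash q) :
    kosCoord q i (ξ ⊗ₜ b) = coord i ξ • b := by simp [kosCoord]

lemma kosCoord_kos0 (b : KPSmash q) : kosCoord q 0 (kos0 q b) = b := by
  rw [kos0_apply, kosCoord_tmul, coord_one]; simp
lemma kosCoord_one_kos1 (p : KPSmash q × KPSmash q) : kosCoord q 1 (kos1 q p) = p.1 := by
  rw [kos1_apply, map_add, kosCoord_tmul, kosCoord_tmul, coord_us, coord_vs]; simp
lemma kosCoord_two_kos1 (p : KPSmash q × KPSmash q) : kosCoord q 2 (kos1 q p) = p.2 := by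
  rw [kos1_apply, map_add, kosCoord_tmul, kosCoord_tmul, coord_us, coord_vs]; simp
lemma kosCoord_kos2 (b : KPSmash q) : kosCoord q 3 (kos2 q b) = b := by
  rw [kos2_apply, kosCoord_tmul, coord_us_vs]; simp

lemma kos0_injective : Function.Injective (kos0 q) :=
  Function.LeftInverse.injective (kosCoord_kos0 q)
lemma kos1_injective : Function.Injective (kos1 q) := fun p p' h =>
  Prod.ext (by rw [← kosCoord_one_kos1, h, kosCoord_one_kos1])
    (by rw [← kosCoord_two_kos1, h, kosCoord_two_kos1])
lemma kos2_injective : Function.Injective (kos2 q) :=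
  Function.LeftInverse.injective (kosCoord_kos2 q)

lemma kosCochain_le {m : ℕ} {W : Submodule k (Kos q)} {s : Set (PlaneDual k)}
    (hs : degree k m ≤ Submodule.span k s) (h : ∀ ξ ∈ s, ∀ b, ξ ⊗ₜ b ∈ W) : kosCochain q m ≤ W := by
  rintro _ ⟨t, rfl⟩
  induction t with
  | zero => simp
  | add t t' ht ht' => rw [map_add]; exact add_mem ht ht'
  | tmul ξ b =>
    have key (ξ : PlaneDual k) (hξ : ξ ∈ Submodule.span k s) : ξ ⊗ₜ b ∈ W := by
      induction hξ using Submodule.span_induction with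
      | mem ξ hξ => exact h ξ hξ b
      | zero => simp
      | add x y _ _ hx hy => rw [TensorProduct.add_tmul]; exact add_mem hx hy
      | smul c x _ hx => rw [← TensorProduct.smul_tmul']; exact W.smul_mem c hx
    exact key _ (hs ξ.2)

lemma kosCochain_zero : kosCochain q 0 = LinearMap.range (kos0 q) := by
  refine le_antisymm (kosCochain_le q degree_zero_le ?_) ?_
  · rintro _ rfl b; exact ⟨b, rfl⟩
  · rintro _ ⟨b, rfl⟩; exact tmul_mem_kosCochain q one_mem_degree b
lemma kosCochain_one : kosCochain q 1 = LinearMap.range (kos1 q) := by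
  refine le_antisymm (kosCochain_le q degree_one_le ?_) ?_
  · rintro _ (rfl | rfl) b
    · exact ⟨(b, 0), by simp [kos1_apply]⟩
    · exact ⟨(0, b), by simp [kos1_apply]⟩
  · rintro _ ⟨p, rfl⟩
    exact add_mem (tmul_mem_kosCochain q us_mem_degree _) (tmul_mem_kosCochain q vs_mem_degree _)
lemma kosCochain_two : kosCochain q 2 = LinearMap.range (kos2 q) := by
  refine le_antisymm (kosCochain_le q degree_two_le ?_) ?_
  · rintro _ rfl b; exact ⟨b, rfl⟩
  · rintro _ ⟨b, rfl⟩; exact tmul_mem_kosCochain q us_mul_vs_mem_degree b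

/-- `b ↦ (u b - b u, v b - b v)` -/
noncomputable def smashD0 : KPSmash q →ₗ[k] KPSmash q × KPSmash q :=
  (LinearMap.mulLeft k (inAHom q QPlane.u) - LinearMap.mulRight k (inAHom q QPlane.u)).prod
    (LinearMap.mulLeft k (inAHom q QPlane.v) - LinearMap.mulRight k (inAHom q QPlane.v))
/-- `(b, c) ↦ v b + b v + u c + c u` -/
noncomputable def smashD1 : KPSmash q × KPSmash q →ₗ[k] KPSmash q :=
  (LinearMap.mulLeft k (inAHom q QPlane.v) + LinearMap.mulRight k (inAHom q QPlane.v)).coprod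
    (LinearMap.mulLeft k (inAHom q QPlane.u) + LinearMap.mulRight k (inAHom q QPlane.u))

lemma smashD0_apply (b : KPSmash q) : smashD0 q b =
    (inAHom q QPlane.u * b - b * inAHom q QPlane.u, inAHom q QPlane.v * b - b * inAHom q QPlane.v) := rfl
lemma smashD1_apply (p : KPSmash q × KPSmash q) : smashD1 q p =
    (inAHom q QPlane.v * p.1 + p.1 * inAHom q QPlane.v) +
      (inAHom q QPlane.u * p.2 + p.2 * inAHom q QPlane.u) := rfl

lemma kosD_kos0 (b : KPSmash q) : kosD q 0 (kos0 q b) = kos1 q (smashD0 q b) := by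
  simp only [kosD, kosL, kosR, kos0_apply, kos1_apply, smashD0_apply, inA_eq, LinearMap.sub_apply,
    LinearMap.add_apply, TensorProduct.map_tmul, LinearMap.mulLeft_apply, LinearMap.mulRight_apply,
    pow_zero, one_smul, mul_one, one_mul, TensorProduct.tmul_sub]
  abel

/-- Only the mixed products u*v* survive; `A^!` is commutative and the sign -(-1)^1 is +1, hence the
anticommutator form of `smashD1`. -/
lemma kosD_kos1 (p : KPSmash q × KPSmash q) : kosD q 1 (kos1 q p) = kos2 q (smashD1 q p) := by
  simp [kosD, kosL, kosR, kos2_apply, kos1_apply, smashD1_apply, inA_eq, us_sq, vs_sq,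
    mul_comm vs us, TensorProduct.tmul_add]
  abel

lemma kos0_mem_kosZ {b : KPSmash q} : kos0 q b ∈ kosZ q 0 ↔ smashD0 q b = 0 := by
  rw [kosZ, Submodule.mem_inf, LinearMap.mem_ker, kosD_kos0, kosCochain_zero]
  exact ⟨fun h => kos1_injective q (h.2.trans (map_zero _).symm), fun h => ⟨⟨b, rfl⟩, by rw [h, map_zero]⟩⟩
lemma kos1_mem_kosZ {p : KPSmash q × KPSmash q} : kos1 q p ∈ kosZ q 1 ↔ smashD1 q p = 0 := by
  rw [kosZ, Submodule.mem_inf, LinearMap.mem_ker, kosD_kos1, kosCochain_one]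
  exact ⟨fun h => kos2_injective q (h.2.trans (map_zero _).symm), fun h => ⟨⟨p, rfl⟩, by rw [h, map_zero]⟩⟩

lemma kosB_one : kosB q 1 = (LinearMap.range (smashD0 q)).map (kos1 q) := by
  rw [kosB, kosCochain_zero]
  ext x
  constructor
  · rintro ⟨_, ⟨b, rfl⟩, rfl⟩; exact ⟨_, ⟨b, rfl⟩, (kosD_kos0 q b).symm⟩
  · rintro ⟨_, ⟨b, rfl⟩, rfl⟩; exact ⟨_, ⟨b, rfl⟩, kosD_kos0 q b⟩
lemma kosB_two : kosB q 2 = (LinearMap.range (smashD1 q)).map (kos2 q) := by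
  rw [kosB, kosCochain_one]
  ext x
  constructor
  · rintro ⟨_, ⟨b, rfl⟩, rfl⟩; exact ⟨_, ⟨b, rfl⟩, (kosD_kos1 q b).symm⟩
  · rintro ⟨_, ⟨b, rfl⟩, rfl⟩; exact ⟨_, ⟨b, rfl⟩, kosD_kos1 q b⟩

lemma kos0_mem_kosB {b : KPSmash q} : kos0 q b ∈ kosB q 0 ↔ b = 0 := by
  rw [kosB, Submodule.mem_bot, map_eq_zero_iff _ (kos0_injective q)]
lemma kos1_mem_kosB {p : KPSmash q × KPSmash q} : kos1 q p ∈ kosB q 1 ↔ p ∈ LinearMap.range (smashD0 q) := by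
  rw [kosB_one, Submodule.mem_map]
  exact ⟨fun ⟨_, h, e⟩ => kos1_injective q e ▸ h, fun h => ⟨_, h, rfl⟩⟩
lemma kos2_mem_kosB {b : KPSmash q} : kos2 q b ∈ kosB q 2 ↔ b ∈ LinearMap.range (smashD1 q) := by
  rw [kosB_two, Submodule.mem_map]
  exact ⟨fun ⟨_, h, e⟩ => kos2_injective q e ▸ h, fun h => ⟨_, h, rfl⟩⟩

/-! The action of `H` on `A^! ⊗ (A # H)`. -/

/-- `(h₁ ⊗ h₂ ⊗ h₃) ↦ (ξ ⊗ b ↦ ξ ◃ h₂ ⊗ S(h₁) b h₃)` -/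
noncomputable def kosActAux : KP k ⊗[k] (KP k ⊗[k] KP k) →ₗ[k] Module.End k (Kos q) :=
  LinearMap.mul' k (Module.End k (Kos q)) ∘ₗ
  TensorProduct.map
    ((LinearMap.lTensorHom (PlaneDual k)) ∘ₗ LinearMap.mul k (KPSmash q) ∘ₗ inH q ∘ₗ
      HopfAlgebra.antipode k)
    (LinearMap.mul' k (Module.End k (Kos q)) ∘ₗ TensorProduct.map
      ((LinearMap.rTensorHom (KPSmash q)) ∘ₗ PlaneDual.dualAct q)
      ((LinearMap.lTensorHom (PlaneDual k)) ∘ₗ (LinearMap.mul k (KPSmash q)).flip ∘ₗ inH q))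

lemma kosActAux_tmul (a b c : KP k) (ξ : PlaneDual k) (X : KPSmash q) :
    kosActAux q (a ⊗ₜ (b ⊗ₜ c)) (ξ ⊗ₜ X) =
      dualAct q b ξ ⊗ₜ (inHHom q (KP.antipodeLin a) * X * inHHom q c) := by
  simp only [kosActAux, LinearMap.comp_apply, TensorProduct.map_tmul, LinearMap.mul'_apply,
    Module.End.mul_apply]
  change LinearMap.lTensor _ _ (LinearMap.rTensor _ _ (LinearMap.lTensor _ _ _)) = _
  simp only [LinearMap.lTensor_tmul, LinearMap.rTensor_tmul]
  rw [mul_assoc]; rfl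

lemma dualAct_mul (a b : KP k) : dualAct q (a * b) = dualAct q b * dualAct q a := by
  simp [dualAct]

/-- The order is reversed because the antipode and `dualAct` reverse products and the third factor
multiplies from the right. So `kosAct` is a right action, and invariance can be tested on x, y, z.
-/
lemma kosActAux_mul (T T' : KP k ⊗[k] (KP k ⊗[k] KP k)) :
    kosActAux q (T * T') = kosActAux q T' * kosActAux q T := by
  induction T with
  | zero => simp
  | add T₁ T₂ h₁ h₂ => rw [add_mul, map_add, h₁, h₂, map_add, mul_add]
  | tmul a W =>
    induction W with
    | zero => simp
    | add W₁ W₂ h₁ h₂ => rw [TensorProduct.tmul_add, add_mul, map_add, h₁, h₂, map_add, mul_add]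
    | tmul b c =>
      induction T' with
      | zero => simp
      | add T₁ T₂ h₁ h₂ => rw [mul_add, map_add, h₁, h₂, map_add, add_mul]
      | tmul a' W =>
        induction W with
        | zero => simp
        | add W₁ W₂ h₁ h₂ => rw [TensorProduct.tmul_add, mul_add, map_add, h₁, h₂, map_add, add_mul]
        | tmul b' c' =>
          apply TensorProduct.ext'
          intro ξ X
          rw [Algebra.TensorProduct.tmul_mul_tmul, Algebra.TensorProduct.tmul_mul_tmul,
            Module.End.mul_apply, kosActAux_tmul, kosActAux_tmul, kosActAux_tmul, dualAct_mul,
            KP.antipodeLin_mul, map_mul, map_mul]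
          simp only [mul_assoc]; rfl

lemma kosAct_eq (h : KP k) : kosAct q h =
    kosActAux q (Algebra.TensorProduct.map (AlgHom.id k _) KP.comulHom (KP.comulHom h)) := rfl

lemma kosAct_mul (a b : KP k) : kosAct q (a * b) = kosAct q b * kosAct q a := by
  rw [kosAct_eq, map_mul, map_mul, kosActAux_mul]; rfl

lemma dualAct_one : dualAct q 1 = 1 := by simp [dualAct]
lemma dualAct_x : dualAct q (KP.gen .x) = 1 := by
  change MulOpposite.unop (dualActHom q (KP.gen .x)) = 1
  rw [dualActHom, KP.lift_x]; rfl
lemma dualAct_y : dualAct q (KP.gen .y) = 1 := by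
  change MulOpposite.unop (dualActHom q (KP.gen .y)) = 1
  rw [dualActHom, KP.lift_y]; rfl
lemma dualAct_z : dualAct q (KP.gen .z) = (PlaneDual.swap q).toLinearMap := by
  change MulOpposite.unop (dualActHom q (KP.gen .z)) = _
  rw [dualActHom, KP.lift_z]; rfl

lemma kosAct_one : kosAct q 1 = 1 := by
  apply TensorProduct.ext'
  intro ξ X
  rw [kosAct_eq, map_one, map_one, Algebra.TensorProduct.one_def, Algebra.TensorProduct.one_def,
    kosActAux_tmul, dualAct_one]
  simp

lemma kosAct_x (ξ : PlaneDual k) (X : KPSmash q) :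
    kosAct q (KP.gen .x) (ξ ⊗ₜ X) = ξ ⊗ₜ (inGen q .x * X * inGen q .x) := by
  rw [kosAct_eq, KP.comulHom_x, Algebra.TensorProduct.map_tmul, KP.comulHom_x, kosActAux_tmul,
    dualAct_x, AlgHom.id_apply, KP.antipodeLin_x]; rfl
lemma kosAct_y (ξ : PlaneDual k) (X : KPSmash q) :
    kosAct q (KP.gen .y) (ξ ⊗ₜ X) = ξ ⊗ₜ (inGen q .y * X * inGen q .y) := by
  rw [kosAct_eq, KP.comulHom_y, Algebra.TensorProduct.map_tmul, KP.comulHom_y, kosActAux_tmul,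
    dualAct_y, AlgHom.id_apply, KP.antipodeLin_y]; rfl
-- In the iterated coproduct of z the middle factor acts through `dualAct`, for which x and y are
-- trivial. What remains is `swap` on `A^!` and the four terms of `conjZ` on `A # H`.
lemma kosAct_z (ξ : PlaneDual k) (X : KPSmash q) :
    kosAct q (KP.gen .z) (ξ ⊗ₜ X) = PlaneDual.swap q ξ ⊗ₜ conjZ q X := by
  have h2 : (2 : k) ≠ 0 := two_ne_zero
  rw [kosAct_eq, KP.comulHom_z]
  simp only [KP.comulZ, map_mul, map_smul, map_add, map_sub, Algebra.TensorProduct.map_tmul, map_one,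
    KP.comulHom_x, KP.comulHom_y, KP.comulHom_z, AlgHom.id_apply, add_mul, sub_mul, mul_add, mul_sub,
    TensorProduct.tmul_add, TensorProduct.add_tmul, TensorProduct.sub_tmul, TensorProduct.tmul_sub,
    smul_mul_assoc, mul_smul_comm, ← TensorProduct.smul_tmul', TensorProduct.tmul_smul, mul_assoc,
    Algebra.TensorProduct.one_def, Algebra.TensorProduct.tmul_mul_tmul, one_mul, mul_one,
    LinearMap.add_apply, LinearMap.sub_apply, LinearMap.smul_apply, kosActAux_tmul, dualAct_mul,
    dualAct_x, dualAct_y, dualAct_z, KP.antipodeLin_mul, KP.antipodeLin_x, KP.antipodeLin_y,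
    KP.antipodeLin_z, Module.End.mul_apply, Module.End.one_apply, conjZ_apply, inGen,
    AlgHom.toLinearMap_apply]
  match_scalars <;> field_simp <;> norm_num

end Koszul

/-! ### Cohomology of the Koszul complexes of `A` with coefficients twisted by the identity or by
`swap`. -/

namespace QPlane

variable {k : Type*} [Field k]

/-- Used with f an averaging operator: once parity conditions on the support of a are known, only
those monomials have to be treated. -/
lemma map_mem_of_coef {M : Type*} [AddCommGroup M] [Module k M] (f : QPlane k →ₗ[k] M)
    (W : Submodule k M) (a : QPlane k) (h : ∀ i j, coef a (i, j) ≠ 0 → f (mon i j) ∈ W) :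
    f a ∈ W := by
  rw [eq_sum a, Finsupp.sum, map_sum]
  refine Submodule.sum_mem _ fun p hp => ?_
  rw [map_smul]
  exact W.smul_mem _ (h _ _ (Finsupp.mem_support_iff.1 hp))

/-- Injectivity of g keeps the prescribed support finite. This supplies the elements whose
coboundary corrects a cocycle. -/
lemma exists_coef (a : QPlane k) {g : ℕ × ℕ → ℕ × ℕ} (hg : Function.Injective g) (φ : ℕ → ℕ → k) :
    ∃ w : QPlane k, ∀ i j, coef w (i, j) = φ i j * coef a (g (i, j)) := by
  refine ⟨ofCoef (Finsupp.ofSupportFinite (fun p => φ p.1 p.2 * coef a (g p)) ?_), fun i j => ?_⟩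
  · refine ((coef a).support.finite_toSet.preimage hg.injOn).subset fun p hp => ?_
    simp only [Function.mem_support] at hp
    simpa using right_ne_zero_of_mul hp
  · rw [coef_ofCoef]; rfl

lemma injective_succ_left : Function.Injective fun p : ℕ × ℕ => (p.1 + 1, p.2) := by
  rintro ⟨i, j⟩ ⟨i', j'⟩ h; simpa using h
lemma injective_succ_right : Function.Injective fun p : ℕ × ℕ => (p.1, p.2 + 1) := by
  rintro ⟨i, j⟩ ⟨i', j'⟩ h; simpa using h

/-- The Koszul differential `a ↦ (u a - a α(u), v a - a α(v))`. -/
noncomputable def d0 (α : QPlane k →ₐ[k] QPlane k) : QPlane k →ₗ[k] QPlane k × QPlane k :=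
  (LinearMap.mulLeft k u - LinearMap.mulRight k (α u)).prod
    (LinearMap.mulLeft k v - LinearMap.mulRight k (α v))
/-- The Koszul differential `(a, b) ↦ v a + a α(v) + u b + b α(u)`. -/
noncomputable def d1 (α : QPlane k →ₐ[k] QPlane k) : QPlane k × QPlane k →ₗ[k] QPlane k :=
  (LinearMap.mulLeft k v + LinearMap.mulRight k (α v)).coprod
    (LinearMap.mulLeft k u + LinearMap.mulRight k (α u))

lemma d0_apply (α : QPlane k →ₐ[k] QPlane k) (a : QPlane k) :
    d0 α a = (u * a - a * α u, v * a - a * α v) := rfl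
lemma d1_apply (α : QPlane k →ₐ[k] QPlane k) (p : QPlane k × QPlane k) :
    d1 α p = (v * p.1 + p.1 * α v) + (u * p.2 + p.2 * α u) := rfl

/-- The action of `z` on the Koszul cochains of degree `1`. -/
noncomputable def swap1 (q : kˣ) : QPlane k × QPlane k →ₗ[k] QPlane k × QPlane k :=
  ((q⁻¹ : k) • ((swap q).toLinearMap ∘ₗ LinearMap.snd k _ _)).prod
    ((q : k) • ((swap q).toLinearMap ∘ₗ LinearMap.fst k _ _))

variable (q : kˣ)

lemma swap1_apply (p : QPlane k × QPlane k) :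
    swap1 q p = ((q⁻¹ : k) • swap q p.2, (q : k) • swap q p.1) := rfl

lemma swap1_d0 {α : QPlane k →ₐ[k] QPlane k} (hα : ∀ a, swap q (α a) = α (swap q a))
    (a : QPlane k) : swap1 q (d0 α a) = d0 α (swap q a) := by
  rw [swap1_apply, d0_apply, d0_apply]
  simp [hα, smul_smul, ← smul_sub]

lemma swap_d1 {α : QPlane k →ₐ[k] QPlane k} (hα : ∀ a, swap q (α a) = α (swap q a))
    (p : QPlane k × QPlane k) : swap q (d1 α p) = d1 α (swap1 q p) := by
  rw [swap1_apply, d1_apply, d1_apply]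
  simp [hα, smul_smul]
  abel

/-- The averaging argument: y is the image of x under z, the difference is a coboundary by
invariance, and the sum is an average that can be computed on monomials. -/
lemma mem_of_two_smul [NeZero (2 : k)] {M : Type*} [AddCommGroup M] [Module k M]
    {W : Submodule k M} {x y : M} (h : x + y ∈ W) (h' : y - x ∈ W) : x ∈ W := by
  have h2 : (2 : k) ≠ 0 := two_ne_zero
  have : (2 : k) • x ∈ W := by
    have := sub_mem h h'
    rwa [show x + y - (y - x) = (2 : k) • x by module] at this
  exact (W.smul_mem_iff h2).1 this

variable [NeZero (2 : k)] {ε : k}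

/-- An element commuting with u and v involves only monomials with both exponents even, since
comparing coefficients gives twice the others equal to 0. The average of such a monomial is a
multiple of a generator in `hL`. -/
lemma mem_of_d0_id {L : Submodule k (QPlane k)}
    (hL : ∀ i j, (q : k) ^ (2 * i) • mon (2 * i) (2 * j) +
      (ε * (q : k) ^ (2 * j)) • mon (2 * j) (2 * i) ∈ L)
    {a : QPlane k} (ha : d0 (AlgHom.id k _) a = 0) (h : ε • swap q a - a ∈ L) : a ∈ L := by
  have h2 : (2 : k) ≠ 0 := two_ne_zero
  have hq : (q : k) ≠ 0 := q.ne_zero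
  refine mem_of_two_smul ?_ h
  refine map_mem_of_coef (LinearMap.id + ε • (swap q).toLinearMap) L a fun i j hij => ?_
  rw [d0_apply, Prod.mk_eq_zero] at ha
  have e1 := DFunLike.congr_fun (congrArg coef ha.1) (i + 1, j)
  have e2 := DFunLike.congr_fun (congrArg coef ha.2) (i, j + 1)
  simp only [map_sub, Finsupp.sub_apply, coef_u_mul_succ, coef_mul_u_succ, coef_v_mul_succ,
    coef_mul_v_succ, AlgHom.id_apply, map_zero, Finsupp.zero_apply] at e1 e2
  have hj : Even j := by
    by_contra hj
    rw [Nat.not_even_iff_odd] at hj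
    rw [hj.neg_one_pow] at e1
    have : (2 : k) * coef a (i, j) = 0 := by linear_combination e1
    exact hij ((mul_eq_zero.1 this).resolve_left h2)
  have hi : Even i := by
    by_contra hi
    rw [Nat.not_even_iff_odd] at hi
    rw [hi.neg_one_pow] at e2
    have : (2 : k) * coef a (i, j) = 0 := by linear_combination -e2
    exact hij ((mul_eq_zero.1 this).resolve_left h2)
  obtain ⟨i, rfl⟩ := even_iff_two_dvd.1 hi
  obtain ⟨j, rfl⟩ := even_iff_two_dvd.1 hj
  have := L.smul_mem (((q : k) ^ (2 * i))⁻¹) (hL i j)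
  convert this using 1
  have hm : Even (2 * i * (2 * j)) := (even_two_mul i).mul_right _
  simp only [LinearMap.add_apply, LinearMap.id_apply, LinearMap.smul_apply,
    AlgHom.toLinearMap_apply, swap_mon, inv_pow, hm.neg_one_pow]
  match_scalars <;> field_simp

/-- Modulo coboundaries a cocycle (a, b) can be moved so that a is supported on exponents (odd,
even) and b on (even, odd). The averages of these monomials are multiples of the pairs in `hL`. -/
lemma mem_of_d1_id (hε : ε * ε = 1) {L : Submodule k (QPlane k × QPlane k)}
    (hL : ∀ i j, ((q : k) ^ (2 * i) • mon (2 * i + 1) (2 * j),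
      (ε * (q : k) ^ (2 * j)) • mon (2 * j) (2 * i + 1)) ∈ L)
    {p : QPlane k × QPlane k} (hp : d1 (AlgHom.id k _) p = 0)
    (h : ε • swap1 q p - p ∈ LinearMap.range (d0 (AlgHom.id k (QPlane k)))) :
    p ∈ LinearMap.range (d0 (AlgHom.id k (QPlane k))) ⊔ L := by
  have h2 : (2 : k) ≠ 0 := two_ne_zero
  have hq : (q : k) ≠ 0 := q.ne_zero
  have hh : (2 : k) * 2⁻¹ = 1 := mul_inv_cancel₀ h2
  refine mem_of_two_smul ?_ (Submodule.mem_sup_left h)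
  obtain ⟨a, b⟩ := p
  have e (i j : ℕ) := DFunLike.congr_fun (congrArg coef hp) (i, j)
  simp only [d1_apply, map_add, Finsupp.add_apply, AlgHom.id_apply, map_zero,
    Finsupp.zero_apply] at e
  obtain ⟨w₁, hw₁⟩ := exists_coef a injective_succ_left (fun _ j => if Odd j then 2⁻¹ else 0)
  obtain ⟨w₂, hw₂⟩ := exists_coef b injective_succ_right
    (fun i j => if Even j ∧ Odd i then -2⁻¹ else 0)
  -- The commutator with u is twice the shift of w where the exponent of v is odd, and the
  -- commutator with v is minus twice the shift where the exponent of u is odd. So w is chosen to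
  -- remove a when j is odd, and b when j is even and i odd. When i and j are both odd the cocycle
  -- equation makes the two demands agree.
  obtain ⟨w, hw⟩ : ∃ w, ∀ i j, coef w (i, j) = if Odd j then 2⁻¹ * coef a (i + 1, j) else
      if Odd i then -2⁻¹ * coef b (i, j + 1) else 0 := by
    refine ⟨w₁ + w₂, fun i j => ?_⟩
    rw [map_add, Finsupp.add_apply, hw₁, hw₂]
    by_cases hj : Odd j
    · simp [hj]
    · by_cases hi : Odd i <;> simp [hj, hi, Nat.not_odd_iff_even.1 hj]
  obtain ⟨a', ha'⟩ : ∃ a', a = (u * w - w * u) + a' := ⟨_, (add_sub_cancel _ _).symm⟩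
  obtain ⟨b', hb'⟩ : ∃ b', b = (v * w - w * v) + b' := ⟨_, (add_sub_cancel _ _).symm⟩
  have ca (i j : ℕ) (hij : coef a' (i, j) ≠ 0) : Odd i ∧ Even j := by
    have h0 := DFunLike.congr_fun (congrArg coef ha') (i, j)
    rw [map_add, map_sub, Finsupp.add_apply, Finsupp.sub_apply] at h0
    rcases i with _ | i
    · have h1 := e 0 (j + 1)
      simp at h0 h1
      refine absurd ((mul_eq_zero.1 (?_ : (2 : k) * coef a' (0, j) = 0)).resolve_left h2) hij
      linear_combination h1 - 2 * h0
    · rw [coef_u_mul_succ, coef_mul_u_succ, hw] at h0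
      have h1 := e (i + 1) (j + 1)
      simp only [coef_v_mul_succ, coef_mul_v_succ, coef_u_mul_succ, coef_mul_u_succ] at h1
      rcases Nat.even_or_odd j with hj | hj
      · refine ⟨?_, hj⟩
        by_contra hi
        rw [Nat.not_odd_iff_even] at hi
        rw [hi.neg_one_pow, hj.add_one.neg_one_pow] at h1
        rw [hj.neg_one_pow] at h0
        refine hij ((mul_eq_zero.1 (?_ : (2 : k) * coef a' (i + 1, j) = 0)).resolve_left h2)
        linear_combination h1 - 2 * h0
      · rw [hj.neg_one_pow, if_pos hj] at h0
        refine absurd ?_ hij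
        linear_combination -h0 - coef a (i + 1, j) * hh
  have cb (i j : ℕ) (hij : coef b' (i, j) ≠ 0) : Even i ∧ Odd j := by
    have h0 := DFunLike.congr_fun (congrArg coef hb') (i, j)
    rw [map_add, map_sub, Finsupp.add_apply, Finsupp.sub_apply] at h0
    by_contra hcon
    refine hij ((mul_eq_zero.1 (?_ : (2 : k) * coef b' (i, j) = 0)).resolve_left h2)
    rcases j with _ | j
    · have h1 := e (i + 1) 0
      simp at h0 h1
      linear_combination h1 - 2 * h0
    · rw [coef_v_mul_succ, coef_mul_v_succ, hw] at h0
      have h1 := e (i + 1) (j + 1)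
      simp only [coef_v_mul_succ, coef_mul_v_succ, coef_u_mul_succ, coef_mul_u_succ] at h1
      rcases Nat.even_or_odd i with hi | hi <;> rcases Nat.even_or_odd j with hj | hj
      · exact absurd ⟨hi, hj.add_one⟩ hcon
      · rw [hi.neg_one_pow] at h0
        rw [hi.add_one.neg_one_pow, hj.add_one.neg_one_pow] at h1
        linear_combination h1 - 2 * h0
      · rw [hi.neg_one_pow, if_neg (Nat.not_odd_iff_even.2 hj), if_pos hi] at h0
        linear_combination -2 * h0 - 2 * coef b (i, j + 1) * hh
      · rw [hi.neg_one_pow, if_pos hj] at h0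
        rw [hi.add_one.neg_one_pow, hj.add_one.neg_one_pow] at h1
        linear_combination h1 - 2 * h0 + 2 * coef a (i + 1, j) * hh
  set T : QPlane k × QPlane k →ₗ[k] QPlane k × QPlane k := LinearMap.id + ε • swap1 q with hT
  change T (a, b) ∈ _
  have hab : (a, b) = d0 (AlgHom.id k _) w + ((a', 0) + (0, b')) :=
    Prod.ext (by simpa [d0_apply] using ha') (by simpa [d0_apply] using hb')
  rw [hab, map_add T, map_add T]
  refine add_mem (Submodule.mem_sup_left ?_) (Submodule.mem_sup_right (add_mem ?_ ?_))
  · exact ⟨w + ε • swap q w, by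
      rw [map_add, map_smul, ← swap1_d0 q (by simp)]; rfl⟩
  · refine map_mem_of_coef (T ∘ₗ LinearMap.inl k _ _) L a' fun i j hij => ?_
    obtain ⟨⟨i, rfl⟩, hj⟩ := ca i j hij
    obtain ⟨j, rfl⟩ := even_iff_two_dvd.1 hj
    have := L.smul_mem (((q : k) ^ (2 * i))⁻¹) (hL i j)
    convert this using 1
    have hm : Even ((2 * i + 1) * (2 * j)) := (even_two_mul j).mul_left _
    simp only [hT, LinearMap.comp_apply, LinearMap.inl_apply, LinearMap.add_apply, LinearMap.id_apply,
      LinearMap.smul_apply, swap1_apply, swap_mon, inv_pow, hm.neg_one_pow, map_zero, smul_zero, Prod.smul_mk,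
      Prod.mk_add_mk, add_zero, zero_add]
    ext1
    · simp only []
      match_scalars; field_simp
    · simp only []
      match_scalars; field_simp; ring
  · refine map_mem_of_coef (T ∘ₗ LinearMap.inr k _ _) L b' fun j i hij => ?_
    obtain ⟨hj, ⟨i, rfl⟩⟩ := cb j i hij
    obtain ⟨j, rfl⟩ := even_iff_two_dvd.1 hj
    -- Here the monomial is the second entry of the pair indexed by (i, j), so its coefficient ε
    -- q^(2j) is the one inverted, using ε² = 1.
    have := L.smul_mem (ε * ((q : k) ^ (2 * j))⁻¹) (hL i j)
    convert this using 1
    have hm : Even ((2 * j) * (2 * i + 1)) := (even_two_mul j).mul_right _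
    simp only [hT, LinearMap.comp_apply, LinearMap.inr_apply, LinearMap.add_apply, LinearMap.id_apply,
      LinearMap.smul_apply, swap1_apply, swap_mon, inv_pow, hm.neg_one_pow, map_zero, smul_zero, Prod.smul_mk,
      Prod.mk_add_mk, add_zero, zero_add]
    ext1
    · simp only []
      match_scalars; field_simp; ring
    · simp only []
      match_scalars; field_simp; linear_combination -hε

/-- Up to coboundaries only 1 and the monomials with both exponents odd remain. The minus sign in
`hL` comes from the sign (-1)^(ij) in `swap_mon`, which is -1 when i and j are both odd; this is why
symmetric and alternating combinations change roles in degree 2. -/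
lemma mem_of_range_d1_id {L : Submodule k (QPlane k)}
    (hL : ∀ i j, (q : k) ^ (2 * i) • mon (2 * i + 1) (2 * j + 1) -
      (ε * (q : k) ^ (2 * j)) • mon (2 * j + 1) (2 * i + 1) ∈ L) (hL1 : (1 + ε) • 1 ∈ L)
    {r : QPlane k} (h : ε • swap q r - r ∈ LinearMap.range (d1 (AlgHom.id k (QPlane k)))) :
    r ∈ LinearMap.range (d1 (AlgHom.id k (QPlane k))) ⊔ L := by
  have h2 : (2 : k) ≠ 0 := two_ne_zero
  have hq : (q : k) ≠ 0 := q.ne_zero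
  refine mem_of_two_smul ?_ (Submodule.mem_sup_left h)
  set T : QPlane k →ₗ[k] QPlane k := LinearMap.id + ε • (swap q).toLinearMap with hT
  change T r ∈ _
  have hd (p : QPlane k × QPlane k) : T (d1 (AlgHom.id k (QPlane k)) p) ∈
      LinearMap.range (d1 (AlgHom.id k (QPlane k))) ⊔ L :=
    Submodule.mem_sup_left ⟨p + ε • swap1 q p, by
      rw [map_add, map_smul, ← swap_d1 q (by simp)]; rfl⟩
  refine map_mem_of_coef T _ r fun i j _ => ?_
  rcases Nat.even_or_odd i with hi | hi
  · rcases j with _ | j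
    · rcases i with _ | i
      · refine Submodule.mem_sup_right ?_
        convert hL1 using 1
        simp [hT, mon_zero, add_smul]
      · convert hd (0, (2⁻¹ : k) • mon i 0) using 2
        simp [d1_apply, u_mul_mon, mon_mul_u]
        match_scalars; field_simp; norm_num
    · convert hd ((2⁻¹ : k) • mon i j, 0) using 2
      simp [d1_apply, v_mul_mon, mon_mul_v, hi.neg_one_pow]
      match_scalars; field_simp; norm_num
  · rcases Nat.even_or_odd j with hj | hj
    · rcases i with _ | i
      · simp at hi
      · convert hd (0, (2⁻¹ : k) • mon i j) using 2
        simp [d1_apply, u_mul_mon, mon_mul_u, hj.neg_one_pow]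
        match_scalars; field_simp; norm_num
    · refine Submodule.mem_sup_right ?_
      have hm : Odd (i * j) := hi.mul hj
      obtain ⟨i, rfl⟩ := hi
      obtain ⟨j, rfl⟩ := hj
      have := L.smul_mem ((q : k) ^ (2 * i))⁻¹ (hL i j)
      convert this using 1
      simp only [hT, LinearMap.add_apply, LinearMap.id_apply, LinearMap.smul_apply,
        AlgHom.toLinearMap_apply, swap_mon, inv_pow, hm.neg_one_pow]
      match_scalars <;> field_simp <;> ring

/-- The equation u a = q⁻¹ a v expresses the coefficient at (i + 1, j) by that at (i, j + 1) and
makes the coefficients at (0, j) vanish, so induction on i kills all of them. -/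
lemma eq_zero_of_d0_swap {a : QPlane k} (ha : d0 (swap q) a = 0) : a = 0 := by
  have hq : (q : k) ≠ 0 := q.ne_zero
  rw [d0_apply, Prod.mk_eq_zero] at ha
  refine ext_coef fun i => ?_
  induction i with
  | zero =>
    intro j
    have e := DFunLike.congr_fun (congrArg coef ha.1) (0, j + 1)
    simpa [hq] using e
  | succ i ih =>
    intro j
    have e := DFunLike.congr_fun (congrArg coef ha.1) (i + 1, j + 1)
    simpa [hq, ih] using e

lemma range_d1_swap_mon (i j : ℕ) :
    mon (i + 1) j + (q⁻¹ : k) • mon i (j + 1) ∈ LinearMap.range (d1 (swap q)) :=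
  ⟨(0, mon i j), by simp [d1_apply, u_mul_mon, mon_mul_v]⟩

lemma range_d1_swap_mon' (i j : ℕ) : (-1 : k) ^ i • mon i (j + 1) +
    ((q : k) * (-1) ^ j) • mon (i + 1) j ∈ LinearMap.range (d1 (swap q)) :=
  ⟨(mon i j, 0), by simp [d1_apply, v_mul_mon, mon_mul_u, smul_smul]⟩

/-- The two boundaries `range_d1_swap_mon` and `range_d1_swap_mon'` involve the same two monomials.
For i + j odd they are linearly independent, as 2 ≠ 0, so each monomial is a boundary; for i + j
even they are proportional. -/
lemma mon_mem_range_d1_swap_aux {i j : ℕ} (h : Odd (i + j)) :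
    mon i (j + 1) ∈ LinearMap.range (d1 (swap q)) ∧
      mon (i + 1) j ∈ LinearMap.range (d1 (swap q)) := by
  have h2 : (2 : k) ≠ 0 := two_ne_zero
  have hq : (q : k) ≠ 0 := q.ne_zero
  have h1 := Submodule.smul_mem _ ((-1 : k) ^ i) (range_d1_swap_mon' q i j)
  have h3 := Submodule.smul_mem _ (q : k) (range_d1_swap_mon q i j)
  have e1 : (-1 : k) ^ i * (-1) ^ i = 1 := by rw [← mul_pow]; simp
  have e2 : (-1 : k) ^ i * (-1) ^ j = -1 := by rw [← pow_add, h.neg_one_pow]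
  have e3 : (q : k) * (q : k)⁻¹ = 1 := mul_inv_cancel₀ hq
  have e4 : (-1 : k) ^ i * (q * (-1) ^ j) = -q := by linear_combination (q : k) * e2
  simp only [smul_add, smul_smul, e1, e3, e4, one_smul, neg_smul] at h1 h3
  have h4 : mon i (j + 1) ∈ LinearMap.range (d1 (swap q)) := by
    refine mem_of_two_smul (y := mon i (j + 1)) ?_ (by simp)
    convert add_mem h1 h3 using 1
    abel
  refine ⟨h4, ?_⟩
  rw [Submodule.add_mem_iff_left _ h4] at h3
  exact (Submodule.smul_mem_iff _ hq).1 h3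

lemma mon_mem_range_d1_swap {i j : ℕ} (h : Even (i + j)) (h0 : i + j ≠ 0) :
    mon i j ∈ LinearMap.range (d1 (swap q)) := by
  rcases j with _ | j
  · rcases i with _ | i
    · simp at h0
    · exact (mon_mem_range_d1_swap_aux q (by grind)).2
  · exact (mon_mem_range_d1_swap_aux q (by grind)).1

lemma mon_sub_mem_range_d1_swap (i j : ℕ) :
    mon i j - (-(q⁻¹ : k)) ^ i • mon 0 (i + j) ∈ LinearMap.range (d1 (swap q)) := by
  induction i generalizing j with
  | zero => simp
  | succ i ih =>
    have := sub_mem (range_d1_swap_mon q i j) (Submodule.smul_mem _ (q⁻¹ : k) (ih (j + 1)))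
    convert this using 1
    rw [show i + 1 + j = i + (j + 1) by ring]
    rw [pow_succ]
    module

/-- Monomials of positive even total degree are boundaries. In odd total degree n each monomial is a
multiple of v^n modulo boundaries, and the average of u^i v^j has coefficient proportional to (-1)^i
+ (-1)^j, which is 0 since i + j is odd. Only the constants survive. -/
lemma mem_of_range_d1_swap {L : Submodule k (QPlane k)} (hL : 1 ∈ L)
    {r : QPlane k} (h : swap q r - r ∈ LinearMap.range (d1 (swap q))) :
    r ∈ LinearMap.range (d1 (swap q)) ⊔ L := by
  have hq : (q : k) ≠ 0 := q.ne_zero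
  refine mem_of_two_smul ?_ (Submodule.mem_sup_left h)
  set T : QPlane k →ₗ[k] QPlane k := LinearMap.id + (swap q).toLinearMap with hT
  change T r ∈ _
  refine map_mem_of_coef T _ r fun i j _ => ?_
  change mon i j + swap q (mon i j) ∈ _
  by_cases h0 : i + j = 0
  · obtain ⟨rfl, rfl⟩ : i = 0 ∧ j = 0 := by omega
    refine Submodule.mem_sup_right ?_
    rw [mon_zero, map_one]
    exact add_mem hL hL
  refine Submodule.mem_sup_left ?_
  rcases Nat.even_or_odd (i + j) with he | he
  · have hm := mon_mem_range_d1_swap q he h0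
    refine add_mem hm ?_
    obtain ⟨p, hp⟩ := hm
    rw [← hp, swap_d1 q (by simp)]
    exact ⟨_, rfl⟩
  · have h1 := mon_sub_mem_range_d1_swap q i j
    have h2 := Submodule.smul_mem _ ((q⁻¹ : k) ^ i * q ^ j) (mon_sub_mem_range_d1_swap q j i)
    have hm : Even (i * j) := by
      rcases Nat.even_or_odd i with hi | hi
      · exact hi.mul_right _
      · exact ((Nat.odd_add.1 he).1 hi).mul_left _
    rw [swap_mon, hm.neg_one_pow, mul_one]
    convert add_mem h1 h2 using 1
    rw [add_comm j i]
    have : (-(q : k)⁻¹) ^ i + (q : k)⁻¹ ^ i * q ^ j * (-(q : k)⁻¹) ^ j = 0 := by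
      rw [neg_pow, neg_pow (q : k)⁻¹ j]
      have e : (-1 : k) ^ i + (-1) ^ j = 0 := by
        rcases Nat.even_or_odd i with hi | hi
        · rw [hi.neg_one_pow, (by grind : Odd j).neg_one_pow]; ring
        · rw [hi.neg_one_pow, (by grind : Even j).neg_one_pow]; ring
      have e2 : (q : k) ^ j * (q : k)⁻¹ ^ j = 1 := by rw [← mul_pow, mul_inv_cancel₀ hq, one_pow]
      linear_combination (q : k)⁻¹ ^ i * e + (q : k)⁻¹ ^ i * (-1) ^ j * e2
    have h3 := congrArg (· • (mon 0 (i + j) : QPlane k)) this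
    linear_combination (norm := module) h3

/-- The automorphism `u ↦ -u`, `v ↦ v` of `A`. -/
noncomputable def flipU : QPlane k →ₐ[k] QPlane k := lift (-u) v (by simp [vu])

@[simp] lemma flipU_u : flipU (u : QPlane k) = -u := by simp [flipU]
@[simp] lemma flipU_v : flipU (v : QPlane k) = v := by simp [flipU]
lemma flipU_mon (i j : ℕ) : flipU (mon i j : QPlane k) = (-1 : k) ^ i • mon i j := by
  rw [mon, map_mul, map_pow, map_pow, flipU_u, flipU_v, neg_pow, mul_assoc]
  rcases Nat.even_or_odd i with h | h <;> simp [h.neg_one_pow]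

lemma coef_flipU (a : QPlane k) (i j : ℕ) : coef (flipU a) (i, j) = (-1) ^ i * coef a (i, j) :=
  coef_aux (f := Finsupp.lapply (i, j) ∘ₗ coef ∘ₗ flipU.toLinearMap)
    (g := LinearMap.mulLeft k ((-1 : k) ^ i) ∘ₗ Finsupp.lapply (i, j) ∘ₗ coef)
    (fun i' j' => by
      simp only [LinearMap.comp_apply, LinearMap.mulLeft_apply, AlgHom.toLinearMap_apply, flipU_mon,
        map_smul, coef_mon, Finsupp.lapply_apply, Finsupp.single_apply, Prod.mk.injEq]
      by_cases h : i' = i <;> simp [h]) a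

/-- The cochains that represent the twisted classes of degree `1`. -/
noncomputable def twistedCocycle : QPlane k →ₗ[k] QPlane k × QPlane k :=
  LinearMap.id.prod (-(q : k) • flipU.toLinearMap)

lemma twistedCocycle_apply (a : QPlane k) : twistedCocycle q a = (a, -(q : k) • flipU a) := rfl

/-- In each even total degree the representatives `twistedCocycle` are proportional modulo
coboundaries: the coboundary of u^i v^j, with i + j odd, moves one factor from u to v. -/
lemma twistedCocycle_sub_mem {i j : ℕ} (h : Even (i + j)) :
    twistedCocycle q (mon i j) - (q⁻¹ : k) ^ i • twistedCocycle q (mon 0 (i + j)) ∈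
      LinearMap.range (d0 (swap q)) := by
  have hq : (q : k) ≠ 0 := q.ne_zero
  induction i generalizing j with
  | zero => simp
  | succ i ih =>
    have hij : Odd (i + j) := by grind
    have h1 : twistedCocycle q (mon (i + 1) j) - (q⁻¹ : k) • twistedCocycle q (mon i (j + 1)) ∈
        LinearMap.range (d0 (swap q)) := by
      refine ⟨mon i j, ?_⟩
      have e : (-1 : k) ^ j = -(-1) ^ i := by
        have e1 : (-1 : k) ^ i * (-1) ^ i = 1 := by rw [← mul_pow]; simp
        have e2 : (-1 : k) ^ i * (-1) ^ j = -1 := by rw [← pow_add, hij.neg_one_pow]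
        linear_combination (-1 : k) ^ i * e2 - (-1) ^ j * e1
      rw [d0_apply, twistedCocycle_apply, twistedCocycle_apply, swap_u, swap_v, flipU_mon, flipU_mon,
        mul_smul_comm, mul_smul_comm, u_mul_mon, v_mul_mon, mon_mul_u, mon_mul_v, e]
      ext1
      · rfl
      · simp only [Prod.snd_sub, Prod.smul_snd]
        match_scalars
        · field_simp
        · ring
    have h2 := Submodule.smul_mem _ (q⁻¹ : k) (ih (j := j + 1) (by grind))
    convert add_mem h1 h2 using 1
    rw [show i + 1 + j = i + (j + 1) by ring, pow_succ]
    module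

/-- Together with `twistedCocycle_sub_mem` this shows that z negates the twisted classes of degree
1, so their averages are coboundaries. -/
lemma swap1_twistedCocycle {i j : ℕ} (h : Even (i + j)) :
    swap1 q (twistedCocycle q (mon i j)) =
      -((q⁻¹ : k) ^ i * q ^ j) • twistedCocycle q (mon j i) := by
  have hq : (q : k) ≠ 0 := q.ne_zero
  have e : (-1 : k) ^ j = (-1) ^ i ∧ (-1 : k) ^ (i * j) = (-1) ^ i ∧ (-1 : k) ^ i * (-1) ^ i = 1 := by
    rcases Nat.even_or_odd i with hi | hi
    · rw [hi.neg_one_pow, (by grind : Even j).neg_one_pow, (hi.mul_right j).neg_one_pow]; simp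
    · have hj : Odd j := by grind
      rw [hi.neg_one_pow, hj.neg_one_pow, (hi.mul hj).neg_one_pow]; simp
  obtain ⟨e1, e2, e3⟩ := e
  rw [swap1_apply, twistedCocycle_apply, twistedCocycle_apply, flipU_mon, flipU_mon, map_smul, map_smul,
    swap_mon, e1, e2]
  ext1
  · simp only [Prod.smul_fst]
    match_scalars
    have hqq : (q : k)⁻¹ * q = 1 := inv_mul_cancel₀ hq
    linear_combination -((q : k)⁻¹ ^ i * q ^ j) * ((q : k)⁻¹ * q) * e3 - ((q : k)⁻¹ ^ i * q ^ j) * hqq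
  · simp only [Prod.smul_snd]
    match_scalars
    ring

-- A cocycle is corrected by a coboundary until it vanishes in odd total degree. In even total
-- degree the cocycle equation forces the form `twistedCocycle q a'`, and the average of such a
-- cocycle is a coboundary.
set_option maxHeartbeats 1000000 in
lemma mem_of_d1_swap {p : QPlane k × QPlane k} (hp : d1 (swap q) p = 0)
    (h : swap1 q p - p ∈ LinearMap.range (d0 (swap q))) :
    p ∈ LinearMap.range (d0 (swap q)) := by
  have h2 : (2 : k) ≠ 0 := two_ne_zero
  have hq : (q : k) ≠ 0 := q.ne_zero
  refine mem_of_two_smul ?_ h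
  obtain ⟨a, b⟩ := p
  have e (i j : ℕ) := DFunLike.congr_fun (congrArg coef hp) (i, j)
  simp only [d1_apply, map_add, Finsupp.add_apply, swap_u, swap_v, mul_smul_comm, map_smul,
    Finsupp.smul_apply, smul_eq_mul, map_zero, Finsupp.zero_apply] at e
  obtain ⟨w₁, hw₁⟩ := exists_coef a injective_succ_left (fun i j => if Even (i + j) then 2⁻¹ else 0)
  obtain ⟨w₂, hw₂⟩ := exists_coef b injective_succ_left
    (fun i j => if Even (i + j) then -(2⁻¹ * (q : k)⁻¹ * (-1) ^ i) else 0)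
  -- If (a, b) were the coboundary of w, its two coefficients at (i + 1, j) would be combinations of
  -- w at (i, j) and at (i + 1, j - 1). For i + j even, eliminating the latter gives this formula.
  -- In odd total degree w is 0, so the part of (a, b) in even total degree is untouched.
  obtain ⟨w, hw⟩ : ∃ w, ∀ i j, coef w (i, j) = if Even (i + j) then
      2⁻¹ * (coef a (i + 1, j) - (q : k)⁻¹ * (-1) ^ i * coef b (i + 1, j)) else 0 := by
    refine ⟨w₁ + w₂, fun i j => ?_⟩
    rw [map_add, Finsupp.add_apply, hw₁, hw₂]
    by_cases hj : Even (i + j)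
    · simp only [hj, if_true]; ring
    · simp [hj]
  obtain ⟨a', ha'⟩ : ∃ a', a = (u * w - (q⁻¹ : k) • (w * v)) + a' := ⟨_, (add_sub_cancel _ _).symm⟩
  obtain ⟨b', hb'⟩ : ∃ b', b = (v * w - (q : k) • (w * u)) + b' := ⟨_, (add_sub_cancel _ _).symm⟩
  have hQ : (q : k) * (q : k)⁻¹ = 1 := mul_inv_cancel₀ hq
  have hH : (2 : k) * 2⁻¹ = 1 := mul_inv_cancel₀ h2
  have fa (i j : ℕ) := DFunLike.congr_fun (congrArg coef ha') (i, j)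
  have fb (i j : ℕ) := DFunLike.congr_fun (congrArg coef hb') (i, j)
  simp only [map_add, map_sub, Finsupp.add_apply, Finsupp.sub_apply, map_smul, Finsupp.smul_apply,
    smul_eq_mul] at fa fb
  have sgn (n : ℕ) : (-1 : k) ^ n * (-1) ^ n = 1 := by rw [← mul_pow]; simp
  have ca (i j : ℕ) (hij : Odd (i + j)) : coef a' (i, j) = 0 := by
    have s1 := sgn i
    have s2 : (-1 : k) ^ j = -(-1) ^ i := by
      have s3 : (-1 : k) ^ i * (-1) ^ j = -1 := by rw [← pow_add, hij.neg_one_pow]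
      linear_combination (-1 : k) ^ i * s3 - (-1) ^ j * s1
    have h0 := fa i j
    have h1 := e (i + 1) j
    have h2 := e i (j + 1)
    rcases i with _ | i <;> rcases j with _ | j
    · simp at hij
    · have hw1 := hw 0 j
      rw [if_pos (by grind)] at hw1
      simp [s2] at h0 h1 h2 hw1 s2
      grind
    · have hw1 := hw i 0
      rw [if_pos (by grind)] at hw1
      simp [s2] at h0 h1 h2 hw1 s2
      grind
    · have hw1 := hw i (j + 1)
      have hw2 := hw (i + 1) j
      rw [if_pos (by grind)] at hw1 hw2
      simp [s2] at h0 h1 h2 hw1 hw2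
      grind
  have cb (i j : ℕ) (hij : Odd (i + j)) : coef b' (i, j) = 0 := by
    have s1 := sgn i
    have s2 : (-1 : k) ^ j = -(-1) ^ i := by
      have s3 : (-1 : k) ^ i * (-1) ^ j = -1 := by rw [← pow_add, hij.neg_one_pow]
      linear_combination (-1 : k) ^ i * s3 - (-1) ^ j * s1
    have h0 := fb i j
    have h1 := e (i + 1) j
    have h2 := e i (j + 1)
    rcases i with _ | i <;> rcases j with _ | j
    · simp at hij
    · have hw1 := hw 0 j
      rw [if_pos (by grind)] at hw1
      simp [s2] at h0 h1 h2 hw1 s2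
      grind
    · have hw1 := hw i 0
      rw [if_pos (by grind)] at hw1
      simp [s2] at h0 h1 h2 hw1 s2
      grind
    · have hw1 := hw i (j + 1)
      have hw2 := hw (i + 1) j
      rw [if_pos (by grind)] at hw1 hw2
      simp [s2] at h0 h1 h2 hw1 hw2
      grind
  -- In even total degree the cocycle equation is a recurrence along the antidiagonal i + j = const
  -- that determines b from a, starting at i = 0.
  have cab₀ (i j : ℕ) (hij : Even (i + j)) : coef b (i, j) = -q * ((-1) ^ i * coef a (i, j)) := by
    induction i generalizing j with
    | zero =>
      have h0 := e 0 (j + 1)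
      simp at h0 ⊢
      grind
    | succ i ih =>
      have h0 := e (i + 1) (j + 1)
      have h1 := ih (j + 1) (by grind)
      have s2 : (-1 : k) ^ (j + 1) = (-1) ^ i := neg_one_pow_congr (by grind)
      rw [coef_v_mul_succ, coef_mul_v_succ, coef_u_mul_succ, coef_mul_u_succ, h1, s2] at h0
      grind
  have cab (i j : ℕ) (hij : Even (i + j)) : coef b' (i, j) = -q * ((-1) ^ i * coef a' (i, j)) := by
    have ea : coef a (i, j) = coef a' (i, j) := by
      have h0 := fa i j
      rcases i with _ | i <;> rcases j with _ | j
      · simpa using h0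
      · have hw1 := hw 0 j
        rw [if_neg (by grind)] at hw1
        simpa [hw1] using h0
      · have hw1 := hw i 0
        rw [if_neg (by grind)] at hw1
        simpa [hw1] using h0
      · have hw1 := hw i (j + 1)
        have hw2 := hw (i + 1) j
        rw [if_neg (by grind)] at hw1 hw2
        simpa [hw1, hw2] using h0
    have eb : coef b (i, j) = coef b' (i, j) := by
      have h0 := fb i j
      rcases i with _ | i <;> rcases j with _ | j
      · simpa using h0
      · have hw1 := hw 0 j
        rw [if_neg (by grind)] at hw1
        simpa [hw1] using h0
      · have hw1 := hw i 0
        rw [if_neg (by grind)] at hw1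
        simpa [hw1] using h0
      · have hw1 := hw i (j + 1)
        have hw2 := hw (i + 1) j
        rw [if_neg (by grind)] at hw1 hw2
        simpa [hw1, hw2] using h0
    rw [← ea, ← eb, cab₀ i j hij]
  have hb : b' = -(q : k) • flipU a' := by
    refine ext_coef fun i j => ?_
    rw [map_smul, Finsupp.smul_apply, coef_flipU, smul_eq_mul]
    rcases Nat.even_or_odd (i + j) with hij | hij
    · exact cab i j hij
    · rw [ca i j hij, cb i j hij]; simp
  set T : QPlane k × QPlane k →ₗ[k] QPlane k × QPlane k := LinearMap.id + swap1 q with hT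
  change T (a, b) ∈ _
  have hab : (a, b) = d0 (swap q) w + twistedCocycle q a' := by
    rw [d0_apply, swap_u, swap_v, mul_smul_comm, mul_smul_comm, twistedCocycle_apply, ← hb]
    exact Prod.ext ha' hb'
  rw [hab, map_add T]
  refine add_mem ⟨w + swap q w, by rw [map_add, ← swap1_d0 q (by simp)]; rfl⟩ ?_
  refine map_mem_of_coef (T ∘ₗ twistedCocycle q) _ a' fun i j hij => ?_
  have he : Even (i + j) := by
    by_contra he
    exact hij (ca i j (Nat.not_even_iff_odd.1 he))
  change twistedCocycle q (mon i j) + swap1 q (twistedCocycle q (mon i j)) ∈ _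
  rw [swap1_twistedCocycle q he]
  have h1 := twistedCocycle_sub_mem q he
  have h3 := Submodule.smul_mem _ ((q⁻¹ : k) ^ i * q ^ j) (twistedCocycle_sub_mem q (i := j) (j := i)
    (by rwa [add_comm]))
  convert sub_mem h1 h3 using 1
  rw [add_comm j i]
  have : (q : k) ^ j * (q : k)⁻¹ ^ j = 1 := by rw [← mul_pow, mul_inv_cancel₀ hq, one_pow]
  have h4 := congrArg (fun c => ((q : k)⁻¹ ^ i * c) • twistedCocycle q (mon 0 (i + j))) this
  linear_combination (norm := module) -h4

end QPlane

/-! ### Invariant classes are combinations of the listed elements. -/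

section Invariants

open SmashProduct PlaneDual QPlane

variable {k : Type*} [Field k] [NeZero (2 : k)] (q : kˣ)

lemma elt_eq (ξ : PlaneDual k) (s t : ℕ) (h : KP k) :
    elt q ξ s t h = ξ ⊗ₜ (inAHom q (mon s t) * inHHom q h) := by
  rw [elt, tmul_eq]; rfl

/-- `a ↦ a h` for `h = KP.bas g` -/
noncomputable def smashBas (g : Fin 8) : QPlane k →ₗ[k] KPSmash q :=
  LinearMap.mulRight k (inHHom q (KP.bas g)) ∘ₗ (inAHom q).toLinearMap

lemma smashBas_apply (g : Fin 8) (a : QPlane k) :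
    smashBas q g a = inAHom q a * inHHom q (KP.bas g) := rfl

lemma sum_smashBas (X : KPSmash q) : ∑ g, smashBas q g (comp q g X) = X := sum_comp q X

/-- The components of a pair of elements of `A # H`. -/
noncomputable def compPair (g : Fin 8) : KPSmash q × KPSmash q →ₗ[k] QPlane k × QPlane k :=
  (comp q g).prodMap (comp q g)

/-- `(a, b) ↦ (a h, b h)` for `h = KP.bas g` -/
noncomputable def smashBasPair (g : Fin 8) : QPlane k × QPlane k →ₗ[k] KPSmash q × KPSmash q :=
  (smashBas q g).prodMap (smashBas q g)

lemma sum_smashBasPair (p : KPSmash q × KPSmash q) : ∑ g, smashBasPair q g (compPair q g p) = p := by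
  ext1
  · rw [Prod.fst_sum]; exact sum_smashBas q p.1
  · rw [Prod.snd_sum]; exact sum_smashBas q p.2

lemma compPair_smashD0 (g : Fin 8) (b : KPSmash q) :
    compPair q g (smashD0 q b) = d0 (twist q g) (comp q g b) := by
  rw [smashD0_apply, d0_apply]
  simp [compPair]

lemma comp_smashD1 (g : Fin 8) (p : KPSmash q × KPSmash q) :
    comp q g (smashD1 q p) = d1 (twist q g) (compPair q g p) := by
  rw [smashD1_apply, d1_apply]
  simp [compPair]

lemma smashBas_mul_inA (g : Fin 8) (a b : QPlane k) :
    smashBas q g a * inAHom q b = smashBas q g (a * twist q g b) := by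
  rw [smashBas_apply, smashBas_apply, mul_assoc, bas_mul_inA, ← mul_assoc, map_mul]
lemma inA_mul_smashBas (g : Fin 8) (a b : QPlane k) :
    inAHom q b * smashBas q g a = smashBas q g (b * a) := by
  rw [smashBas_apply, smashBas_apply, ← mul_assoc, map_mul]

lemma smashD0_smashBas (g : Fin 8) (a : QPlane k) :
    smashD0 q (smashBas q g a) = smashBasPair q g (d0 (twist q g) a) := by
  rw [smashD0_apply, d0_apply]
  simp [smashBasPair, smashBas_mul_inA, inA_mul_smashBas]

lemma smashD1_smashBasPair (g : Fin 8) (p : QPlane k × QPlane k) :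
    smashD1 q (smashBasPair q g p) = smashBas q g (d1 (twist q g) p) := by
  rw [smashD1_apply, d1_apply]
  simp [smashBasPair, smashBas_mul_inA, inA_mul_smashBas]

lemma kosAct_z_kos1 (p : KPSmash q × KPSmash q) : kosAct q (KP.gen .z) (kos1 q p) =
    kos1 q ((q⁻¹ : k) • conjZ q p.2, (q : k) • conjZ q p.1) := by
  rw [kos1_apply, map_add, kosAct_z, kosAct_z, PlaneDual.swap_us, PlaneDual.swap_vs, kos1_apply]
  simp only [TensorProduct.smul_tmul]
  rw [add_comm]

lemma swap_us_mul_vs : PlaneDual.swap q (us * vs) = us * vs := by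
  rw [map_mul, PlaneDual.swap_us, PlaneDual.swap_vs, smul_mul_smul_comm, mul_comm vs]
  simp

lemma kosAct_z_kos2 (b : KPSmash q) : kosAct q (KP.gen .z) (kos2 q b) = kos2 q (conjZ q b) := by
  rw [kos2_apply, kosAct_z, swap_us_mul_vs]; rfl
lemma kosAct_z_kos0 (b : KPSmash q) : kosAct q (KP.gen .z) (kos0 q b) = kos0 q (conjZ q b) := by
  rw [kos0_apply, kosAct_z, map_one]; rfl

lemma kosAct_x_kos1 (p : KPSmash q × KPSmash q) : kosAct q (KP.gen .x) (kos1 q p) =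
    kos1 q (inGen q .x * p.1 * inGen q .x, inGen q .x * p.2 * inGen q .x) := by
  rw [kos1_apply, map_add, kosAct_x, kosAct_x]; rfl
lemma kosAct_x_kos2 (b : KPSmash q) : kosAct q (KP.gen .x) (kos2 q b) =
    kos2 q (inGen q .x * b * inGen q .x) := by
  rw [kos2_apply, kosAct_x]; rfl
lemma kosAct_y_kos1 (p : KPSmash q × KPSmash q) : kosAct q (KP.gen .y) (kos1 q p) =
    kos1 q (inGen q .y * p.1 * inGen q .y, inGen q .y * p.2 * inGen q .y) := by
  rw [kos1_apply, map_add, kosAct_y, kosAct_y]; rfl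
lemma kosAct_y_kos2 (b : KPSmash q) : kosAct q (KP.gen .y) (kos2 q b) =
    kos2 q (inGen q .y * b * inGen q .y) := by
  rw [kos2_apply, kosAct_y]; rfl

lemma twist_of_lt {g : Fin 8} (hg : g < 4) : twist q g = AlgHom.id k _ := if_pos hg
lemma twist_of_not_lt {g : Fin 8} (hg : ¬ g < 4) : twist q g = QPlane.swap q := if_neg hg

/-! Symmetries of the listed elements. -/

lemma sym0_comm (i j : ℕ) (h : KP k) : sym0 q i j h = sym0 q j i h := add_comm _ _
lemma alt0_comm (i j : ℕ) (h : KP k) : alt0 q i j h = -alt0 q j i h := (neg_sub _ _).symm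
lemma sym2_comm (i j : ℕ) (h : KP k) : sym2 q i j h = sym2 q j i h := add_comm _ _
lemma alt2_comm (i j : ℕ) (h : KP k) : alt2 q i j h = -alt2 q j i h := (neg_sub _ _).symm
lemma alt0_self (i : ℕ) (h : KP k) : alt0 q i i h = 0 := sub_self _
lemma alt2_self (i : ℕ) (h : KP k) : alt2 q i i h = 0 := sub_self _

lemma sym0_mem (i j : ℕ) (g : Fin 8) (hg : g < 3) :
    sym0 q i j (KP.bas g) ∈ Submodule.span k (Set.range (elements0 q)) := by
  wlog h : i ≤ j generalizing i j
  · rw [sym0_comm]; exact this j i (le_of_not_ge h)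
  fin_cases g <;> simp at hg
  exacts [Submodule.subset_span ⟨.c1 i j h, rfl⟩, Submodule.subset_span ⟨.c2 i j h, rfl⟩,
    Submodule.subset_span ⟨.c3 i j h, rfl⟩]

lemma alt0_mem (i j : ℕ) :
    alt0 q i j (KP.bas 3) ∈ Submodule.span k (Set.range (elements0 q)) := by
  rcases lt_trichotomy i j with h | rfl | h
  · exact Submodule.subset_span ⟨.c4 i j h, rfl⟩
  · rw [alt0_self]; exact zero_mem _
  · rw [alt0_comm]; exact neg_mem (Submodule.subset_span ⟨.c4 j i h, rfl⟩)

lemma sym1_mem (i j : ℕ) (g : Fin 8) (hg : g < 3) :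
    sym1 q i j (KP.bas g) ∈ Submodule.span k (Set.range (elements1 q)) := by
  fin_cases g <;> simp at hg
  exacts [Submodule.subset_span ⟨.c1 i j, rfl⟩, Submodule.subset_span ⟨.c2 i j, rfl⟩,
    Submodule.subset_span ⟨.c3 i j, rfl⟩]

lemma alt1_mem (i j : ℕ) :
    alt1 q i j (KP.bas 3) ∈ Submodule.span k (Set.range (elements1 q)) :=
  Submodule.subset_span ⟨.c4 i j, rfl⟩

lemma alt2_mem (i j : ℕ) (g : Fin 8) (hg : g < 3) :
    alt2 q i j (KP.bas g) ∈ Submodule.span k (Set.range (elements2 q)) := by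
  have key (i j : ℕ) (h : i < j) :
      alt2 q i j (KP.bas g) ∈ Submodule.span k (Set.range (elements2 q)) := by
    fin_cases g <;> simp at hg
    exacts [Submodule.subset_span ⟨.c1 i j h, rfl⟩, Submodule.subset_span ⟨.c2 i j h, rfl⟩,
      Submodule.subset_span ⟨.c3 i j h, rfl⟩]
  rcases lt_trichotomy i j with h | rfl | h
  · exact key i j h
  · rw [alt2_self]; exact zero_mem _
  · rw [alt2_comm]; exact neg_mem (key j i h)

lemma sym2_mem (i j : ℕ) :
    sym2 q i j (KP.bas 3) ∈ Submodule.span k (Set.range (elements2 q)) := by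
  wlog h : i ≤ j generalizing i j
  · rw [sym2_comm]; exact this j i (le_of_not_ge h)
  exact Submodule.subset_span ⟨.c4 i j h, rfl⟩

/-! Invariant classes are combinations of the listed elements. -/

lemma map_mem_sup {M N : Type*} [AddCommGroup M] [Module k M] [AddCommGroup N] [Module k N]
    (f : M →ₗ[k] N) {R L : Submodule k M} {R' L' : Submodule k N} (hR : R ≤ R'.comap f)
    (hL : L ≤ L'.comap f) {x : M} (hx : x ∈ R ⊔ L) : f x ∈ R' ⊔ L' := by
  obtain ⟨y, hy, z, hz, rfl⟩ := Submodule.mem_sup.1 hx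
  rw [map_add]
  exact add_mem (Submodule.mem_sup_left (hR hy)) (Submodule.mem_sup_right (hL hz))

lemma conjSign_of_lt {g : Fin 8} (hg : g < 3) : (conjSign g : k) = 1 := by
  fin_cases g <;> simp at hg <;> rfl
lemma conjSign_of_lt' {g : Fin 8} (hg : ¬ g < 4) (hg' : g < 6) : (conjSign g : k) = 1 := by
  fin_cases g <;> simp at hg hg' <;> rfl
lemma conjSign_three : (conjSign 3 : k) = -1 := rfl

/-- In degree 0 there are no coboundaries, so invariance under z is an equality. All four twisted
components vanish already by the cocycle condition. -/
lemma invariant_mem_zero {ζ : Kos q} (hζ : ζ ∈ kosZ q 0)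
    (h : ∀ h : KP k, kosAct q h ζ - KP.counitHom h • ζ ∈ kosB q 0) :
    ζ ∈ kosB q 0 ⊔ Submodule.span k (Set.range (elements0 q)) := by
  obtain ⟨b, rfl⟩ : ζ ∈ LinearMap.range (kos0 q) := by
    rw [← kosCochain_zero]; exact (Submodule.mem_inf.1 hζ).1
  rw [kos0_mem_kosZ] at hζ
  refine Submodule.mem_sup_right ?_
  have hz := h (KP.gen .z)
  rw [KP.counitHom_z, one_smul, kosAct_z_kos0, ← map_sub, kos0_mem_kosB] at hz
  have hc (g : Fin 8) : d0 (twist q g) (comp q g b) = 0 := by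
    rw [← compPair_smashD0, hζ]; exact map_zero _
  have hcz (g : Fin 8) (hg : g < 6) :
      (conjSign g : k) • QPlane.swap q (comp q g b) - comp q g b = 0 := by
    rw [← comp_conjZ q g hg, ← map_sub, hz, map_zero]
  rw [← sum_smashBas q b, map_sum]
  refine Submodule.sum_mem _ fun g _ => ?_
  by_cases hg : g < 4
  · refine mem_of_d0_id q (ε := conjSign g)
      (L := (Submodule.span k (Set.range (elements0 q))).comap (kos0 q ∘ₗ smashBas q g))
      (fun i j => ?_) (twist_of_lt q hg ▸ hc g) ?_
    · rw [Submodule.mem_comap, LinearMap.comp_apply]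
      by_cases hg3 : g < 3
      · convert sym0_mem q i j g hg3 using 1
        rw [conjSign_of_lt hg3, one_mul, sym0, elt_eq, elt_eq]
        simp [kos0_apply, smashBas_apply, add_mul, sub_mul, TensorProduct.tmul_add, TensorProduct.tmul_sub]
      · obtain rfl : g = 3 := by omega
        convert alt0_mem q i j using 1
        rw [conjSign_three, alt0, elt_eq, elt_eq]
        simp [kos0_apply, smashBas_apply, sub_eq_add_neg, add_mul, TensorProduct.tmul_add, TensorProduct.tmul_neg]
    · rw [hcz g (hg.trans (by decide))]; exact zero_mem _
  · rw [eq_zero_of_d0_swap q (a := comp q g b) (by rw [← twist_of_not_lt q hg]; exact hc g)]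
    simp

/-- The eight components are treated separately: for 0 to 3 averaging by z gives listed elements,
for 4 and 5 it gives coboundaries, and 6 and 7 are coboundaries by invariance under x. -/
lemma invariant_mem_one {ζ : Kos q} (hζ : ζ ∈ kosZ q 1)
    (h : ∀ h : KP k, kosAct q h ζ - KP.counitHom h • ζ ∈ kosB q 1) :
    ζ ∈ kosB q 1 ⊔ Submodule.span k (Set.range (elements1 q)) := by
  obtain ⟨p, rfl⟩ : ζ ∈ LinearMap.range (kos1 q) := by
    rw [← kosCochain_one]; exact (Submodule.mem_inf.1 hζ).1
  rw [kos1_mem_kosZ] at hζ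
  have hz := h (KP.gen .z)
  have hx := h (KP.gen .x)
  rw [KP.counitHom_z, one_smul, kosAct_z_kos1, ← map_sub, kos1_mem_kosB] at hz
  rw [KP.counitHom_x, one_smul, kosAct_x_kos1, ← map_sub, kos1_mem_kosB] at hx
  obtain ⟨b, hb⟩ := hz
  obtain ⟨c, hc⟩ := hx
  have hd (g : Fin 8) : d1 (twist q g) (compPair q g p) = 0 := by
    rw [← comp_smashD1, hζ, map_zero]
  have hcz (g : Fin 8) (hg : g < 6) :
      (conjSign g : k) • QPlane.swap1 q (compPair q g p) - compPair q g p ∈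
        LinearMap.range (d0 (twist q g)) := by
    refine ⟨comp q g b, ?_⟩
    rw [← compPair_smashD0, hb, map_sub]
    congr 1
    ext1 <;> simp [compPair, swap1_apply, comp_conjZ q g hg, smul_comm (conjSign g : k)]
  have hcx (g : Fin 8) (hg : ¬ g < 6) : compPair q g p ∈ LinearMap.range (d0 (twist q g)) := by
    refine mem_of_two_smul (y := -compPair q g p) (by simp) ⟨comp q g c, ?_⟩
    rw [← compPair_smashD0, hc, map_sub]
    congr 1
    ext1 <;> simp [compPair, comp_conjX q g hg]
  have hR (g : Fin 8) : LinearMap.range (d0 (twist q g)) ≤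
      (kosB q 1).comap (kos1 q ∘ₗ smashBasPair q g) := by
    rintro _ ⟨a, rfl⟩
    rw [Submodule.mem_comap, LinearMap.comp_apply, ← smashD0_smashBas, kos1_mem_kosB]
    exact ⟨_, rfl⟩
  rw [← sum_smashBasPair q p, map_sum]
  refine Submodule.sum_mem _ fun g _ => ?_
  by_cases hg : g < 4
  · refine map_mem_sup (kos1 q ∘ₗ smashBasPair q g) (hR g) le_rfl ?_
    have hz := hcz g (hg.trans (by decide))
    have hdg := hd g
    rw [twist_of_lt q hg] at hz hdg ⊢
    refine mem_of_d1_id q (ε := conjSign g) ?_ (fun i j => ?_) hdg hz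
    · by_cases hg3 : g < 3
      · rw [conjSign_of_lt hg3, one_mul]
      · obtain rfl : g = 3 := by omega
        rw [conjSign_three]; ring
    · rw [Submodule.mem_comap, LinearMap.comp_apply]
      by_cases hg3 : g < 3
      · convert sym1_mem q i j g hg3 using 1
        rw [conjSign_of_lt hg3, one_mul, sym1, elt_eq, elt_eq]
        simp [kos1_apply, smashBasPair, smashBas_apply]
      · obtain rfl : g = 3 := by omega
        convert alt1_mem q i j using 1
        rw [conjSign_three, alt1, elt_eq, elt_eq]
        simp [kos1_apply, smashBasPair, smashBas_apply, sub_eq_add_neg, TensorProduct.tmul_neg]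
  · refine Submodule.mem_sup_left (hR g ?_)
    by_cases hg6 : g < 6
    · have hz := hcz g hg6
      have hdg := hd g
      rw [conjSign_of_lt' hg hg6, one_smul] at hz
      rw [twist_of_not_lt q hg] at hz hdg ⊢
      exact mem_of_d1_swap q hdg hz
    · exact hcx g hg6

/-- The division into components is as in degree 1, except that the constants in components 4 and 5
survive. In component 3 the sign is -1, and the average of 1 is 0, so there is no constant class
with `xMinus`. -/
lemma invariant_mem_two {ζ : Kos q} (hζ : ζ ∈ kosZ q 2)
    (h : ∀ h : KP k, kosAct q h ζ - KP.counitHom h • ζ ∈ kosB q 2) :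
    ζ ∈ kosB q 2 ⊔ Submodule.span k (Set.range (elements2 q)) := by
  obtain ⟨r, rfl⟩ : ζ ∈ LinearMap.range (kos2 q) := by
    rw [← kosCochain_two]; exact (Submodule.mem_inf.1 hζ).1
  have hz := h (KP.gen .z)
  have hx := h (KP.gen .x)
  rw [KP.counitHom_z, one_smul, kosAct_z_kos2, ← map_sub, kos2_mem_kosB] at hz
  rw [KP.counitHom_x, one_smul, kosAct_x_kos2, ← map_sub, kos2_mem_kosB] at hx
  obtain ⟨b, hb⟩ := hz
  obtain ⟨c, hc⟩ := hx
  have hcz (g : Fin 8) (hg : g < 6) : (conjSign g : k) • QPlane.swap q (comp q g r) - comp q g r ∈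
        LinearMap.range (d1 (twist q g)) :=
    ⟨compPair q g b, by rw [← comp_smashD1, hb, map_sub, comp_conjZ q g hg]⟩
  have hcx (g : Fin 8) (hg : ¬ g < 6) : comp q g r ∈ LinearMap.range (d1 (twist q g)) := by
    refine mem_of_two_smul (y := -comp q g r) (by simp) ⟨compPair q g c, ?_⟩
    rw [← comp_smashD1, hc, map_sub, comp_conjX q g hg]
  have hR (g : Fin 8) : LinearMap.range (d1 (twist q g)) ≤
      (kosB q 2).comap (kos2 q ∘ₗ smashBas q g) := by
    rintro _ ⟨a, rfl⟩
    rw [Submodule.mem_comap, LinearMap.comp_apply, ← smashD1_smashBasPair, kos2_mem_kosB]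
    exact ⟨_, rfl⟩
  have hone (g : Fin 8) (hg : g < 3 ∨ g = 4 ∨ g = 5) :
      kos2 q (smashBas q g 1) ∈ Submodule.span k (Set.range (elements2 q)) := by
    have e : kos2 q (smashBas q g 1) = elt q (us * vs) 0 0 (KP.bas g) := by
      rw [elt_eq, mon_zero]; rfl
    rw [e]
    fin_cases g <;> simp at hg
    exacts [Submodule.subset_span ⟨.e1, rfl⟩, Submodule.subset_span ⟨.e2, rfl⟩,
      Submodule.subset_span ⟨.e3, rfl⟩, Submodule.subset_span ⟨.e4, rfl⟩,
      Submodule.subset_span ⟨.e5, rfl⟩]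
  rw [← sum_smashBas q r, map_sum]
  refine Submodule.sum_mem _ fun g _ => ?_
  by_cases hg : g < 4
  · refine map_mem_sup (kos2 q ∘ₗ smashBas q g) (hR g) le_rfl ?_
    have hz := hcz g (hg.trans (by decide))
    rw [twist_of_lt q hg] at hz ⊢
    refine mem_of_range_d1_id q (ε := conjSign g) (fun i j => ?_) ?_ hz
    · rw [Submodule.mem_comap, LinearMap.comp_apply]
      by_cases hg3 : g < 3
      · convert alt2_mem q i j g hg3 using 1
        rw [conjSign_of_lt hg3, one_mul, alt2, elt_eq, elt_eq]
        simp [kos2_apply, smashBas_apply, add_mul, sub_mul, TensorProduct.tmul_add, TensorProduct.tmul_sub]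
      · obtain rfl : g = 3 := by omega
        convert sym2_mem q i j using 1
        rw [conjSign_three, sym2, elt_eq, elt_eq]
        simp [kos2_apply, smashBas_apply, add_mul, sub_mul, TensorProduct.tmul_add, TensorProduct.tmul_sub]
    · by_cases hg3 : g < 3
      · exact Submodule.smul_mem _ _ (hone g (Or.inl hg3))
      · obtain rfl : g = 3 := by omega
        rw [conjSign_three, add_neg_cancel, zero_smul]; exact zero_mem _
  · by_cases hg6 : g < 6
    · refine map_mem_sup (kos2 q ∘ₗ smashBas q g) (hR g) le_rfl ?_
      have hz := hcz g hg6
      rw [conjSign_of_lt' hg hg6, one_smul] at hz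
      rw [twist_of_not_lt q hg] at hz ⊢
      exact mem_of_range_d1_swap q (hone g (by omega)) hz
    · exact Submodule.mem_sup_left (hR g (hcx g hg6))

end Invariants

/-! ### Coefficients that separate the listed classes. -/

section Independence

open SmashProduct PlaneDual QPlane

variable {k : Type*} [Field k] [NeZero (2 : k)] (q : kˣ)

/-- The coefficient of `ξ ⊗ u^s v^t h`, where `ξ` is the basis element of `A^!` with index `c` and
`h = KP.bas g`. -/
noncomputable def kosCoef (c : Fin 4) (g : Fin 8) (s t : ℕ) : Kos q →ₗ[k] k :=
  Finsupp.lapply (s, t) ∘ₗ coef ∘ₗ comp q g ∘ₗ kosCoord q c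

lemma kosCoef_apply (c : Fin 4) (g : Fin 8) (s t : ℕ) (ζ : Kos q) :
    kosCoef q c g s t ζ = coef (comp q g (kosCoord q c ζ)) (s, t) := rfl

lemma kosCoef_elt (c : Fin 4) (g g' : Fin 8) (s t s' t' : ℕ) (ξ : PlaneDual k) :
    kosCoef q c g s t (elt q ξ s' t' (KP.bas g')) =
      coord c ξ * if g = g' ∧ s' = s ∧ t' = t then 1 else 0 := by
  rw [kosCoef_apply, elt_eq, kosCoord_tmul, map_smul, comp_bas, map_smul, Finsupp.smul_apply,
    smul_eq_mul]
  split_ifs with h1 h2 h2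
  · simp [h2]
  · rw [coef_mon, Finsupp.single_apply, if_neg (by simpa [h1] using h2)]
  · exact absurd h2.1 h1
  · simp

/-- The coordinate of a class of degree `0` dual to an element of the list. -/
noncomputable def dual0 : Index0 → Kos q →ₗ[k] k
  | .c1 i j _ => kosCoef q 0 0 (2 * i) (2 * j)
  | .c2 i j _ => kosCoef q 0 1 (2 * i) (2 * j)
  | .c3 i j _ => kosCoef q 0 2 (2 * i) (2 * j)
  | .c4 i j _ => kosCoef q 0 3 (2 * i) (2 * j)

/-- The coordinate of a class of degree `1` dual to an element of the list. -/
noncomputable def dual1 : Index1 → Kos q →ₗ[k] k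
  | .c1 i j => kosCoef q 1 0 (2 * i + 1) (2 * j)
  | .c2 i j => kosCoef q 1 1 (2 * i + 1) (2 * j)
  | .c3 i j => kosCoef q 1 2 (2 * i + 1) (2 * j)
  | .c4 i j => kosCoef q 1 3 (2 * i + 1) (2 * j)

/-- The coordinate of a class of degree `2` dual to an element of the list. -/
noncomputable def dual2 : Index2 → Kos q →ₗ[k] k
  | .c1 i j _ => kosCoef q 3 0 (2 * i + 1) (2 * j + 1)
  | .c2 i j _ => kosCoef q 3 1 (2 * i + 1) (2 * j + 1)
  | .c3 i j _ => kosCoef q 3 2 (2 * i + 1) (2 * j + 1)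
  | .c4 i j _ => kosCoef q 3 3 (2 * i + 1) (2 * j + 1)
  | .e1 => kosCoef q 3 0 0 0
  | .e2 => kosCoef q 3 1 0 0
  | .e3 => kosCoef q 3 2 0 0
  | .e4 => kosCoef q 3 4 0 0
  | .e5 => kosCoef q 3 5 0 0

lemma bas_zero : (onePlus : KP k) = KP.bas 0 := rfl
lemma bas_one : (oneMinus : KP k) = KP.bas 1 := rfl
lemma bas_two : (xPlus : KP k) = KP.bas 2 := rfl
lemma bas_three : (xMinus : KP k) = KP.bas 3 := rfl
lemma bas_four : (zPlus : KP k) = KP.bas 4 := rfl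
lemma bas_five : (xzPlus : KP k) = KP.bas 5 := rfl

/-- Because the indices are ordered, the second monomial of an element matches the leading monomial
of a listed index only when i = j and the two indices agree. -/
lemma dual0_offdiag {i j : Index0} (h : i ≠ j) : dual0 q i (elements0 q j) = 0 := by
  cases i <;> cases j <;>
    simp only [dual0, elements0, sym0, alt0, bas_zero, bas_one, bas_two, bas_three, map_add, map_sub,
      map_smul, kosCoef_elt, coord_one] <;>
    simp <;> grind

/-- When i = j the two monomials of a symmetric element coincide and the coefficient is 2 q^(2i), so
2 ≠ 0 is needed. -/
lemma dual0_diag (i : Index0) : dual0 q i (elements0 q i) ≠ 0 := by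
  have hq : (q : k) ≠ 0 := q.ne_zero
  have h2 : (2 : k) ≠ 0 := two_ne_zero
  rcases i with ⟨i, j, h⟩ | ⟨i, j, h⟩ | ⟨i, j, h⟩ | ⟨i, j, h⟩ <;>
    simp only [dual0, elements0, sym0, alt0, bas_zero, bas_one, bas_two, bas_three, map_add, map_sub,
      map_smul, kosCoef_elt, coord_one] <;>
    rcases Nat.eq_or_lt_of_le h with rfl | h' <;> simp [← two_mul, *] <;> grind [pow_ne_zero (M₀ := k)]

lemma dual1_offdiag {i j : Index1} (h : i ≠ j) : dual1 q i (elements1 q j) = 0 := by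
  cases i <;> cases j <;>
    simp only [dual1, elements1, sym1, alt1, bas_zero, bas_one, bas_two, bas_three, map_add, map_sub,
      map_smul, kosCoef_elt, coord_us, coord_vs] <;>
    simp <;> grind

lemma dual1_diag (i : Index1) : dual1 q i (elements1 q i) ≠ 0 := by
  rcases i with ⟨i, j⟩ | ⟨i, j⟩ | ⟨i, j⟩ | ⟨i, j⟩ <;>
    simp [dual1, elements1, sym1, alt1, bas_zero, bas_one, bas_two, bas_three,
      kosCoef_elt, coord_us, coord_vs]

lemma dual2_offdiag {i j : Index2} (h : i ≠ j) : dual2 q i (elements2 q j) = 0 := by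
  cases i <;> cases j <;>
    simp only [dual2, elements2, sym2, alt2, bas_zero, bas_one, bas_two, bas_three, bas_four,
      bas_five, map_add, map_sub, map_smul, kosCoef_elt, coord_us_vs] <;>
    simp at h ⊢ <;> grind

lemma dual2_diag (i : Index2) : dual2 q i (elements2 q i) ≠ 0 := by
  have hq : (q : k) ≠ 0 := q.ne_zero
  have h2 : (2 : k) ≠ 0 := two_ne_zero
  rcases i with ⟨i, j, h⟩ | ⟨i, j, h⟩ | ⟨i, j, h⟩ | ⟨i, j, h⟩ | _ | _ | _ | _ | _
  all_goals
    simp only [dual2, elements2, sym2, alt2, bas_zero, bas_one, bas_two, bas_three, bas_four,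
      bas_five, map_add, map_sub, map_smul, kosCoef_elt, coord_us_vs]
  all_goals try rcases Nat.eq_or_lt_of_le h with rfl | h'
  all_goals simp [← two_mul, *]
  all_goals grind [pow_ne_zero (M₀ := k)]

lemma dual0_kosB (i : Index0) {β : Kos q} (h : β ∈ kosB q 0) : dual0 q i β = 0 := by
  rw [show β = 0 from h, map_zero]

/-- The coefficient of u w - w u at an even exponent of v is the difference of two equal terms. -/
lemma dual1_kosB (i : Index1) {β : Kos q} (h : β ∈ kosB q 1) : dual1 q i β = 0 := by
  rw [kosB_one] at h
  obtain ⟨_, ⟨b, rfl⟩, rfl⟩ := h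
  have key (g : Fin 8) (hg : g < 4) (i j : ℕ) :
      kosCoef q 1 g (2 * i + 1) (2 * j) (kos1 q (smashD0 q b)) = 0 := by
    rw [kosCoef_apply, kosCoord_one_kos1]
    change coef (compPair q g (smashD0 q b)).1 _ = 0
    rw [compPair_smashD0, d0_apply, twist_of_lt q hg]
    simp
  cases i <;> exact key _ (by decide) _ _

/-- In the untwisted components the anticommutators with u and v cancel where both exponents are
odd. The constant coefficient vanishes in all components, because `d1` raises the degree. -/
lemma dual2_kosB (i : Index2) {β : Kos q} (h : β ∈ kosB q 2) : dual2 q i β = 0 := by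
  rw [kosB_two] at h
  obtain ⟨_, ⟨b, rfl⟩, rfl⟩ := h
  have key (g : Fin 8) (hg : g < 4) (i j : ℕ) :
      kosCoef q 3 g (2 * i + 1) (2 * j + 1) (kos2 q (smashD1 q b)) = 0 := by
    rw [kosCoef_apply, kosCoord_kos2, comp_smashD1, d1_apply, twist_of_lt q hg]
    simp [pow_succ, pow_mul]
  have key' (g : Fin 8) : kosCoef q 3 g 0 0 (kos2 q (smashD1 q b)) = 0 := by
    rw [kosCoef_apply, kosCoord_kos2, comp_smashD1, d1_apply]
    by_cases hg : g < 4
    · rw [twist_of_lt q hg]; simp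
    · rw [twist_of_not_lt q hg]; simp
  cases i
  on_goal 1 => exact key _ (by decide) _ _
  on_goal 1 => exact key _ (by decide) _ _
  on_goal 1 => exact key _ (by decide) _ _
  on_goal 1 => exact key _ (by decide) _ _
  all_goals exact key' _

end Independence

/-! ### A criterion for a basis of a space that embeds in a cohomology space. -/

section Basis

variable {k M N ι : Type*} [Field k] [AddCommGroup M] [Module k M] [AddCommGroup N] [Module k N]
  {Z B : Submodule k N}

/-- A family of elements of `M` mapped by an injective map to the classes of `e` is a basis if the
classes of `e` span the range and are separated by functionals. -/
lemma Cohomology.exists_basis (φ : M →ₗ[k] Cohomology Z B) (hφ : Function.Injective φ) (e : ι → N)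
    (f : ι → N →ₗ[k] k) (hB : ∀ i, ∀ b ∈ B, f i b = 0) (hdiag : ∀ i, f i (e i) ≠ 0)
    (hoff : ∀ i j, i ≠ j → f i (e j) = 0) (hpre : ∀ i, ∃ c, Cohomology.IsClassOf (φ c) (e i))
    (hspan : ∀ c, ∃ w ∈ Submodule.span k (Set.range e), Cohomology.IsClassOf (φ c) w) :
    ∃ b : Module.Basis ι k M, ∀ i, Cohomology.IsClassOf (φ (b i)) (e i) := by
  choose c hc using hpre
  have hli : LinearIndependent k c := by
    let F (i : ι) : Cohomology Z B →ₗ[k] k := (B.submoduleOf Z).liftQ ((f i).domRestrict Z)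
      (fun z hz => hB i z hz)
    have hF (i j : ι) : F i (φ (c j)) = f i (e j) := by
      obtain ⟨hw, h⟩ := hc j
      rw [h]
      exact Submodule.liftQ_apply _ _ _
    refine LinearIndependent.of_pairwise_dual_eq_zero_one c
      (fun i => (f i (e i))⁻¹ • (F i ∘ₗ φ)) (fun i j hij => ?_) (fun i => ?_)
    · simp [hF, hoff i j hij]
    · simp [hF, hdiag i]
  have htop : ⊤ ≤ Submodule.span k (Set.range c) := by
    intro x _
    obtain ⟨w, hw, hw', hx⟩ := hspan x
    have key : ∀ w ∈ Submodule.span k (Set.range e), ∃ y ∈ Submodule.span k (Set.range c),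
        Cohomology.IsClassOf (φ y) w := by
      intro w hw
      induction hw using Submodule.span_induction with
      | mem w hw =>
        obtain ⟨i, rfl⟩ := hw
        exact ⟨c i, Submodule.subset_span ⟨i, rfl⟩, hc i⟩
      | zero => exact ⟨0, zero_mem _, zero_mem _, by rw [map_zero]; rfl⟩
      | add v w _ _ hv hw =>
        obtain ⟨y, hy, h1, h2⟩ := hv
        obtain ⟨z, hz, h3, h4⟩ := hw
        exact ⟨y + z, add_mem hy hz, add_mem h1 h3, by rw [map_add, h2, h4]; rfl⟩
      | smul a w _ hw =>
        obtain ⟨z, hz, h3, h4⟩ := hw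
        exact ⟨a • z, Submodule.smul_mem _ _ hz, Submodule.smul_mem _ _ h3, by
          rw [map_smul, h4]; rfl⟩
    obtain ⟨y, hy, hy', h⟩ := key w hw
    rwa [← hφ (h.trans hx.symm)]
  exact ⟨Module.Basis.mk hli htop, fun i => by rw [Module.Basis.mk_apply]; exact hc i⟩

end Basis

/-! ### Hochschild cochains of degree at most 2 as elements, linear maps and bilinear maps. -/

section LowDegree

variable {k B : Type*} [Field k] [Ring B] [Algebra k B]

lemma vec_one (a : Fin 1 → B) : ![a 0] = a := by funext i; fin_cases i; rfl
lemma vec_two (a : Fin 2 → B) : ![a 0, a 1] = a := by funext i; fin_cases i <;> rfl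
lemma vec_three (a : Fin 3 → B) : ![a 0, a 1, a 2] = a := by funext i; fin_cases i <;> rfl

lemma hochD_zero_apply (f : HochCochain k B 0) (a : B) :
    hochD k B 0 f ![a] = a * f ![] - f ![] * a := by
  have i1 : Fin.init ![a] = ![] := by funext i; exact i.elim0
  simp [hochD, hochLeft, hochRight, i1]
  abel

lemma hochD_one_apply (f : HochCochain k B 1) (a b : B) :
    hochD k B 1 f ![a, b] = a * f ![b] - f ![a * b] + f ![a] * b := by
  have i2 : Fin.init ![a, b] = ![a] := by funext i; fin_cases i; rfl
  have c2 : Fin.contractNth 0 (· * ·) ![a, b] = ![a * b] := by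
    funext i; fin_cases i; rfl
  simp [hochD, hochLeft, hochRight, hochInner, i2, c2]
  abel

lemma hochD_two_apply (f : HochCochain k B 2) (a b c : B) :
    hochD k B 2 f ![a, b, c] = a * f ![b, c] - f ![a * b, c] + f ![a, b * c] - f ![a, b] * c := by
  have i3 : Fin.init ![a, b, c] = ![a, b] := by funext i; fin_cases i <;> rfl
  have c3 : Fin.contractNth 0 (· * ·) ![a, b, c] = ![a * b, c] := by
    funext i; fin_cases i <;> rfl
  have c3' : Fin.contractNth 1 (· * ·) ![a, b, c] = ![a, b * c] := by
    funext i; fin_cases i <;> rfl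
  simp [hochD, hochLeft, hochRight, hochInner, i3, c3, c3', Fin.sum_univ_two,
    show (-1 : k) ^ 3 = -1 by norm_num]
  abel

/-- The linear map underlying a cochain of degree `1`. -/
def HochCochain.lin (f : HochCochain k B 1) : B →ₗ[k] B where
  toFun b := f ![b]
  map_add' a b := by
    simpa [← vec_one (Function.update _ _ _)] using f.map_update_add ![0] 0 a b
  map_smul' c a := by
    simpa [← vec_one (Function.update _ _ _)] using f.map_update_smul ![0] 0 c a

/-- The bilinear map underlying a cochain of degree `2`. -/
def HochCochain.bilin (f : HochCochain k B 2) : B →ₗ[k] B →ₗ[k] B :=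
  LinearMap.mk₂ k (fun a b => f ![a, b])
    (fun a a' b => by
      simpa [← vec_two (Function.update _ _ _)] using f.map_update_add ![0, b] 0 a a')
    (fun c a b => by
      simpa [← vec_two (Function.update _ _ _)] using f.map_update_smul ![0, b] 0 c a)
    (fun a b b' => by
      simpa [← vec_two (Function.update _ _ _)] using f.map_update_add ![a, 0] 1 b b')
    (fun c a b => by
      simpa [← vec_two (Function.update _ _ _)] using f.map_update_smul ![a, 0] 1 c b)

lemma HochCochain.lin_apply (f : HochCochain k B 1) (a : B) : f.lin a = f ![a] := rfl
lemma HochCochain.bilin_apply (f : HochCochain k B 2) (a b : B) : f.bilin a b = f ![a, b] := rfl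

/-- The cochain of degree `0` given by an element. -/
def hochOfElement (b : B) : HochCochain k B 0 := MultilinearMap.constOfIsEmpty k _ b

/-- The cochain of degree `1` given by a linear map. -/
def hochOfLin (d : B →ₗ[k] B) : HochCochain k B 1 :=
  MultilinearMap.mk' (fun a => d (a 0))
    (fun a j x y => by rw [Subsingleton.elim j 0]; simp)
    (fun a j c x => by rw [Subsingleton.elim j 0]; simp)

/-- The cochain of degree `2` given by a bilinear map. -/
def hochOfBilin (F : B →ₗ[k] B →ₗ[k] B) : HochCochain k B 2 :=
  MultilinearMap.mk' (fun a => F (a 0) (a 1))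
    (fun a j x y => by fin_cases j <;> simp)
    (fun a j c x => by fin_cases j <;> simp)

@[simp] lemma hochOfElement_apply (b : B) (a : Fin 0 → B) : hochOfElement (k := k) b a = b := rfl
@[simp] lemma hochOfLin_apply (d : B →ₗ[k] B) (a : B) : hochOfLin d ![a] = d a := rfl
@[simp] lemma hochOfBilin_apply (F : B →ₗ[k] B →ₗ[k] B) (a b : B) :
    hochOfBilin F ![a, b] = F a b := rfl

lemma hoch_ext_one {f g : HochCochain k B 1} (h : ∀ a, f ![a] = g ![a]) : f = g := by
  ext a; rw [← vec_one a]; exact h _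
lemma hoch_ext_two {f g : HochCochain k B 2} (h : ∀ a b, f ![a, b] = g ![a, b]) : f = g := by
  ext a; rw [← vec_two a]; exact h _ _
lemma hoch_ext_three {f g : HochCochain k B 3} (h : ∀ a b c, f ![a, b, c] = g ![a, b, c]) :
    f = g := by
  ext a; rw [← vec_three a]; exact h _ _ _

lemma mem_hochZ_zero {f : HochCochain k B 0} : f ∈ hochZ k B 0 ↔ ∀ a, a * f ![] = f ![] * a := by
  constructor
  · intro h a
    rw [← sub_eq_zero, ← hochD_zero_apply, show hochD k B 0 f = 0 from h]; rfl
  · intro h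
    exact hoch_ext_one fun a => by rw [hochD_zero_apply, h, sub_self]; rfl

lemma mem_hochZ_one {f : HochCochain k B 1} :
    f ∈ hochZ k B 1 ↔ ∀ a b, f.lin (a * b) = a * f.lin b + f.lin a * b := by
  constructor
  · intro h a b
    have e := hochD_one_apply f a b
    rw [show hochD k B 1 f = 0 from h] at e
    simp only [HochCochain.lin_apply]
    rw [eq_comm, ← sub_eq_zero]
    exact (by abel : _ = _).trans e.symm
  · intro h
    refine hoch_ext_two fun a b => ?_
    have e := h a b
    simp only [HochCochain.lin_apply] at e
    rw [hochD_one_apply, e]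
    change _ = (0 : B)
    abel

/-- The Hochschild `2`-cocycle condition for a bilinear map. -/
def IsCocycle (F : B →ₗ[k] B →ₗ[k] B) : Prop :=
  ∀ a b c, a * F b c - F (a * b) c + F a (b * c) - F a b * c = 0

lemma IsCocycle.sub {F G : B →ₗ[k] B →ₗ[k] B} (hF : IsCocycle F) (hG : IsCocycle G) :
    IsCocycle (F - G) := fun a b c => by
  have e := congrArg₂ (· - ·) (hF a b c) (hG a b c)
  simp only [sub_self] at e
  rw [← e]
  simp only [LinearMap.sub_apply, mul_sub, sub_mul]
  abel

/-- The Hochschild coboundary of a linear map. -/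
def bilinD (g : B →ₗ[k] B) : B →ₗ[k] B →ₗ[k] B :=
  (LinearMap.mul k B).compl₂ g - (LinearMap.mul k B).compr₂ g + (LinearMap.mul k B).comp g

lemma bilinD_apply (g : B →ₗ[k] B) (a b : B) : bilinD g a b = a * g b - g (a * b) + g a * b := rfl

lemma bilinD_add (g h : B →ₗ[k] B) : bilinD g + bilinD h = bilinD (g + h) := by
  ext a b
  simp only [bilinD_apply, LinearMap.add_apply, mul_add, add_mul]
  abel

lemma isCocycle_bilinD (g : B →ₗ[k] B) : IsCocycle (bilinD g) := fun a b c => by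
  simp only [bilinD_apply, mul_add, mul_sub, add_mul, sub_mul, mul_assoc]
  abel

lemma mem_hochZ_two {f : HochCochain k B 2} : f ∈ hochZ k B 2 ↔ IsCocycle f.bilin := by
  constructor
  · intro h a b c
    have e := hochD_two_apply f a b c
    rw [show hochD k B 2 f = 0 from h] at e
    exact e.symm
  · intro h
    exact hoch_ext_three fun a b c => (hochD_two_apply f a b c).trans (h a b c)

end LowDegree

/-! ### Averaging Hochschild cochains over a separable subalgebra. -/

section Separable

variable {k H B ι : Type*} [Field k] [Ring H] [Algebra k H] [Ring B] [Algebra k B] [Fintype ι]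

/-- A family `w`, `w'` of elements of `B` such that `∑ wᵢ ⊗ wᵢ'` is a separability idempotent of
the image of `H` in `B`. -/
structure SeparatingFamily (ρ : H →ₐ[k] B) (ι : Type*) [Fintype ι] where
  w : ι → B
  w' : ι → B
  sum_mul : ∑ i, w i * w' i = 1
  comm : ∀ h, ∑ i, (ρ h * w i) ⊗ₜ[k] w' i = ∑ i, w i ⊗ₜ[k] (w' i * ρ h)

namespace SeparatingFamily

variable {ρ : H →ₐ[k] B} (S : SeparatingFamily ρ ι)

/-- The map b ⊗ c ↦ b D(c) applied to the Casimir identity. -/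
lemma comm_right (h : H) (D : B →ₗ[k] B) :
    ∑ i, ρ h * S.w i * D (S.w' i) = ∑ i, S.w i * D (S.w' i * ρ h) := by
  simpa using congrArg (TensorProduct.lift ((LinearMap.mul k B).compl₂ D)) (S.comm h)

lemma comm_left (h : H) (D : B →ₗ[k] B) :
    ∑ i, D (ρ h * S.w i) * S.w' i = ∑ i, D (S.w i) * (S.w' i * ρ h) := by
  simpa using congrArg (TensorProduct.lift ((LinearMap.mul k B).comp D)) (S.comm h)

/-- `∑ wᵢ D(wᵢ')` -/
def lavg (D : B →ₗ[k] B) : B := ∑ i, S.w i * D (S.w' i)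

/-- On the separable subalgebra a derivation is inner: expanding D(wᵢ' h) by the Leibniz rule
produces D(h), with coefficient ∑ wᵢ wᵢ' = 1. -/
lemma commutator_lavg (D : B →ₗ[k] B) (hD : ∀ a b, D (a * b) = a * D b + D a * b) (h : H) :
    ρ h * S.lavg D - S.lavg D * ρ h = D (ρ h) := by
  have e := S.comm_right h D
  simp only [hD _ (ρ h), mul_add, Finset.sum_add_distrib, ← mul_assoc, ← Finset.sum_mul,
    S.sum_mul, one_mul] at e
  rw [lavg, Finset.mul_sum]
  simp only [← mul_assoc]
  rw [e, add_sub_cancel_right]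

/-- `a ↦ ∑ wᵢ F(wᵢ', a)` -/
def lhom (F : B →ₗ[k] B →ₗ[k] B) : B →ₗ[k] B :=
  ∑ i, LinearMap.mulLeft k (S.w i) ∘ₗ F (S.w' i)

lemma lhom_apply (F : B →ₗ[k] B →ₗ[k] B) (a : B) : S.lhom F a = ∑ i, S.w i * F (S.w' i) a := by
  simp [lhom]

/-- `a ↦ ∑ F(a, wᵢ) wᵢ'` -/
def rhom (F : B →ₗ[k] B →ₗ[k] B) : B →ₗ[k] B :=
  ∑ i, LinearMap.mulRight k (S.w' i) ∘ₗ F.flip (S.w i)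

lemma rhom_apply (F : B →ₗ[k] B →ₗ[k] B) (a : B) : S.rhom F a = ∑ i, F a (S.w i) * S.w' i := by
  simp [rhom]

/-- The coboundary of `lhom F` agrees with F when the first argument is in H: the cocycle identity
at (wᵢ', h, a), multiplied by wᵢ and summed, has F(h, a) as one of its terms. -/
lemma lhom_spec {F : B →ₗ[k] B →ₗ[k] B} (hF : IsCocycle F) (h : H) (a : B) :
    ρ h * S.lhom F a - S.lhom F (ρ h * a) + S.lhom F (ρ h) * a = F (ρ h) a := by
  have e := S.comm_right h (F.flip a)
  simp only [LinearMap.flip_apply] at e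
  rw [lhom_apply, lhom_apply, lhom_apply, Finset.mul_sum, Finset.sum_mul]
  simp only [← mul_assoc]
  rw [e, ← Finset.sum_sub_distrib, ← Finset.sum_add_distrib]
  rw [← one_mul (F (ρ h) a), ← S.sum_mul, Finset.sum_mul]
  refine Finset.sum_congr rfl fun i _ => ?_
  have c := congrArg (S.w i * ·) (hF (S.w' i) (ρ h) a)
  simp only [mul_add, mul_sub, mul_zero, ← mul_assoc] at c
  rw [← sub_eq_zero, ← neg_eq_zero, ← c]
  abel

lemma rhom_eq_zero {F : B →ₗ[k] B →ₗ[k] B} (h0 : ∀ h a, F (ρ h) a = 0) (h : H) :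
    S.rhom F (ρ h) = 0 := by
  simp [rhom_apply, h0]

/-- The mirror image of `lhom_spec`, for a cocycle that already vanishes when its first argument is
in H. -/
lemma rhom_spec {F : B →ₗ[k] B →ₗ[k] B} (hF : IsCocycle F) (h0 : ∀ h a, F (ρ h) a = 0)
    (h : H) (a : B) :
    a * S.rhom F (ρ h) - S.rhom F (a * ρ h) + S.rhom F a * ρ h = F a (ρ h) := by
  have e := S.comm_left h (F a)
  rw [S.rhom_eq_zero h0, rhom_apply, rhom_apply, Finset.sum_mul]
  simp only [mul_assoc]
  rw [← e, mul_zero, zero_sub, ← sub_eq_neg_add, ← Finset.sum_sub_distrib]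
  rw [← mul_one (F a (ρ h)), ← S.sum_mul, Finset.mul_sum]
  refine Finset.sum_congr rfl fun i _ => ?_
  have c := congrArg (· * S.w' i) (hF a (ρ h) (S.w i))
  simp only [h0, add_mul, sub_mul, mul_zero, zero_mul, mul_assoc] at c
  rw [← sub_eq_zero, ← c]
  abel

/-- A cocycle is cohomologous to a cocycle relative to `H`. -/
lemma exists_relative (S : SeparatingFamily ρ ι) {F : B →ₗ[k] B →ₗ[k] B} (hF : IsCocycle F) : ∃ g : B →ₗ[k] B,
    ∀ h a, F (ρ h) a = ρ h * g a - g (ρ h * a) + g (ρ h) * a ∧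
      F a (ρ h) = a * g (ρ h) - g (a * ρ h) + g a * ρ h := by
  -- First F is normalised to vanish for a first argument in H, then for a second argument in H.
  let G : B →ₗ[k] B →ₗ[k] B := F - bilinD (S.lhom F)
  have hG : IsCocycle G := hF.sub (isCocycle_bilinD _)
  have h0 (h : H) (a : B) : G (ρ h) a = 0 := by
    rw [LinearMap.sub_apply, LinearMap.sub_apply, bilinD_apply, S.lhom_spec hF, sub_self]
  refine ⟨S.lhom F + S.rhom G, fun h a => ⟨?_, ?_⟩⟩
  -- The second correction is left H-linear and vanishes on H, so its coboundary does not spoil the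
  -- first normalisation.
  · have e : S.rhom G (ρ h * a) = ρ h * S.rhom G a := by
      rw [rhom_apply, rhom_apply, Finset.mul_sum]
      refine Finset.sum_congr rfl fun i _ => ?_
      rw [← mul_assoc]
      congr 1
      have c := hG (ρ h) a (S.w i)
      rw [h0, h0, zero_mul, sub_zero, add_zero, sub_eq_zero] at c
      exact c.symm
    have c := S.lhom_spec hF h a
    rw [← c]
    simp only [LinearMap.add_apply, mul_add, add_mul, e, S.rhom_eq_zero h0, zero_mul]
    abel
  · have c := S.rhom_spec hG h0 h a
    have c' : G a (ρ h) = F a (ρ h) - bilinD (S.lhom F) a (ρ h) := rfl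
    rw [bilinD_apply] at c'
    rw [eq_add_of_sub_eq c'.symm, ← c]
    simp only [LinearMap.add_apply, mul_add, add_mul]
    abel

end SeparatingFamily
end Separable

/-! ### The separability idempotent of `H`. -/

namespace KP
variable {k : Type*} [Field k] [NeZero (2 : k)]

/-- The elements `x^a y^b`. -/
noncomputable def grp : Fin 4 → KP k := ![1, gen .x, gen .y, gen .x * gen .y]

/-- The inverse of `z`. -/
noncomputable def zInv : KP k := gen .z * gen .z * gen .z

/-- The eight elements g and z g, with g among 1, x, y, xy, play the part of group elements:
`sepRight` consists of their inverses divided by 8. -/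
noncomputable def sepLeft : Fin 2 × Fin 4 → KP k
  | (0, i) => grp i
  | (1, i) => gen .z * grp i

noncomputable def sepRight : Fin 2 × Fin 4 → KP k
  | (0, i) => (2⁻¹ * 2⁻¹ * 2⁻¹ : k) • grp i
  | (1, i) => (2⁻¹ * 2⁻¹ * 2⁻¹ : k) • (grp i * zInv)

lemma zz_sq : (gen .z * (gen .z * (gen .z * gen .z)) : KP k) = 1 := by
  have h2 : (2 : k) ≠ 0 := two_ne_zero
  simp [mul_add, mul_sub, add_mul, sub_mul, mul_assoc, xx, yy, zz, yx, zx, zy, xx', yy', yx', zx',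
    zy', zz']
  match_scalars <;> field_simp <;> norm_num

lemma z_mul_zInv : (gen .z * zInv : KP k) = 1 := by
  rw [zInv, mul_assoc, zz_sq]
lemma zInv_mul_z : (zInv * gen .z : KP k) = 1 := by
  rw [zInv, mul_assoc, mul_assoc, zz_sq]

lemma zInv_mul_y : (zInv * gen .y : KP k) = gen .x * zInv := by
  simp only [zInv, mul_assoc, zy, zx, zx', zy']
lemma zInv_mul_x : (zInv * gen .x : KP k) = gen .y * zInv := by
  simp only [zInv, mul_assoc, zy, zx, zx', zy']

lemma grp_mul_self (i : Fin 4) : (grp i * grp i : KP k) = 1 := by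
  fin_cases i <;> simp [grp, mul_assoc, xx, yy, yx, xx', yy', yx']

lemma sum_sep : ∑ i, sepLeft i * sepRight i = (1 : KP k) := by
  have h2 : (2 : k) ≠ 0 := two_ne_zero
  have e (i : Fin 4) : (gen .z * grp i * (grp i * zInv) : KP k) = 1 := by
    rw [mul_assoc, ← mul_assoc (grp i), grp_mul_self, one_mul, z_mul_zInv]
  rw [Fintype.sum_prod_type, Fin.sum_univ_two]
  simp only [sepLeft, sepRight, mul_smul_comm, grp_mul_self, e, Finset.sum_const, Finset.card_univ,
    Fintype.card_fin, ← Nat.cast_smul_eq_nsmul k, ← add_smul, smul_smul]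
  convert one_smul k (1 : KP k)
  push_cast
  field_simp
  norm_num

lemma sum_grp_tmul_x : ∑ i, (gen .x * grp i : KP k) ⊗ₜ[k] (grp i : KP k) =
    ∑ i, (grp i : KP k) ⊗ₜ[k] (grp i * gen .x : KP k) := by
  simp [grp, Fin.sum_univ_four, mul_assoc, xx, yy, yx, xx', yy', yx']
  abel

lemma sum_grp_tmul_y : ∑ i, (gen .y * grp i : KP k) ⊗ₜ[k] (grp i : KP k) =
    ∑ i, (grp i : KP k) ⊗ₜ[k] (grp i * gen .y : KP k) := by
  simp [grp, Fin.sum_univ_four, mul_assoc, xx, yy, yx, xx', yy', yx']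
  abel

/-- The elements `h` such that `∑ h wᵢ ⊗ wᵢ' = ∑ wᵢ ⊗ wᵢ' h`. -/
def casimirSubalgebra {ι A : Type*} [Fintype ι] [Ring A] [Algebra k A] (w w' : ι → A) :
    Subalgebra k A where
  carrier := {h | ∑ i, (h * w i) ⊗ₜ[k] w' i = ∑ i, w i ⊗ₜ[k] (w' i * h)}
  mul_mem' {a b} ha hb := by
    have e := congrArg (LinearMap.rTensor A (LinearMap.mulLeft k a)) hb
    have e' := congrArg (LinearMap.lTensor A (LinearMap.mulRight k b)) ha
    simp only [map_sum, LinearMap.rTensor_tmul, LinearMap.lTensor_tmul, LinearMap.mulLeft_apply,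
      LinearMap.mulRight_apply] at e e'
    simp only [Set.mem_ofPred_eq, mul_assoc] at e e' ⊢
    rw [e, e']
  add_mem' {a b} ha hb := by
    simp only [Set.mem_ofPred_eq, add_mul, mul_add, TensorProduct.add_tmul, TensorProduct.tmul_add,
      Finset.sum_add_distrib] at *
    rw [ha, hb]
  algebraMap_mem' r := by
    simp [Algebra.algebraMap_eq_smul_one, TensorProduct.smul_tmul']

lemma mem_casimirSubalgebra {ι A : Type*} [Fintype ι] [Ring A] [Algebra k A] {w w' : ι → A} {h : A} :
    h ∈ casimirSubalgebra (k := k) w w' ↔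
      ∑ i, (h * w i) ⊗ₜ[k] w' i = ∑ i, w i ⊗ₜ[k] (w' i * h) := Iff.rfl

lemma eq_top_of_gen_mem (S : Subalgebra k (KP k)) (hx : gen .x ∈ S) (hy : gen .y ∈ S)
    (hz : gen .z ∈ S) : S = ⊤ := by
  refine eq_top_iff.2 fun h _ => ?_
  induction h using induction with
  | hc c => exact S.algebraMap_mem c
  | hx => exact hx
  | hy => exact hy
  | hz => exact hz
  | hadd a b ha hb => exact add_mem (ha trivial) (hb trivial)
  | hmul a b ha hb => exact mul_mem (ha trivial) (hb trivial)

/-- The elements that satisfy the identity form a subalgebra, so generators suffice. The generators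
x and y preserve the two halves of the sum, being exchanged on passing z; z interchanges the halves.
-/
lemma casimir (h : KP k) : h ∈ casimirSubalgebra (k := k) (sepLeft (k := k)) sepRight := by
  have hsum (f : Fin 2 × Fin 4 → KP k ⊗[k] KP k) :
      ∑ i, f i = ∑ i, f (0, i) + ∑ i, f (1, i) := by
    rw [Fintype.sum_prod_type, Fin.sum_univ_two]
  have hG (g : KP k) (hg : ∑ i, (g * grp i) ⊗ₜ[k] (grp i : KP k) =
      ∑ i, (grp i : KP k) ⊗ₜ[k] (grp i * g : KP k)) (a b : KP k) (s : k) :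
      ∑ i, (a * (g * grp i)) ⊗ₜ[k] (s • (grp i * b) : KP k) =
      ∑ i, (a * grp i) ⊗ₜ[k] (s • (grp i * (g * b)) : KP k) := by
    have e := congrArg (TensorProduct.map (LinearMap.mulLeft k a) (s • LinearMap.mulRight k b)) hg
    simpa [mul_assoc] using e
  have hx := hG _ sum_grp_tmul_x
  have hy := hG _ sum_grp_tmul_y
  rw [eq_top_of_gen_mem (casimirSubalgebra sepLeft sepRight) ?_ ?_ ?_]
  · exact Algebra.mem_top
  · rw [mem_casimirSubalgebra, hsum, hsum]
    have e1 := hx 1 1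
    have e2 := hy (gen .z) zInv
    simp only [one_mul, mul_one] at e1
    simp only [sepLeft, sepRight, smul_mul_assoc, ← mul_assoc, ← zy] at *
    simp only [mul_assoc, zInv_mul_x] at *
    rw [e1, e2]
  · rw [mem_casimirSubalgebra, hsum, hsum]
    have e1 := hy 1 1
    have e2 := hx (gen .z) zInv
    simp only [one_mul, mul_one] at e1
    simp only [sepLeft, sepRight, smul_mul_assoc, ← mul_assoc, ← zx] at *
    simp only [mul_assoc, zInv_mul_y] at *
    rw [e1, e2]
  · rw [mem_casimirSubalgebra, hsum, hsum]
    -- Multiplying the second half by z produces z², which lies in the span of 1, x, y, xy and hence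
    -- can be moved across ∑ g ⊗ g.
    have hz : gen .z * gen .z ∈ casimirSubalgebra (k := k) grp (grp (k := k)) := by
      have hx := mem_casimirSubalgebra.2 (sum_grp_tmul_x (k := k))
      have hy := mem_casimirSubalgebra.2 (sum_grp_tmul_y (k := k))
      rw [zz]
      exact Subalgebra.smul_mem _ (sub_mem (add_mem (add_mem (one_mem _) hx) hy) (mul_mem hx hy)) _
    have e := hG _ (mem_casimirSubalgebra.1 hz) 1 zInv (2⁻¹ * 2⁻¹ * 2⁻¹)
    simp only [one_mul, mul_assoc, z_mul_zInv, mul_one] at e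
    simp only [sepLeft, sepRight, smul_mul_assoc, mul_assoc, zInv_mul_z, mul_one, e]
    rw [add_comm]
end KP

/-! ### Cocycles with trivial restriction to the Koszul complex are coboundaries. -/

namespace KPSmash

open SmashProduct QPlane

variable {k : Type*} [Field k] [NeZero (2 : k)] (q : kˣ)

/-- The separability idempotent of `H` in `A # H`. -/
noncomputable def sep : SeparatingFamily (inHHom q) (Fin 2 × Fin 4) where
  w i := inHHom q (KP.sepLeft i)
  w' i := inHHom q (KP.sepRight i)
  sum_mul := by simp only [← map_mul, ← map_sum, KP.sum_sep, map_one]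
  comm h := by
    simpa using congrArg (TensorProduct.map (inHHom q).toLinearMap (inHHom q).toLinearMap)
      (KP.mem_casimirSubalgebra.1 (KP.casimir h))

lemma inH_x_mul_inA (a : QPlane k) :
    inHHom q (KP.gen .x) * inAHom q a = inAHom q a * inHHom q (KP.gen .x) := x_mul_inA q a
lemma inH_y_mul_inA (a : QPlane k) :
    inHHom q (KP.gen .y) * inAHom q a = inAHom q a * inHHom q (KP.gen .y) := y_mul_inA q a
lemma inH_z_mul_inA (a : QPlane k) : inHHom q (KP.gen .z) * inAHom q a =
    inAHom q (QPlane.swap q a) * inHHom q (KP.gen .z) := z_mul_inA q a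

lemma grp_mul_inA (i : Fin 4) (a : QPlane k) :
    inHHom q (KP.grp i) * inAHom q a = inAHom q a * inHHom q (KP.grp i) := by
  fin_cases i
  · simp [KP.grp]
  · exact inH_x_mul_inA q a
  · exact inH_y_mul_inA q a
  · change inHHom q (KP.gen .x * KP.gen .y) * _ = _ * inHHom q (KP.gen .x * KP.gen .y)
    rw [map_mul, mul_assoc, inH_y_mul_inA, ← mul_assoc, inH_x_mul_inA, mul_assoc]

lemma zInv_mul_inA (a : QPlane k) :
    inHHom q KP.zInv * inAHom q a = inAHom q (QPlane.swap q a) * inHHom q KP.zInv := by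
  simp only [KP.zInv, map_mul, mul_assoc, inH_z_mul_inA]
  simp only [← mul_assoc, inH_z_mul_inA, QPlane.swap_swap]

/-- The same b serves on both sides, because `swap` is an involution. So elements of A pass through
the idempotent, and averages of left A-linear maps satisfy `inA_mul_lavg`. -/
lemma sep_mul_inA (i : Fin 2 × Fin 4) (a : QPlane k) : ∃ b : QPlane k,
    (sep q).w' i * inAHom q a = inAHom q b * (sep q).w' i ∧
      inAHom q a * (sep q).w i = (sep q).w i * inAHom q b := by
  rcases i with ⟨c, i⟩
  fin_cases c
  · refine ⟨a, ?_, (grp_mul_inA q i a).symm⟩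
    change inHHom q (_ • KP.grp i) * _ = _ * inHHom q (_ • KP.grp i)
    rw [map_smul, smul_mul_assoc, mul_smul_comm, grp_mul_inA]
  · refine ⟨QPlane.swap q a, ?_, ?_⟩
    · change inHHom q (_ • (KP.grp i * KP.zInv)) * _ = _ * inHHom q (_ • (KP.grp i * KP.zInv))
      rw [map_smul, smul_mul_assoc, mul_smul_comm, map_mul, mul_assoc (inHHom q (KP.grp i)),
        zInv_mul_inA, ← mul_assoc (inHHom q (KP.grp i)), grp_mul_inA, mul_assoc (inAHom q _)]
    · change _ * inHHom q (KP.gen .z * KP.grp i) = inHHom q (KP.gen .z * KP.grp i) * _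
      rw [map_mul, mul_assoc, grp_mul_inA, ← mul_assoc, ← mul_assoc, inH_z_mul_inA,
        QPlane.swap_swap]

lemma inA_mul_lavg (D : KPSmash q →ₗ[k] KPSmash q)
    (hD : ∀ a X, D (inAHom q a * X) = inAHom q a * D X) (a : QPlane k) :
    inAHom q a * (sep q).lavg D = ∑ i, (sep q).w i * D ((sep q).w' i * inAHom q a) := by
  rw [SeparatingFamily.lavg, Finset.mul_sum]
  refine Finset.sum_congr rfl fun i _ => ?_
  obtain ⟨b, h1, h2⟩ := sep_mul_inA q i a
  rw [h1, hD, ← mul_assoc, h2, mul_assoc]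

/-- A derivation that vanishes on `A` is inner. -/
lemma eq_commutator_of_vanish {D : KPSmash q →ₗ[k] KPSmash q}
    (hD : ∀ a b, D (a * b) = a * D b + D a * b) (h0 : ∀ a, D (inAHom q a) = 0) (X : KPSmash q) :
    D X = X * (sep q).lavg D - (sep q).lavg D * X := by
  -- A derivation that vanishes on A is A-bilinear, so its average commutes with A; on H it is the
  -- commutator by `commutator_lavg`.
  have hA (a : QPlane k) : inAHom q a * (sep q).lavg D = (sep q).lavg D * inAHom q a := by
    rw [inA_mul_lavg q D (fun a X => by rw [hD, h0, zero_mul, add_zero])]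
    simp only [hD _ (inAHom q a), h0, mul_zero, zero_add, ← mul_assoc]
    rw [← Finset.sum_mul]; rfl
  induction X using smash_induction with
  | h0 => simp
  | hadd X Y hX hY => rw [map_add, hX, hY, add_mul, mul_add]; abel
  | hmul a h =>
    rw [hD, h0, zero_mul, add_zero, ← (sep q).commutator_lavg D hD h, mul_sub,
      ← mul_assoc, ← mul_assoc, hA, mul_assoc ((sep q).lavg D)]

lemma lhom_eq_lavg (F : KPSmash q →ₗ[k] KPSmash q →ₗ[k] KPSmash q) (c : KPSmash q) :
    (sep q).lhom F c = (sep q).lavg (F.flip c) := (sep q).lhom_apply F c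

/-- A `2`-cocycle vanishing on `A × (A # H)` is a coboundary. -/
lemma eq_bilinD_of_vanish {F : KPSmash q →ₗ[k] KPSmash q →ₗ[k] KPSmash q} (hF : IsCocycle F)
    (h0 : ∀ a X, F (inAHom q a) X = 0) : F = bilinD ((sep q).lhom F) := by
  have hl (a : QPlane k) (X Y : KPSmash q) : F (inAHom q a * X) Y = inAHom q a * F X Y := by
    have c := hF (inAHom q a) X Y
    rw [h0, h0, zero_mul, sub_zero, add_zero, sub_eq_zero] at c
    exact c.symm
  -- The coboundary of `lhom F` also vanishes for a first argument in A. Both cocycles are then left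
  -- A-linear in the first argument, and they agree on H by `lhom_spec`.
  have hA (a : QPlane k) (c : KPSmash q) : bilinD ((sep q).lhom F) (inAHom q a) c = 0 := by
    rw [bilinD_apply, lhom_eq_lavg, inA_mul_lavg q _ (fun a X => hl a X c), (sep q).lhom_apply,
      (sep q).lhom_apply, Finset.sum_mul, ← Finset.sum_sub_distrib, ← Finset.sum_add_distrib]
    refine Finset.sum_eq_zero fun i _ => ?_
    have e := congrArg ((sep q).w i * ·) (hF ((sep q).w' i) (inAHom q a) c)
    simp only [h0, mul_zero, zero_sub, mul_add, mul_sub, mul_neg, ← mul_assoc] at e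
    rw [LinearMap.flip_apply, ← neg_eq_zero, ← e]
    abel
  have hl' (a : QPlane k) (X Y : KPSmash q) : bilinD ((sep q).lhom F) (inAHom q a * X) Y =
      inAHom q a * bilinD ((sep q).lhom F) X Y := by
    have c := isCocycle_bilinD ((sep q).lhom F) (inAHom q a) X Y
    rw [hA, hA, zero_mul, sub_zero, add_zero, sub_eq_zero] at c
    exact c.symm
  ext X Y
  induction X using smash_induction with
  | h0 => simp
  | hadd X Z hX hZ => rw [map_add, map_add, LinearMap.add_apply, LinearMap.add_apply, hX, hZ]
  | hmul a h => rw [hl, hl', bilinD_apply, (sep q).lhom_spec hF]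

/-- The linear map on `A # H` given by a bilinear map on `A × H`. -/
noncomputable def extend (β : QPlane k →ₗ[k] KP k →ₗ[k] KPSmash q) : KPSmash q →ₗ[k] KPSmash q :=
  TensorProduct.lift β

lemma extend_apply (β : QPlane k →ₗ[k] KP k →ₗ[k] KPSmash q) (a : QPlane k) (h : KP k) :
    extend q β (inAHom q a * inHHom q h) = β a h := by
  rw [← tmul_eq]; exact TensorProduct.lift.tmul _ _

lemma apply_one {F : KPSmash q →ₗ[k] KPSmash q →ₗ[k] KPSmash q} (hF : IsCocycle F)
    (a : KPSmash q) : F a 1 = a * F 1 1 := by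
  have c := hF a 1 1
  simp only [mul_one] at c
  rw [eq_comm, ← sub_eq_zero, ← c]; abel

/-- The operator `(b, n) ↦ (a b, a n + m b - F(a, b))`. -/
noncomputable def extOp (F : KPSmash q →ₗ[k] KPSmash q →ₗ[k] KPSmash q) (a m : KPSmash q) :
    Module.End k (KPSmash q × KPSmash q) :=
  (LinearMap.mulLeft k a ∘ₗ LinearMap.fst k _ _).prod
    (LinearMap.mulLeft k a ∘ₗ LinearMap.snd k _ _ +
      (LinearMap.mulLeft k m - F a) ∘ₗ LinearMap.fst k _ _)

lemma extOp_apply (F : KPSmash q →ₗ[k] KPSmash q →ₗ[k] KPSmash q) (a m b n : KPSmash q) :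
    extOp q F a m (b, n) = (a * b, a * n + (m * b - F a b)) := rfl

/-- The cocycle identity makes these operators closed under composition. The second parameter
composes as the value at a product of a map with coboundary F, so a homomorphism into such operators
encodes a trivialisation of F. -/
lemma extOp_mul {F : KPSmash q →ₗ[k] KPSmash q →ₗ[k] KPSmash q} (hF : IsCocycle F)
    (a a' m m' : KPSmash q) :
    extOp q F a m * extOp q F a' m' = extOp q F (a * a') (a * m' + m * a' - F a a') := by
  refine LinearMap.ext fun ⟨b, n⟩ => ?_
  rw [Module.End.mul_apply, extOp_apply, extOp_apply, extOp_apply, mul_assoc]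
  congr 1
  rw [← sub_eq_zero, ← neg_eq_zero, ← hF a a' b]
  simp only [mul_add, mul_sub, add_mul, sub_mul, mul_assoc]
  abel

lemma extOp_add (F : KPSmash q →ₗ[k] KPSmash q →ₗ[k] KPSmash q) (a a' m m' : KPSmash q) :
    extOp q F a m + extOp q F a' m' = extOp q F (a + a') (m + m') := by
  refine LinearMap.ext fun ⟨b, n⟩ => ?_
  rw [LinearMap.add_apply, extOp_apply, extOp_apply, extOp_apply, Prod.mk_add_mk]
  simp only [map_add, LinearMap.add_apply, add_mul]
  congr 1
  abel

/-- A `2`-cocycle whose restriction to the Koszul complex is the coboundary of `(m, n)` is the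
coboundary of a map with values `m`, `n` at `u`, `v` on `A × A`. -/
lemma exists_eq_on_inA {F : KPSmash q →ₗ[k] KPSmash q →ₗ[k] KPSmash q} (hF : IsCocycle F)
    (m n : KPSmash q) (h : F (inAHom q u) (inAHom q v) + F (inAHom q v) (inAHom q u) =
      smashD1 q (m, n)) :
    ∃ g : QPlane k →ₗ[k] KPSmash q, ∀ a b, F (inAHom q a) (inAHom q b) =
      inAHom q a * g b - g (a * b) + g a * inAHom q b := by
  -- The relation u v + v u = 0 holds for the chosen operators exactly because of the hypothesis on
  -- (m, n).
  let Ψ : QPlane k →ₐ[k] Module.End k (KPSmash q × KPSmash q) :=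
    QPlane.lift (extOp q F (inAHom q u) m) (extOp q F (inAHom q v) n) (by
      rw [extOp_mul q hF, extOp_mul q hF, extOp_add, ← map_mul, ← map_mul, ← map_add, uv_add_vu,
        map_zero]
      have e : inAHom q u * n + m * inAHom q v - F (inAHom q u) (inAHom q v) +
          (inAHom q v * m + n * inAHom q u - F (inAHom q v) (inAHom q u)) = 0 := by
        rw [smashD1_apply] at h
        rw [← sub_eq_zero] at h
        rw [← neg_eq_zero, ← h]
        abel
      rw [e]
      refine LinearMap.ext fun ⟨b, n⟩ => ?_
      rw [extOp_apply]; simp)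
  have h1 (b : KPSmash q) : F 1 b = F 1 1 * b := by
    have c := hF 1 1 b
    simp only [one_mul] at c
    rw [← sub_eq_zero, ← c]; abel
  have hΨ (a : QPlane k) : ∃ m, Ψ a = extOp q F (inAHom q a) m := by
    induction a using QPlane.induction with
    | hc c =>
      refine ⟨c • F 1 1, LinearMap.ext fun ⟨b, n⟩ => ?_⟩
      rw [AlgHom.commutes, AlgHom.commutes, extOp_apply, Algebra.algebraMap_eq_smul_one,
        Algebra.algebraMap_eq_smul_one, map_smul, LinearMap.smul_apply, LinearMap.smul_apply, h1 b]
      simp [h1 b]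
    | hu => exact ⟨m, QPlane.lift_u _ _ _⟩
    | hv => exact ⟨n, QPlane.lift_v _ _ _⟩
    | hadd a b ha hb =>
      obtain ⟨x, hx⟩ := ha
      obtain ⟨y, hy⟩ := hb
      exact ⟨x + y, by rw [map_add, hx, hy, extOp_add, map_add]⟩
    | hmul a b ha hb =>
      obtain ⟨x, hx⟩ := ha
      obtain ⟨y, hy⟩ := hb
      exact ⟨_, by rw [map_mul, hx, hy, extOp_mul q hF, map_mul]⟩
  -- The parameter m of `extOp q F a m` is recovered from its value at (1, 0), whose second entry is
  -- m - F(a, 1).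
  let g : QPlane k →ₗ[k] KPSmash q := LinearMap.snd k _ _ ∘ₗ
    LinearMap.applyₗ ((1 : KPSmash q), (0 : KPSmash q)) ∘ₗ Ψ.toLinearMap +
    F.flip 1 ∘ₗ (inAHom q).toLinearMap
  have hg (a : QPlane k) : Ψ a = extOp q F (inAHom q a) (g a) := by
    obtain ⟨m, hm⟩ := hΨ a
    have : g a = m := by
      change (Ψ a (1, 0)).2 + F (inAHom q a) 1 = m
      rw [hm, extOp_apply]
      simp
    rw [hm, this]
  refine ⟨g, fun a b => ?_⟩
  have e := congrArg Prod.snd (LinearMap.congr_fun (map_mul Ψ a b) (1, 0))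
  rw [hg, hg, hg, extOp_mul q hF, extOp_apply, extOp_apply, map_mul] at e
  simp only [mul_zero, zero_add, mul_one] at e
  have e' := sub_left_injective e
  rw [e']
  abel

/-- A `2`-cocycle whose restriction to the Koszul complex is a coboundary is a coboundary. -/
lemma exists_eq_bilinD {F : KPSmash q →ₗ[k] KPSmash q →ₗ[k] KPSmash q} (hF : IsCocycle F)
    (m n : KPSmash q) (h : F (inAHom q u) (inAHom q v) + F (inAHom q v) (inAHom q u) =
      smashD1 q (m, n)) : ∃ G, F = bilinD G := by
  obtain ⟨g, hg⟩ := exists_eq_on_inA q hF m n h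
  -- G extends g, and the terms at h are chosen so that the coboundary of G agrees with F on A × A
  -- h. The difference then vanishes on A × (A # H).
  let G : KPSmash q →ₗ[k] KPSmash q := extend q
    (((LinearMap.mul k (KPSmash q)).compl₂ (inHHom q).toLinearMap) ∘ₗ
        (g + F.flip 1 ∘ₗ (inAHom q).toLinearMap) -
      (F.compl₂ (inHHom q).toLinearMap) ∘ₗ (inAHom q).toLinearMap)
  have hG (a : QPlane k) (h : KP k) : G (inAHom q a * inHHom q h) =
      (g a + F (inAHom q a) 1) * inHHom q h - F (inAHom q a) (inHHom q h) := extend_apply q _ a h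
  have hE := eq_bilinD_of_vanish q (hF.sub (isCocycle_bilinD G)) (fun a X => by
    induction X using smash_induction with
    | h0 => simp
    | hadd X Y hX hY => rw [map_add, hX, hY, add_zero]
    | hmul b h =>
      have h1 : G (inAHom q a) = g a := by simpa using hG a 1
      rw [LinearMap.sub_apply, LinearMap.sub_apply, bilinD_apply, h1, ← mul_assoc, ← map_mul, hG,
        hG, apply_one q hF (inAHom q b), apply_one q hF (inAHom q (a * b))]
      have c := congrArg (· * inHHom q h) (hg a b)
      have c' := hF (inAHom q a) (inAHom q b) (inHHom q h)
      simp only [add_mul, sub_mul, mul_add, mul_sub, map_mul, mul_assoc] at c c' ⊢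
      linear_combination (norm := abel) c' + c)
  exact ⟨_, (sub_eq_iff_eq_add.1 hE).trans (by rw [bilinD_add])⟩

end KPSmash

/-! ### Injectivity of induced maps on cohomology. -/

section Cohomology

variable {k M N : Type*} [Field k] [AddCommGroup M] [Module k M] [AddCommGroup N] [Module k N]
  {Z B : Submodule k M} {Z' B' : Submodule k N}

lemma Cohomology.map_mk (f : M →ₗ[k] N) (hZ : ∀ z ∈ Z, f z ∈ Z') (hB : ∀ z ∈ B, f z ∈ B') (z : Z) :
    Cohomology.map f hZ hB (Submodule.Quotient.mk z) = Submodule.Quotient.mk ⟨f z, hZ z z.2⟩ := rfl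

lemma Cohomology.map_injective (f : M →ₗ[k] N) (hZ : ∀ z ∈ Z, f z ∈ Z') (hB : ∀ z ∈ B, f z ∈ B')
    (h : ∀ z ∈ Z, f z ∈ B' → z ∈ B) : Function.Injective (Cohomology.map f hZ hB) := by
  rw [injective_iff_map_eq_zero]
  intro c hc
  obtain ⟨z, rfl⟩ := Submodule.Quotient.mk_surjective _ c
  rw [Cohomology.map_mk, Submodule.Quotient.mk_eq_zero] at hc
  rw [Submodule.Quotient.mk_eq_zero]
  exact h z z.2 hc

end Cohomology

/-! ### Injectivity of the restriction, and invariance of its image. -/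

section Restriction

open SmashProduct QPlane KPSmash

variable {k : Type*} [Field k] [NeZero (2 : k)] (q : kˣ)

lemma restrictCochain_zero (f : HochCochain k (KPSmash q) 0) :
    restrictCochain q 0 f = kos0 q (f ![]) := rfl
lemma restrictCochain_one (f : HochCochain k (KPSmash q) 1) :
    restrictCochain q 1 f = kos1 q (f ![inAHom q u], f ![inAHom q v]) := rfl
lemma restrictCochain_two (f : HochCochain k (KPSmash q) 2) : restrictCochain q 2 f =
    kos2 q (f ![inAHom q u, inAHom q v] + f ![inAHom q v, inAHom q u]) := rfl

lemma restrictCochain_mem_kosZ {n : ℕ} {f : HochCochain k (KPSmash q) n}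
    (hf : f ∈ hochZ k (KPSmash q) n) : restrictCochain q n f ∈ kosZ q n :=
  ⟨restrictCochain_mem q n f, by
    rw [SetLike.mem_coe, LinearMap.mem_ker, kosD_restrictCochain,
      show hochD k (KPSmash q) n f = 0 from hf, map_zero]⟩

lemma restrictHH_mk {n : ℕ} {f : HochCochain k (KPSmash q) n} (hf : f ∈ hochZ k (KPSmash q) n) :
    restrictHH q n (Submodule.Quotient.mk ⟨f, hf⟩) =
      Submodule.Quotient.mk ⟨restrictCochain q n f, restrictCochain_mem_kosZ q hf⟩ := rfl

lemma derivation_eq_zero {D : KPSmash q →ₗ[k] KPSmash q}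
    (hD : ∀ a b, D (a * b) = a * D b + D a * b) (hu : D (inAHom q u) = 0) (hv : D (inAHom q v) = 0)
    (a : QPlane k) : D (inAHom q a) = 0 := by
  have h1 : D 1 = 0 := by simpa using hD 1 1
  induction a using QPlane.induction with
  | hc c => rw [AlgHom.commutes, Algebra.algebraMap_eq_smul_one, map_smul, h1, smul_zero]
  | hu => exact hu
  | hv => exact hv
  | hadd a b ha hb => rw [map_add, map_add, ha, hb, add_zero]
  | hmul a b ha hb => rw [map_mul, hD, ha, hb, mul_zero, zero_mul, add_zero]

lemma mem_hochB_zero {f : HochCochain k (KPSmash q) 0} (h : restrictCochain q 0 f ∈ kosB q 0) :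
    f ∈ hochB k (KPSmash q) 0 := by
  rw [restrictCochain_zero, kos0_mem_kosB] at h
  change f = 0
  ext a
  rw [Subsingleton.elim a ![], h]; rfl

lemma mem_hochB_one {f : HochCochain k (KPSmash q) 1} (hf : f ∈ hochZ k (KPSmash q) 1)
    (h : restrictCochain q 1 f ∈ kosB q 1) : f ∈ hochB k (KPSmash q) 1 := by
  rw [restrictCochain_one, kos1_mem_kosB] at h
  obtain ⟨b, hb⟩ := h
  rw [smashD0_apply, Prod.mk.injEq] at hb
  rw [mem_hochZ_one] at hf
  -- Subtracting the inner derivation with the same values at u and v leaves a derivation that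
  -- vanishes on A.
  let D : KPSmash q →ₗ[k] KPSmash q := f.lin - (LinearMap.mulRight k b - LinearMap.mulLeft k b)
  have hD (a c : KPSmash q) : D (a * c) = a * D c + D a * c := by
    simp only [D, LinearMap.sub_apply, hf, LinearMap.mulRight_apply, LinearMap.mulLeft_apply,
      mul_sub, sub_mul, mul_assoc]
    abel
  have h0 := derivation_eq_zero q hD (sub_eq_zero.2 hb.1.symm) (sub_eq_zero.2 hb.2.symm)
  have key := eq_commutator_of_vanish q hD h0
  refine ⟨hochOfElement (b + (sep q).lavg D), hoch_ext_one fun a => ?_⟩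
  rw [hochD_zero_apply, hochOfElement_apply]
  have e : f ![a] - (a * b - b * a) = _ := key a
  rw [sub_eq_iff_eq_add.1 e, mul_add, add_mul]
  abel

lemma mem_hochB_two {f : HochCochain k (KPSmash q) 2} (hf : f ∈ hochZ k (KPSmash q) 2)
    (h : restrictCochain q 2 f ∈ kosB q 2) : f ∈ hochB k (KPSmash q) 2 := by
  rw [restrictCochain_two, kos2_mem_kosB] at h
  obtain ⟨b, hb⟩ := h
  obtain ⟨G, hG⟩ := exists_eq_bilinD q (mem_hochZ_two.1 hf) b.1 b.2 hb.symm
  refine ⟨hochOfLin G, hoch_ext_two fun a c => ?_⟩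
  rw [hochD_one_apply, ← HochCochain.bilin_apply f, hG]; rfl

lemma restrictHH_injective {n : ℕ} (hn : n ≤ 2) : Function.Injective (restrictHH q n) := by
  refine Cohomology.map_injective _ _ _ fun f hf h => ?_
  interval_cases n
  exacts [mem_hochB_zero q h, mem_hochB_one q hf h, mem_hochB_two q hf h]

lemma kosAct_eq_of_gen {ζ : Kos q} (hx : kosAct q (KP.gen .x) ζ = ζ)
    (hy : kosAct q (KP.gen .y) ζ = ζ) (hz : kosAct q (KP.gen .z) ζ = ζ) (h : KP k) :
    kosAct q h ζ = KP.counitHom h • ζ := by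
  induction h using KP.induction with
  | hc c =>
    rw [AlgHom.commutes, Algebra.algebraMap_eq_smul_one, map_smul, kosAct_one]; simp
  | hx => rw [hx, KP.counitHom_x, one_smul]
  | hy => rw [hy, KP.counitHom_y, one_smul]
  | hz => rw [hz, KP.counitHom_z, one_smul]
  | hadd a b ha hb => rw [map_add, map_add, LinearMap.add_apply, ha, hb, add_smul]
  | hmul a b ha hb =>
    rw [kosAct_mul, Module.End.mul_apply, ha, map_smul, hb, map_mul, smul_smul]

lemma mem_kosInvariants {n : ℕ} {ζ : Kos q} (hζ : ζ ∈ kosZ q n) (hx : kosAct q (KP.gen .x) ζ = ζ)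
    (hy : kosAct q (KP.gen .y) ζ = ζ) (hz : kosAct q (KP.gen .z) ζ = ζ) :
    (Submodule.Quotient.mk ⟨ζ, hζ⟩ : KosH q n) ∈ kosInvariants q n := by
  refine ⟨⟨ζ, hζ⟩, (Submodule.mem_iInf _).2 fun h => ?_, rfl⟩
  change ζ ∈ (kosB q n).comap (kosAct q h - (Coalgebra.counit h : k) • LinearMap.id)
  rw [Submodule.mem_comap, LinearMap.sub_apply, kosAct_eq_of_gen q hx hy hz]
  change KP.counitHom h • ζ - KP.counitHom h • ζ ∈ _
  rw [sub_self]
  exact zero_mem _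

/-- Both factors can be pulled to the left out of `conjZ`, which leaves Y times `conjZ q 1` = Y. -/
lemma conjZ_of_comm {X Y : KPSmash q} (hy : inGen q .y * X = X * inGen q .y) (hz : inGen q .z * X = Y * inGen q .z) :
    conjZ q X = Y := by
  have hy' (W : KPSmash q) : inGen q .y * (X * W) = X * (inGen q .y * W) := by
    rw [← mul_assoc, hy, mul_assoc]
  have hz' (W : KPSmash q) : inGen q .z * (X * W) = Y * (inGen q .z * W) := by
    rw [← mul_assoc, hz, mul_assoc]
  have key : Y * conjZ q 1 = conjZ q X := by
    rw [conjZ_apply, conjZ_apply, mul_smul_comm]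
    simp only [mul_add, mul_sub, mul_one, mul_assoc, hy', hz']
  rw [← key, ← map_one (inHHom q), conjZ_inH, conjH_one, map_one, mul_one]

lemma conj_of_comm {g : KPGen} (hg : inGen q g * inGen q g = 1) {X : KPSmash q}
    (h : inGen q g * X = X * inGen q g) : inGen q g * X * inGen q g = X := by
  rw [h, mul_assoc, hg, mul_one]

lemma inGen_x_sq : inGen q .x * inGen q .x = 1 := by rw [inGen, ← map_mul, KP.xx, map_one]
lemma inGen_y_sq : inGen q .y * inGen q .y = 1 := by rw [inGen, ← map_mul, KP.yy, map_one]

lemma kosAct_x_kos0 (b : KPSmash q) :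
    kosAct q (KP.gen .x) (kos0 q b) = kos0 q (inGen q .x * b * inGen q .x) := by
  rw [kos0_apply, kosAct_x]; rfl
lemma kosAct_y_kos0 (b : KPSmash q) :
    kosAct q (KP.gen .y) (kos0 q b) = kos0 q (inGen q .y * b * inGen q .y) := by
  rw [kos0_apply, kosAct_y]; rfl

lemma restrictHH_mem_zero (c : HH k (KPSmash q) 0) : restrictHH q 0 c ∈ kosInvariants q 0 := by
  obtain ⟨⟨f, hf⟩, rfl⟩ := Submodule.Quotient.mk_surjective _ c
  have h := mem_hochZ_zero.1 hf
  rw [restrictHH_mk]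
  apply mem_kosInvariants
  · rw [restrictCochain_zero, kosAct_x_kos0, conj_of_comm q (inGen_x_sq q) (h _)]
  · rw [restrictCochain_zero, kosAct_y_kos0, conj_of_comm q (inGen_y_sq q) (h _)]
  · rw [restrictCochain_zero, kosAct_z_kos0, conjZ_of_comm q (h _) (h _)]

/-- The class of a cocycle is invariant if it can be represented by one with invariant
restriction. -/
lemma restrictHH_mem_of_sub {n : ℕ} {f g : HochCochain k (KPSmash q) n}
    (hf : f ∈ hochZ k (KPSmash q) n) (hfg : f - g ∈ hochB k (KPSmash q) n)
    (hg : g ∈ hochZ k (KPSmash q) n)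
    (hx : kosAct q (KP.gen .x) (restrictCochain q n g) = restrictCochain q n g)
    (hy : kosAct q (KP.gen .y) (restrictCochain q n g) = restrictCochain q n g)
    (hz : kosAct q (KP.gen .z) (restrictCochain q n g) = restrictCochain q n g) :
    restrictHH q n (Submodule.Quotient.mk ⟨f, hf⟩) ∈ kosInvariants q n := by
  have e : (Submodule.Quotient.mk ⟨f, hf⟩ : HH k (KPSmash q) n) = Submodule.Quotient.mk ⟨g, hg⟩ :=
    (Submodule.Quotient.eq _).2 hfg
  rw [e, restrictHH_mk]
  exact mem_kosInvariants q _ hx hy hz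

/-- After an inner derivation is subtracted, the derivation vanishes on H and is therefore
H-bilinear. Passing generators of H through A then shows that its restriction is invariant on the
nose. -/
lemma restrictHH_mem_one (c : HH k (KPSmash q) 1) : restrictHH q 1 c ∈ kosInvariants q 1 := by
  obtain ⟨⟨f, hf⟩, rfl⟩ := Submodule.Quotient.mk_surjective _ c
  have hf' := mem_hochZ_one.1 hf
  let m := (sep q).lavg f.lin
  have hB : hochD k (KPSmash q) 0 (hochOfElement m) ∈ hochB k (KPSmash q) 1 := ⟨_, rfl⟩
  set g := f - hochD k (KPSmash q) 0 (hochOfElement m) with hg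
  have hgZ : g ∈ hochZ k (KPSmash q) 1 := by
    refine mem_hochZ_one.2 fun a b => ?_
    simp only [HochCochain.lin_apply, hg, sub_apply, hochD_zero_apply,
      hochOfElement_apply]
    have := hf' a b
    simp only [HochCochain.lin_apply] at this
    rw [this]
    simp only [mul_sub, sub_mul, mul_assoc]
    abel
  have hD := mem_hochZ_one.1 hgZ
  have h0 (h : KP k) : g.lin (inHHom q h) = 0 := by
    rw [HochCochain.lin_apply, hg, sub_apply, hochD_zero_apply, hochOfElement_apply,
      ← HochCochain.lin_apply, (sep q).commutator_lavg _ hf', sub_self]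
  have hl (i : KPGen) (X : KPSmash q) : g.lin (inGen q i * X) = inGen q i * g.lin X := by
    rw [hD, inGen, h0, zero_mul, add_zero]
  have hr (i : KPGen) (X : KPSmash q) : g.lin (X * inGen q i) = g.lin X * inGen q i := by
    rw [hD, inGen, h0, mul_zero, zero_add]
  have hx (a : QPlane k) : inGen q .x * g.lin (inAHom q a) = g.lin (inAHom q a) * inGen q .x := by
    rw [← hl, ← hr, x_mul_inA]
  have hy (a : QPlane k) : inGen q .y * g.lin (inAHom q a) = g.lin (inAHom q a) * inGen q .y := by
    rw [← hl, ← hr, y_mul_inA]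
  have hz (a : QPlane k) : inGen q .z * g.lin (inAHom q a) =
      g.lin (inAHom q (QPlane.swap q a)) * inGen q .z := by
    rw [← hl, ← hr, z_mul_inA]
  have hres : restrictCochain q 1 g = kos1 q (g.lin (inAHom q u), g.lin (inAHom q v)) := rfl
  refine restrictHH_mem_of_sub q hf (by rw [hg, sub_sub_cancel]; exact hB) hgZ ?_ ?_ ?_
  · rw [hres, kosAct_x_kos1]
    simp only [conj_of_comm q (inGen_x_sq q) (hx _)]
  · rw [hres, kosAct_y_kos1]
    simp only [conj_of_comm q (inGen_y_sq q) (hy _)]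
  · rw [hres, kosAct_z_kos1]
    simp only [conjZ_of_comm q (hy _) (hz _), swap_u, swap_v]
    simp

/-- By `exists_relative` the cocycle may be taken to vanish whenever an argument is in H. It is then
H-linear on both sides and balanced over H in the middle, which gives strict invariance of the
restriction. -/
lemma restrictHH_mem_two (c : HH k (KPSmash q) 2) : restrictHH q 2 c ∈ kosInvariants q 2 := by
  obtain ⟨⟨f, hf⟩, rfl⟩ := Submodule.Quotient.mk_surjective _ c
  have hf' := mem_hochZ_two.1 hf
  obtain ⟨G, hG⟩ := (sep q).exists_relative hf'
  have hB : hochD k (KPSmash q) 1 (hochOfLin G) ∈ hochB k (KPSmash q) 2 := ⟨_, rfl⟩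
  set g := f - hochD k (KPSmash q) 1 (hochOfLin G) with hg
  have hgb : g.bilin = f.bilin - bilinD G := by
    ext a b
    rw [HochCochain.bilin_apply, hg, sub_apply, hochD_one_apply]; rfl
  have hF : IsCocycle g.bilin := by rw [hgb]; exact hf'.sub (isCocycle_bilinD G)
  have hgZ : g ∈ hochZ k (KPSmash q) 2 := mem_hochZ_two.2 hF
  have h0 (i : KPGen) (X : KPSmash q) : g.bilin (inGen q i) X = 0 := by
    rw [hgb, LinearMap.sub_apply, LinearMap.sub_apply, inGen, (hG _ _).1, bilinD_apply, sub_self]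
  have h0' (i : KPGen) (X : KPSmash q) : g.bilin X (inGen q i) = 0 := by
    rw [hgb, LinearMap.sub_apply, LinearMap.sub_apply, inGen, (hG _ _).2, bilinD_apply, sub_self]
  have hl (i : KPGen) (X Y : KPSmash q) :
      g.bilin (inGen q i * X) Y = inGen q i * g.bilin X Y := by
    have c := hF (inGen q i) X Y
    rw [h0, h0, zero_mul, sub_zero, add_zero, sub_eq_zero] at c
    exact c.symm
  have hr (i : KPGen) (X Y : KPSmash q) :
      g.bilin X (Y * inGen q i) = g.bilin X Y * inGen q i := by
    have c := hF X Y (inGen q i)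
    rw [h0', h0', mul_zero, sub_zero, zero_add, sub_eq_zero] at c
    exact c
  have hm (i : KPGen) (X Y : KPSmash q) :
      g.bilin (X * inGen q i) Y = g.bilin X (inGen q i * Y) := by
    have c := hF X (inGen q i) Y
    rw [h0, h0', mul_zero, zero_mul, sub_zero, zero_sub, neg_add_eq_sub, sub_eq_zero] at c
    exact c.symm
  have hx (a b : QPlane k) : inGen q .x * g.bilin (inAHom q a) (inAHom q b) =
      g.bilin (inAHom q a) (inAHom q b) * inGen q .x := by
    rw [← hl, ← hr, x_mul_inA, hm, x_mul_inA]
  have hy (a b : QPlane k) : inGen q .y * g.bilin (inAHom q a) (inAHom q b) =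
      g.bilin (inAHom q a) (inAHom q b) * inGen q .y := by
    rw [← hl, ← hr, y_mul_inA, hm, y_mul_inA]
  have hz (a b : QPlane k) : inGen q .z * g.bilin (inAHom q a) (inAHom q b) =
      g.bilin (inAHom q (QPlane.swap q a)) (inAHom q (QPlane.swap q b)) * inGen q .z := by
    rw [← hl, ← hr, z_mul_inA, hm, z_mul_inA]
  have hres : restrictCochain q 2 g = kos2 q (g.bilin (inAHom q u) (inAHom q v) +
    g.bilin (inAHom q v) (inAHom q u)) := rfl
  refine restrictHH_mem_of_sub q hf (by rw [hg, sub_sub_cancel]; exact hB) hgZ ?_ ?_ ?_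
  · rw [hres, kosAct_x_kos2]
    simp only [mul_add, add_mul, conj_of_comm q (inGen_x_sq q) (hx _ _)]
  · rw [hres, kosAct_y_kos2]
    simp only [mul_add, add_mul, conj_of_comm q (inGen_y_sq q) (hy _ _)]
  · rw [hres, kosAct_z_kos2, map_add]
    simp only [conjZ_of_comm q (hy _ _) (hz _ _), swap_u, swap_v]
    simp [add_comm]

end Restriction

/-! ### Twisted derivations of `A`. -/

namespace QPlane

variable {k R : Type*} [Field k] [Ring R] [Algebra k R]

/-- A twisted derivation of `A` with given values at `u` and `v`. -/
lemma exists_twisted_derivation (μ l : QPlane k →ₐ[k] R) (m n : R)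
    (h : μ u * n + m * l v + (μ v * m + n * l u) = 0) :
    ∃ D : QPlane k →ₗ[k] R, D u = m ∧ D v = n ∧ ∀ a b, D (a * b) = μ a * D b + D a * l b := by
  have hμ : μ u * μ v + μ v * μ u = 0 := by rw [← map_mul, ← map_mul, ← map_add, uv_add_vu, map_zero]
  have hl : l u * l v + l v * l u = 0 := by rw [← map_mul, ← map_mul, ← map_add, uv_add_vu, map_zero]
  -- A twisted derivation is the off-diagonal entry of a homomorphism to upper triangular matrices
  -- with diagonal (μ, l); the hypothesis is the relation in that entry.
  let Ψ : QPlane k →ₐ[k] Matrix (Fin 2) (Fin 2) R :=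
    QPlane.lift !![μ u, m; 0, l u] !![μ v, n; 0, l v] (by
      rw [Matrix.mul_fin_two, Matrix.mul_fin_two]
      ext i j
      fin_cases i <;> fin_cases j <;> simp [hμ, hl, h])
  have hu : Ψ u = !![μ u, m; 0, l u] := QPlane.lift_u _ _ _
  have hv : Ψ v = !![μ v, n; 0, l v] := QPlane.lift_v _ _ _
  have key (a : QPlane k) : Ψ a 0 0 = μ a ∧ Ψ a 1 0 = 0 ∧ Ψ a 1 1 = l a := by
    induction a using QPlane.induction with
    | hc c => simp [Matrix.algebraMap_matrix_apply]
    | hu => simp [hu]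
    | hv => simp [hv]
    | hadd a b ha hb => simp [ha, hb]
    | hmul a b ha hb => simp [Matrix.mul_apply, Fin.sum_univ_two, ha, hb]
  refine ⟨Matrix.entryLinearMap k R 0 1 ∘ₗ Ψ.toLinearMap, ?_, ?_, fun a b => ?_⟩
  · simp [hu]
  · simp [hv]
  · simp [Matrix.mul_apply, Fin.sum_univ_two, key]

end QPlane

/-! ### Extension of equivariant cochains from `A` to `A # H`. -/

namespace KPSmash

open SmashProduct QPlane

variable {k : Type*} [Field k] [NeZero (2 : k)] (q : kˣ)

/-- The action of the generators of `H` on `A`. -/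
noncomputable def genAct : KPGen → QPlane k →ₐ[k] QPlane k
  | .x => AlgHom.id k _
  | .y => AlgHom.id k _
  | .z => QPlane.swap q

lemma inGen_mul (g : KPGen) (a : QPlane k) :
    inGen q g * inAHom q a = inAHom q (genAct q g a) * inGen q g := by
  cases g
  exacts [x_mul_inA q a, y_mul_inA q a, z_mul_inA q a]

lemma inH_induction {P : KPSmash q → Prop} (hc : ∀ c : k, P (algebraMap k _ c))
    (hg : ∀ g, P (inGen q g)) (hadd : ∀ X Y, P X → P Y → P (X + Y))
    (hmul : ∀ X Y, P X → P Y → P (X * Y)) (h : KP k) : P (inHHom q h) := by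
  induction h using KP.induction with
  | hc c => rw [AlgHom.commutes]; exact hc c
  | hx => exact hg .x
  | hy => exact hg .y
  | hz => exact hg .z
  | hadd a b ha hb => rw [map_add]; exact hadd _ _ ha hb
  | hmul a b ha hb => rw [map_mul]; exact hmul _ _ ha hb

/-- An element commuting with the generators is central. -/
lemma central_of_gen {b : KPSmash q} (hu : inAHom q u * b = b * inAHom q u)
    (hv : inAHom q v * b = b * inAHom q v) (hg : ∀ g, inGen q g * b = b * inGen q g)
    (X : KPSmash q) : X * b = b * X := by
  have hA (a : QPlane k) : inAHom q a * b = b * inAHom q a := by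
    induction a using QPlane.induction with
    | hc c => rw [AlgHom.commutes]; exact Algebra.commutes _ _
    | hu => exact hu
    | hv => exact hv
    | hadd a c ha hc => rw [map_add, add_mul, mul_add, ha, hc]
    | hmul a c ha hc => rw [map_mul, mul_assoc, hc, ← mul_assoc, ha, mul_assoc]
  have hH (h : KP k) : inHHom q h * b = b * inHHom q h := by
    refine inH_induction q (P := fun X => X * b = b * X) ?_ hg ?_ ?_ h
    · exact fun c => Algebra.commutes _ _
    · intro X Y hX hY; rw [add_mul, mul_add, hX, hY]
    · intro X Y hX hY; rw [mul_assoc, hY, ← mul_assoc, hX, mul_assoc]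
  induction X using smash_induction with
  | h0 => simp
  | hadd X Y hX hY => rw [add_mul, mul_add, hX, hY]
  | hmul a h => rw [mul_assoc, hH, ← mul_assoc, hA, mul_assoc]

lemma hom_ext_smash {M : Type*} [AddCommGroup M] [Module k M] {F G : KPSmash q →ₗ[k] M}
    (h : ∀ a h, F (inAHom q a * inHHom q h) = G (inAHom q a * inHHom q h)) : F = G := by
  ext X
  induction X using smash_induction with
  | h0 => simp
  | hadd X Y hX hY => rw [map_add, map_add, hX, hY]
  | hmul a g => exact h a g

/-- The extension `a h ↦ D(a) h` of a linear map on `A`. -/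
noncomputable def extendRight : (QPlane k →ₗ[k] KPSmash q) →ₗ[k] KPSmash q →ₗ[k] KPSmash q where
  toFun D := extend q (((LinearMap.mul k (KPSmash q)).compl₂ (inHHom q).toLinearMap) ∘ₗ D)
  map_add' D D' := hom_ext_smash q fun a h => by
    rw [LinearMap.add_apply, extend_apply, extend_apply, extend_apply]
    simp [add_mul]
  map_smul' c D := hom_ext_smash q fun a h => by
    rw [RingHom.id_apply, LinearMap.smul_apply, extend_apply, extend_apply]
    simp

lemma extendRight_apply (D : QPlane k →ₗ[k] KPSmash q) (a : QPlane k) (h : KP k) :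
    extendRight q D (inAHom q a * inHHom q h) = D a * inHHom q h := extend_apply q _ a h

lemma extendRight_inA (D : QPlane k →ₗ[k] KPSmash q) (a : QPlane k) :
    extendRight q D (inAHom q a) = D a := by
  simpa using extendRight_apply q D a 1

lemma extendRight_mul_inH (D : QPlane k →ₗ[k] KPSmash q) (X : KPSmash q) (h : KP k) :
    extendRight q D (X * inHHom q h) = extendRight q D X * inHHom q h := by
  induction X using smash_induction with
  | h0 => simp
  | hadd X Y hX hY => rw [add_mul, map_add, map_add, hX, hY, add_mul]
  | hmul a g => rw [mul_assoc, ← map_mul, extendRight_apply, extendRight_apply, map_mul, mul_assoc]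

lemma extendRight_inGen_mul {g : KPGen} {D D' : QPlane k →ₗ[k] KPSmash q}
    (hD : ∀ a, inGen q g * D a = D' (genAct q g a) * inGen q g) (X : KPSmash q) :
    extendRight q D' (inGen q g * X) = inGen q g * extendRight q D X := by
  induction X using smash_induction with
  | h0 => simp
  | hadd X Y hX hY => rw [mul_add, map_add, map_add, hX, hY, mul_add]
  | hmul a h =>
    rw [← mul_assoc, inGen_mul, mul_assoc, inGen, ← map_mul, extendRight_apply, extendRight_apply,
      map_mul, ← mul_assoc, ← mul_assoc]
    exact congrArg (· * _) (hD a).symm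

/-- An equivariant derivation of `A` with values in `A # H` extends to `A # H`. -/
lemma extendRight_derivation {D : QPlane k →ₗ[k] KPSmash q}
    (hD : ∀ a b, D (a * b) = inAHom q a * D b + D a * inAHom q b)
    (hg : ∀ g a, inGen q g * D a = D (genAct q g a) * inGen q g) (X Y : KPSmash q) :
    extendRight q D (X * Y) = X * extendRight q D Y + extendRight q D X * Y := by
  have hH (h : KP k) : ∀ Y, extendRight q D (inHHom q h * Y) = inHHom q h * extendRight q D Y := by
    refine inH_induction q (P := fun X => ∀ Y, extendRight q D (X * Y) = X * extendRight q D Y)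
      ?_ ?_ ?_ ?_ h
    · intro c Y; rw [← Algebra.smul_def, ← Algebra.smul_def, map_smul]
    · exact fun g Y => extendRight_inGen_mul q (hg g) Y
    · intro X X' hX hX' Y; rw [add_mul, add_mul, map_add, hX, hX']
    · intro X X' hX hX' Y; rw [mul_assoc, hX, hX', mul_assoc]
  have hA (a : QPlane k) (Y : KPSmash q) : extendRight q D (inAHom q a * Y) =
      inAHom q a * extendRight q D Y + D a * Y := by
    induction Y using smash_induction with
    | h0 => simp
    | hadd Y Y' h h' => simp only [mul_add, map_add, h, h']; abel
    | hmul b h =>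
      rw [← mul_assoc, ← map_mul, extendRight_apply, hD, extendRight_apply]
      simp only [add_mul, mul_assoc]
  induction X using smash_induction with
  | h0 => simp
  | hadd X X' h h' => simp only [add_mul, map_add, h, h']; abel
  | hmul a h => rw [mul_assoc, hA, hH, extendRight_apply]; simp only [mul_assoc]

/-- The extension `(a h, Y) ↦ f(a, h Y)` of a bilinear map on `A`, where `f(a, b h) = f(a, b) h`. -/
noncomputable def extendBilin (f : QPlane k →ₗ[k] QPlane k →ₗ[k] KPSmash q) :
    KPSmash q →ₗ[k] KPSmash q →ₗ[k] KPSmash q :=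
  TensorProduct.lift (LinearMap.mk₂ k
    (fun (a : QPlane k) (h : KP k) => extendRight q (f a) ∘ₗ LinearMap.mulLeft k (inHHom q h))
    (fun a b h => by ext; simp) (fun c a h => by ext; simp)
    (fun a h h' => by ext; simp [add_mul]) (fun c a h => by ext; simp))

lemma extendBilin_apply (f : QPlane k →ₗ[k] QPlane k →ₗ[k] KPSmash q) (a : QPlane k) (h : KP k)
    (Y : KPSmash q) : extendBilin q f (inAHom q a * inHHom q h) Y =
      extendRight q (f a) (inHHom q h * Y) := by
  rw [← tmul_eq]; exact LinearMap.congr_fun (TensorProduct.lift.tmul _ _) Y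

section
variable (f : QPlane k →ₗ[k] QPlane k →ₗ[k] KPSmash q)

lemma extendBilin_inA (a b : QPlane k) :
    extendBilin q f (inAHom q a) (inAHom q b) = f a b := by
  have := extendBilin_apply q f a 1 (inAHom q b)
  rwa [map_one, mul_one, one_mul, extendRight_inA] at this

lemma extendBilin_mul_inH (X : KPSmash q) (h : KP k) (Y : KPSmash q) :
    extendBilin q f (X * inHHom q h) Y = extendBilin q f X (inHHom q h * Y) := by
  induction X using smash_induction with
  | h0 => simp
  | hadd X X' h h' => simp only [add_mul, map_add, LinearMap.add_apply, h, h']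
  | hmul a g => rw [mul_assoc, ← map_mul, extendBilin_apply, extendBilin_apply, map_mul (inHHom q), mul_assoc]

lemma extendBilin_apply_mul_inH (X Y : KPSmash q) (h : KP k) :
    extendBilin q f X (Y * inHHom q h) = extendBilin q f X Y * inHHom q h := by
  induction X using smash_induction with
  | h0 => simp
  | hadd X X' h h' => simp only [add_mul, map_add, LinearMap.add_apply, h, h']
  | hmul a g => rw [extendBilin_apply, extendBilin_apply, ← mul_assoc, extendRight_mul_inH]

variable {f}

lemma extendBilin_inH_mul
    (hg : ∀ g a b, inGen q g * f a b = f (genAct q g a) (genAct q g b) * inGen q g)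
    (h : KP k) : ∀ X Y, extendBilin q f (inHHom q h * X) Y = inHHom q h * extendBilin q f X Y := by
  refine inH_induction q
    (P := fun Z => ∀ X Y, extendBilin q f (Z * X) Y = Z * extendBilin q f X Y) ?_ ?_ ?_ ?_ h
  · intro c X Y
    rw [← Algebra.smul_def, ← Algebra.smul_def, map_smul, LinearMap.smul_apply]
  · intro g X Y
    induction X using smash_induction with
    | h0 => simp
    | hadd X X' h h' => simp only [mul_add, map_add, LinearMap.add_apply, h, h']
    | hmul a h =>
      rw [← mul_assoc, inGen_mul, mul_assoc]
      nth_rw 1 [inGen]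
      rw [← map_mul, extendBilin_apply, extendBilin_apply, map_mul (inHHom q), mul_assoc]
      exact extendRight_inGen_mul q (fun b => hg g a b) _
  · intro Z Z' h h' X Y
    rw [add_mul, map_add, LinearMap.add_apply, h, h', add_mul]
  · intro Z Z' h h' X Y
    rw [mul_assoc, h, h', mul_assoc]

/-- An equivariant `2`-cocycle of `A` with values in `A # H` extends to `A # H`. -/
lemma isCocycle_extendBilin (hf : ∀ a b c, inAHom q a * f b c - f (a * b) c + f a (b * c) -
      f a b * inAHom q c = 0)
    (hg : ∀ g a b, inGen q g * f a b = f (genAct q g a) (genAct q g b) * inGen q g) :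
    IsCocycle (extendBilin q f) := by
  -- The arguments are released from A one at a time: the third here, the second in `h2`, the first
  -- at the end, where equivariance is used.
  have h1 (a b : QPlane k) (Z : KPSmash q) :
      inAHom q a * extendBilin q f (inAHom q b) Z - extendBilin q f (inAHom q a * inAHom q b) Z +
      extendBilin q f (inAHom q a) (inAHom q b * Z) -
      extendBilin q f (inAHom q a) (inAHom q b) * Z = 0 := by
    induction Z using smash_induction with
    | h0 => simp
    | hadd Z Z' h h' =>
      rw [← add_zero (0 : KPSmash q)]
      nth_rw 1 [← h]
      rw [← h']
      simp only [mul_add, map_add]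
      abel
    | hmul c h =>
      rw [← zero_mul (inHHom q h), ← hf a b c, ← mul_assoc (inAHom q b), ← map_mul, ← map_mul]
      simp only [extendBilin_apply_mul_inH, extendBilin_inA]
      simp only [add_mul, sub_mul, mul_assoc]
  have h2 (a : QPlane k) (Y Z : KPSmash q) :
      inAHom q a * extendBilin q f Y Z - extendBilin q f (inAHom q a * Y) Z +
      extendBilin q f (inAHom q a) (Y * Z) - extendBilin q f (inAHom q a) Y * Z = 0 := by
    induction Y using smash_induction with
    | h0 => simp
    | hadd Y Y' h h' =>
      rw [← add_zero (0 : KPSmash q)]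
      nth_rw 1 [← h]
      rw [← h']
      simp only [mul_add, add_mul, map_add, LinearMap.add_apply]
      abel
    | hmul b h =>
      rw [← mul_assoc, extendBilin_mul_inH, extendBilin_mul_inH, extendBilin_apply_mul_inH,
        mul_assoc, mul_assoc]
      exact h1 a b _
  intro X Y Z
  induction X using smash_induction with
  | h0 => simp
  | hadd X X' h h' =>
    rw [← add_zero (0 : KPSmash q)]
    nth_rw 1 [← h]
    rw [← h']
    simp only [mul_add, add_mul, map_add, LinearMap.add_apply]
    abel
  | hmul a h =>
    rw [mul_assoc, ← extendBilin_inH_mul q hg, mul_assoc, extendBilin_mul_inH, extendBilin_mul_inH,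
      ← mul_assoc (inHHom q h)]
    exact h2 a _ _

end
end KPSmash

/-! ### Commutation of the generators of `H` with the first six basis elements. -/

namespace KP
variable {k : Type*} [Field k] [NeZero (2 : k)]

lemma x_mul_bas {g : Fin 8} (hg : g < 6) : gen .x * bas g = (bas g * gen .x : KP k) := by
  have h2 : (2 : k) ≠ 0 := two_ne_zero
  fin_cases g <;> simp at hg <;>
    simp [bas, onePlus, oneMinus, xPlus, xMinus, zPlus, xzPlus, mul_add, mul_sub, add_mul, sub_mul,
      mul_assoc, xx, yy, zz, yx, zx, zy, xx', yy', yx', zx', zy', zz'] <;>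
    match_scalars <;> field_simp

lemma y_mul_bas {g : Fin 8} (hg : g < 6) : gen .y * bas g = (bas g * gen .y : KP k) := by
  have h2 : (2 : k) ≠ 0 := two_ne_zero
  fin_cases g <;> simp at hg <;>
    simp [bas, onePlus, oneMinus, xPlus, xMinus, zPlus, xzPlus, mul_add, mul_sub, add_mul, sub_mul,
      mul_assoc, xx, yy, zz, yx, zx, zy, xx', yy', yx', zx', zy', zz'] <;>
    match_scalars <;> field_simp

lemma z_mul_bas {g : Fin 8} (hg : g < 6) :
    gen .z * bas g = ((conjSign g : k) • bas g * gen .z : KP k) := by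
  have h2 : (2 : k) ≠ 0 := two_ne_zero
  fin_cases g <;> simp at hg <;>
    simp [conjSign, bas, onePlus, oneMinus, xPlus, xMinus, zPlus, xzPlus, mul_add, mul_sub,
      add_mul, sub_mul,
      mul_assoc, xx, yy, zz, yx, zx, zy, xx', yy', yx', zx', zy', zz'] <;>
    match_scalars <;> field_simp <;> norm_num
end KP

/-! ### Explicit cocycles with prescribed restriction. -/

section Realization

open SmashProduct QPlane KPSmash

variable {k : Type*} [Field k] [NeZero (2 : k)] (q : kˣ)

lemma x_mul_smashBas {g : Fin 8} (hg : g < 6) (p : QPlane k) :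
    inGen q .x * smashBas q g p = smashBas q g p * inGen q .x := by
  rw [smashBas_apply, ← mul_assoc, x_mul_inA, mul_assoc, mul_assoc, inGen, ← map_mul, ← map_mul,
    KP.x_mul_bas hg]
lemma y_mul_smashBas {g : Fin 8} (hg : g < 6) (p : QPlane k) :
    inGen q .y * smashBas q g p = smashBas q g p * inGen q .y := by
  rw [smashBas_apply, ← mul_assoc, y_mul_inA, mul_assoc, mul_assoc, inGen, ← map_mul, ← map_mul,
    KP.y_mul_bas hg]
lemma z_mul_smashBas {g : Fin 8} (hg : g < 6) (p : QPlane k) : inGen q .z * smashBas q g p =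
    smashBas q g ((conjSign g : k) • QPlane.swap q p) * inGen q .z := by
  rw [smashBas_apply, ← mul_assoc, z_mul_inA, mul_assoc, inGen, ← map_mul, KP.z_mul_bas hg,
    smashBas_apply, map_smul (inAHom q), map_mul, map_smul (inHHom q)]
  simp only [smul_mul_assoc, mul_smul_comm, mul_assoc]

lemma isClassOf_restrictHH {n : ℕ} {f : HochCochain k (KPSmash q) n}
    (hf : f ∈ hochZ k (KPSmash q) n) {ζ : Kos q} (h : restrictCochain q n f = ζ) :
    ∃ c, Cohomology.IsClassOf (restrictHH q n c) ζ := by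
  subst h
  exact ⟨Submodule.Quotient.mk ⟨f, hf⟩, restrictCochain_mem_kosZ q hf, rfl⟩

lemma exists_class_zero {g : Fin 8} (hg : g < 4) {p : QPlane k} (hu : u * p = p * u)
    (hv : v * p = p * v) (hz : (conjSign g : k) • QPlane.swap q p = p) :
    ∃ c, Cohomology.IsClassOf (restrictHH q 0 c) (kos0 q (smashBas q g p)) := by
  have hg' : g < 6 := hg.trans (by decide)
  have hA (a : QPlane k) (h : a * p = p * a) :
      inAHom q a * smashBas q g p = smashBas q g p * inAHom q a := by
    rw [inA_mul_smashBas, smashBas_mul_inA, twist_of_lt q hg, AlgHom.id_apply, h]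
  refine isClassOf_restrictHH q (f := hochOfElement (smashBas q g p)) ?_ rfl
  refine mem_hochZ_zero.2 (central_of_gen q (hA _ hu) (hA _ hv) fun i => ?_)
  cases i
  · exact x_mul_smashBas q hg' p
  · exact y_mul_smashBas q hg' p
  · exact (z_mul_smashBas q hg' p).trans (by rw [hz]; rfl)

/-- The cocycle condition yields a derivation of A with these values at u and v. Equivariance is
checked at u and v, where `hp` and `hr` handle z, and the derivation then extends to `A # H`. -/
lemma exists_class_one {g : Fin 8} (hg : g < 4) {p r : QPlane k}
    (hpr : d1 (AlgHom.id k _) (p, r) = 0)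
    (hp : (conjSign g : k) • QPlane.swap q p = (q⁻¹ : k) • r)
    (hr : (conjSign g : k) • QPlane.swap q r = (q : k) • p) :
    ∃ c, Cohomology.IsClassOf (restrictHH q 1 c) (kos1 q (smashBas q g p, smashBas q g r)) := by
  have hg' : g < 6 := hg.trans (by decide)
  obtain ⟨D, hu, hv, hD⟩ := exists_twisted_derivation (inAHom q) (inAHom q) (smashBas q g p)
    (smashBas q g r) (by
      have := congrArg (smashBas q g) hpr
      rw [d1_apply] at this
      rw [inA_mul_smashBas, inA_mul_smashBas, smashBas_mul_inA, smashBas_mul_inA,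
        twist_of_lt q hg, ← map_add, ← map_add, ← map_add, ← map_zero (smashBas q g), ← this]
      congr 1
      simp only [AlgHom.id_apply]
      abel)
  have h1 : D 1 = 0 := by simpa using hD 1 1
  have hgen (i : KPGen) (a : QPlane k) :
      inGen q i * D a = D (genAct q i a) * inGen q i := by
    induction a using QPlane.induction with
    | hc c =>
      rw [AlgHom.commutes, Algebra.algebraMap_eq_smul_one, map_smul, h1, smul_zero, mul_zero,
        zero_mul]
    | hu =>
      cases i
      · exact hu ▸ x_mul_smashBas q hg' p
      · exact hu ▸ y_mul_smashBas q hg' p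
      · rw [hu, z_mul_smashBas q hg', hp, genAct, swap_u, map_smul, map_smul, hv]
    | hv =>
      cases i
      · exact hv ▸ x_mul_smashBas q hg' r
      · exact hv ▸ y_mul_smashBas q hg' r
      · rw [hv, z_mul_smashBas q hg', hr, genAct, swap_v, map_smul, map_smul, hu]
    | hadd a b ha hb => rw [map_add, map_add, map_add, mul_add, add_mul, ha, hb]
    | hmul a b ha hb =>
      rw [hD, map_mul, hD, mul_add, add_mul, ← mul_assoc, inGen_mul, mul_assoc, hb, ← mul_assoc,
        ← mul_assoc (inGen q i) (D a), ha, mul_assoc (D _) (inGen q i), inGen_mul]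
      simp only [mul_assoc]
  refine isClassOf_restrictHH q (f := hochOfLin (extendRight q D)) ?_ ?_
  · exact mem_hochZ_one.2 (extendRight_derivation q hD hgen)
  · rw [restrictCochain_one, hochOfLin_apply, hochOfLin_apply, extendRight_inA, extendRight_inA,
      hu, hv]

/-- The bilinear map `(a, b) ↦ D₁(a) D₂(b) r`. -/
noncomputable def mulBilin (D₁ D₂ : QPlane k →ₗ[k] QPlane k) (r : KPSmash q) :
    QPlane k →ₗ[k] QPlane k →ₗ[k] KPSmash q :=
  LinearMap.mk₂ k (fun a b => inAHom q (D₁ a * D₂ b) * r) (by simp [add_mul])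
    (by simp) (by simp [mul_add, add_mul]) (by simp)

lemma mulBilin_apply (D₁ D₂ : QPlane k →ₗ[k] QPlane k) (r : KPSmash q) (a b : QPlane k) :
    mulBilin q D₁ D₂ r a b = inAHom q (D₁ a * D₂ b) * r := rfl

lemma mulBilin_cocycle {l α : QPlane k → QPlane k} {D₁ D₂ : QPlane k →ₗ[k] QPlane k}
    {r : KPSmash q} (h1 : ∀ a b, D₁ (a * b) = a * D₁ b + D₁ a * l b)
    (h2 : ∀ a b, D₂ (a * b) = l a * D₂ b + D₂ a * α b)
    (hr : ∀ a, r * inAHom q a = inAHom q (α a) * r) (a b c : QPlane k) :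
    inAHom q a * mulBilin q D₁ D₂ r b c - mulBilin q D₁ D₂ r (a * b) c +
      mulBilin q D₁ D₂ r a (b * c) - mulBilin q D₁ D₂ r a b * inAHom q c = 0 := by
  simp only [mulBilin_apply, h1, h2]
  rw [mul_assoc _ r, hr]
  simp only [map_mul, map_add, mul_add, add_mul, mul_assoc]
  abel

lemma swap_twisted {l α : QPlane k → QPlane k} {D : QPlane k →ₗ[k] QPlane k}
    (h : ∀ a b, D (a * b) = l a * D b + D a * α b) (a b : QPlane k) :
    QPlane.swap q (D (QPlane.swap q (a * b))) =
      QPlane.swap q (l (QPlane.swap q a)) * QPlane.swap q (D (QPlane.swap q b)) +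
      QPlane.swap q (D (QPlane.swap q a)) * QPlane.swap q (α (QPlane.swap q b)) := by
  rw [map_mul, h, map_add, map_mul, map_mul]

lemma inGen_z_right_cancel {X Y : KPSmash q} (h : X * inGen q .z = Y * inGen q .z) : X = Y := by
  have e : inGen q .z * inHHom q KP.zInv = 1 := by rw [inGen, ← map_mul, KP.z_mul_zInv, map_one]
  rw [← mul_one X, ← e, ← mul_assoc, h, mul_assoc, e, mul_one]

lemma conjSign_mul_self {g : Fin 8} (hg : g < 6) : (conjSign g * conjSign g : k) = 1 := by
  fin_cases g <;> simp at hg <;> simp [conjSign]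

/-- If D₁ is an (id, l)-derivation and D₂ an (l, α)-derivation, then D₁(a) D₂(b) r is a cocycle as
soon as r b = α(b) r. Adding its transform under z makes it equivariant, and `h` normalises the
restriction. -/
lemma exists_class_two {g : Fin 8} (hg : g < 6) (p : QPlane k) (l α : QPlane k →ₐ[k] QPlane k)
    (hα : ∀ a, p * twist q g a = α a * p) {m₁ n₁ m₂ n₂ : QPlane k}
    (h1 : u * n₁ + m₁ * l v + (v * m₁ + n₁ * l u) = 0)
    (h2 : l u * n₂ + m₂ * α v + (l v * m₂ + n₂ * α u) = 0) (h : m₁ * n₂ + n₁ * m₂ = 1) :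
    ∃ c, Cohomology.IsClassOf (restrictHH q 2 c)
      (kos2 q (smashBas q g (p + (conjSign g : k) • QPlane.swap q p))) := by
  obtain ⟨D₁, hu₁, hv₁, hD₁⟩ := exists_twisted_derivation (AlgHom.id k _) l m₁ n₁ h1
  obtain ⟨D₂, hu₂, hv₂, hD₂⟩ := exists_twisted_derivation l α m₂ n₂ h2
  set r := smashBas q g p with hr
  set r' := smashBas q g ((conjSign g : k) • QPlane.swap q p) with hr'
  have hrα (a : QPlane k) : r * inAHom q a = inAHom q (α a) * r := by
    rw [hr, smashBas_mul_inA, inA_mul_smashBas, hα]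
  have hzr : inGen q .z * r = r' * inGen q .z := z_mul_smashBas q hg p
  have hzr' : inGen q .z * r' = r * inGen q .z := by
    rw [hr', z_mul_smashBas q hg, map_smul (QPlane.swap q), QPlane.swap_swap, smul_smul, conjSign_mul_self hg,
      one_smul]
  have hrα' (a : QPlane k) : r' * inAHom q a =
      inAHom q (QPlane.swap q (α (QPlane.swap q a))) * r' := by
    apply inGen_z_right_cancel
    have e := z_mul_inA q (QPlane.swap q a)
    rw [QPlane.swap_swap] at e
    rw [mul_assoc, ← e, ← mul_assoc, ← hzr, mul_assoc, hrα, ← mul_assoc, z_mul_inA, mul_assoc, hzr,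
      mul_assoc]
  let σ := (QPlane.swap q).toLinearMap
  let f := mulBilin q D₁ D₂ r + mulBilin q (σ ∘ₗ D₁ ∘ₗ σ) (σ ∘ₗ D₂ ∘ₗ σ) r'
  have hf (a b : QPlane k) : f a b = inAHom q (D₁ a * D₂ b) * r + inAHom q (QPlane.swap q
      (D₁ (QPlane.swap q a) * D₂ (QPlane.swap q b))) * r' := by
    rw [map_mul (QPlane.swap q)]; rfl
  have hcoc (a b c : QPlane k) :
      inAHom q a * f b c - f (a * b) c + f a (b * c) - f a b * inAHom q c = 0 := by
    have e1 := mulBilin_cocycle q hD₁ hD₂ hrα a b c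
    have e2 := mulBilin_cocycle q (D₁ := σ ∘ₗ D₁ ∘ₗ σ) (D₂ := σ ∘ₗ D₂ ∘ₗ σ)
      (fun a b => by
        have := swap_twisted q hD₁ a b
        rwa [AlgHom.id_apply, QPlane.swap_swap] at this) (swap_twisted q hD₂) hrα' a b c
    rw [← add_zero (0 : KPSmash q)]
    nth_rw 1 [← e1]
    rw [← e2]
    simp only [f, LinearMap.add_apply, mul_add, add_mul]
    abel
  have hgen (i : KPGen) (a b : QPlane k) :
      inGen q i * f a b = f (genAct q i a) (genAct q i b) * inGen q i := by
    cases i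
    · simp only [hf, genAct, AlgHom.id_apply, mul_add, add_mul]
      rw [← mul_assoc, ← mul_assoc, x_mul_inA, x_mul_inA, mul_assoc, mul_assoc,
        x_mul_smashBas q hg, x_mul_smashBas q hg, mul_assoc, mul_assoc]
    · simp only [hf, genAct, AlgHom.id_apply, mul_add, add_mul]
      rw [← mul_assoc, ← mul_assoc, y_mul_inA, y_mul_inA, mul_assoc, mul_assoc,
        y_mul_smashBas q hg, y_mul_smashBas q hg, mul_assoc, mul_assoc]
    · simp only [hf, genAct, QPlane.swap_swap, mul_add, add_mul]
      rw [← mul_assoc, ← mul_assoc, z_mul_inA, z_mul_inA, mul_assoc, mul_assoc, hzr, hzr',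
        QPlane.swap_swap, add_comm]
      simp only [mul_assoc]
  refine isClassOf_restrictHH q (f := hochOfBilin (extendBilin q f)) ?_ ?_
  · exact mem_hochZ_two.2 (isCocycle_extendBilin q hcoc hgen)
  · rw [restrictCochain_two, hochOfBilin_apply, hochOfBilin_apply, extendBilin_inA, extendBilin_inA,
      hf, hf, swap_u, swap_v, map_smul, map_smul, map_smul, map_smul, hu₁, hv₁, hu₂, hv₂,
      smul_mul_smul_comm, smul_mul_smul_comm, mul_inv_cancel₀ q.ne_zero,
      inv_mul_cancel₀ q.ne_zero, one_smul, one_smul, map_add (smashBas q g), ← hr, ← hr']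
    have e : inAHom q (m₁ * n₂) * r + inAHom q (QPlane.swap q (n₁ * m₂)) * r' +
        (inAHom q (n₁ * m₂) * r + inAHom q (QPlane.swap q (m₁ * n₂)) * r') =
        inAHom q (m₁ * n₂ + n₁ * m₂) * r + inAHom q (QPlane.swap q (m₁ * n₂ + n₁ * m₂)) * r' := by
      simp only [map_add, add_mul]
      abel
    rw [e, h, map_one, map_one, map_one, one_mul, one_mul]

end Realization

/-! ### Automorphisms of `A` used as twists. -/

namespace QPlane

variable {k : Type*} [Field k]

lemma mul_twist_of_gen {α β : QPlane k →ₐ[k] QPlane k} {p : QPlane k} (hu : p * β u = α u * p)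
    (hv : p * β v = α v * p) (a : QPlane k) : p * β a = α a * p := by
  induction a using QPlane.induction with
  | hc c => rw [AlgHom.commutes, AlgHom.commutes]; exact (Algebra.commutes _ _).symm
  | hu => exact hu
  | hv => exact hv
  | hadd a b ha hb => rw [map_add, map_add, mul_add, add_mul, ha, hb]
  | hmul a b ha hb => rw [map_mul, map_mul, ← mul_assoc, ha, mul_assoc, hb, mul_assoc]

/-- The automorphism `u ↦ -u`, `v ↦ -v` of `A`. -/
noncomputable def flip : QPlane k →ₐ[k] QPlane k := lift (-u) (-v) (by simp [vu])

@[simp] lemma flip_u : flip (u : QPlane k) = -u := by simp [flip]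
@[simp] lemma flip_v : flip (v : QPlane k) = -v := by simp [flip]

/-- The automorphism `u ↦ -q⁻¹ v`, `v ↦ -q u` of `A`. -/
noncomputable def flipSwap (q : kˣ) : QPlane k →ₐ[k] QPlane k := flip.comp (swap q)

@[simp] lemma flipSwap_u (q : kˣ) : flipSwap q (u : QPlane k) = -((q⁻¹ : k) • v) := by
  simp [flipSwap]
@[simp] lemma flipSwap_v (q : kˣ) : flipSwap q (v : QPlane k) = -((q : k) • u) := by
  simp [flipSwap]

end QPlane

/-! ### The listed classes are realised, and the theorem is assembled. -/

section Main

open SmashProduct QPlane PlaneDual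

variable {k : Type*} [Field k] [NeZero (2 : k)] (q : kˣ)

lemma conjSign_mul_self_of_lt {g : Fin 8} (hg : g < 4) : (conjSign g * conjSign g : k) = 1 :=
  conjSign_mul_self (hg.trans (by decide))

lemma exists_class_sym0 (i j : ℕ) {g : Fin 8} (hg : g < 4) :
    ∃ c, Cohomology.IsClassOf (restrictHH q 0 c) ((q : k) ^ (2 * i) • elt q 1 (2 * i) (2 * j)
      (KP.bas g) + (conjSign g * (q : k) ^ (2 * j)) • elt q 1 (2 * j) (2 * i) (KP.bas g)) := by
  have hq : (q : k) ≠ 0 := q.ne_zero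
  convert exists_class_zero q hg (p := (q : k) ^ (2 * i) • mon (2 * i) (2 * j) +
    (conjSign g * (q : k) ^ (2 * j)) • mon (2 * j) (2 * i)) ?_ ?_ ?_ using 3
  · rw [elt_eq, elt_eq]
    simp [kos0_apply, smashBas_apply, add_mul, TensorProduct.tmul_add]
  · simp only [mul_add, add_mul, mul_smul_comm, smul_mul_assoc, u_mul_mon, mon_mul_u]
    simp
  · simp only [mul_add, add_mul, mul_smul_comm, smul_mul_assoc, v_mul_mon, mon_mul_v]
    simp
  · rw [map_add, map_smul, map_smul, swap_mon, swap_mon, add_comm]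
    simp only [smul_add, smul_smul, inv_pow]
    congr 2
    · rw [show 2 * j * (2 * i) = 2 * (2 * j * i) by ring, pow_mul (-1 : k)]
      have := conjSign_mul_self_of_lt (k := k) hg
      field_simp
      simp [pow_two, this]
    · rw [show 2 * i * (2 * j) = 2 * (2 * i * j) by ring, pow_mul (-1 : k)]
      field_simp
      simp

lemma exists_class_sym1 (i j : ℕ) {g : Fin 8} (hg : g < 4) :
    ∃ c, Cohomology.IsClassOf (restrictHH q 1 c) ((q : k) ^ (2 * i) • elt q us (2 * i + 1) (2 * j)
      (KP.bas g) + (conjSign g * (q : k) ^ (2 * j)) • elt q vs (2 * j) (2 * i + 1) (KP.bas g)) := by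
  have hq : (q : k) ≠ 0 := q.ne_zero
  convert exists_class_one q hg (p := (q : k) ^ (2 * i) • mon (2 * i + 1) (2 * j))
    (r := (conjSign g * (q : k) ^ (2 * j)) • mon (2 * j) (2 * i + 1)) ?_ ?_ ?_ using 3
  · rw [elt_eq, elt_eq]
    simp [kos1_apply, smashBas_apply]
  · rw [d1_apply]
    simp [u_mul_mon, mon_mul_u, v_mul_mon, mon_mul_v, pow_succ, pow_mul]
  · rw [map_smul, swap_mon]
    simp only [smul_smul, inv_pow]
    congr 1
    rw [show (2 * i + 1) * (2 * j) = 2 * ((2 * i + 1) * j) by ring, pow_mul (-1 : k)]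
    field_simp
    simp [pow_succ, mul_assoc]
  · rw [map_smul, swap_mon]
    simp only [smul_smul, inv_pow]
    congr 1
    rw [show 2 * j * (2 * i + 1) = 2 * (j * (2 * i + 1)) by ring, pow_mul (-1 : k)]
    have := conjSign_mul_self_of_lt (k := k) hg
    field_simp
    simp [pow_succ, this, mul_comm]

/-- A monomial with both exponents odd anticommutes with u and v, so α is `flip`. With l = `flipU`
the two derivations can be taken dual to v and to u. -/
lemma exists_class_alt2 (i j : ℕ) {g : Fin 8} (hg : g < 4) :
    ∃ c, Cohomology.IsClassOf (restrictHH q 2 c) ((q : k) ^ (2 * i) •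
      elt q (us * vs) (2 * i + 1) (2 * j + 1) (KP.bas g) -
      (conjSign g * (q : k) ^ (2 * j)) • elt q (us * vs) (2 * j + 1) (2 * i + 1) (KP.bas g)) := by
  have hq : (q : k) ≠ 0 := q.ne_zero
  convert exists_class_two q (hg.trans (by decide) : g < 6)
    ((q : k) ^ (2 * i) • mon (2 * i + 1) (2 * j + 1)) flipU flip ?_
    (m₁ := 0) (n₁ := 1) (m₂ := 1) (n₂ := 0) ?_ ?_ ?_ using 3
  · rw [map_smul, swap_mon, elt_eq, elt_eq, kos2_apply, smashBas_apply, smul_smul, smul_smul,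
      show conjSign g * (q : k) ^ (2 * i) * ((q⁻¹ : k) ^ (2 * i + 1) * (q : k) ^ (2 * j + 1) *
        (-1) ^ ((2 * i + 1) * (2 * j + 1))) = -(conjSign g * (q : k) ^ (2 * j)) by
        rw [Odd.neg_one_pow (by exact (odd_two_mul_add_one i).mul (odd_two_mul_add_one j)), inv_pow]
        field_simp
        ring]
    rw [neg_smul, ← sub_eq_add_neg, map_sub, sub_mul, TensorProduct.tmul_sub,
      map_smul (inAHom q), map_smul (inAHom q), smul_mul_assoc, smul_mul_assoc,
      TensorProduct.tmul_smul, TensorProduct.tmul_smul]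
  · rw [twist_of_lt q hg]
    refine mul_twist_of_gen ?_ ?_ <;>
      simp [u_mul_mon, mon_mul_u, v_mul_mon, mon_mul_v, pow_succ, pow_mul]
  all_goals simp

lemma exists_class_extra {g : Fin 8} (hg : g < 6) (hs : (conjSign g : k) = 1) :
    ∃ c, Cohomology.IsClassOf (restrictHH q 2 c) (elt q (us * vs) 0 0 (KP.bas g)) := by
  have h2 : (2 : k) ≠ 0 := two_ne_zero
  have e : elt q (us * vs) 0 0 (KP.bas g) = kos2 q (smashBas q g ((2⁻¹ : k) • (1 : QPlane k) +
      (conjSign g : k) • QPlane.swap q ((2⁻¹ : k) • (1 : QPlane k)))) := by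
    rw [hs, one_smul, map_smul, map_one, ← add_smul, ← two_mul, mul_inv_cancel₀ h2, one_smul,
      elt_eq, mon_zero]; rfl
  rw [e]
  by_cases hg4 : g < 4
  · refine exists_class_two q hg _ flip (AlgHom.id k _) (fun a => ?_)
      (m₁ := 0) (n₁ := 1) (m₂ := 1) (n₂ := 0) ?_ ?_ ?_
    · rw [twist_of_lt q hg4]; simp
    all_goals simp
  -- Here α = `swap`. Taking l = -α on generators makes D₂ with values (0, 1) admissible, and forces
  -- the values (1, q) of D₁ up to scale.
  · refine exists_class_two q hg _ (flipSwap q) (QPlane.swap q) (fun a => ?_)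
      (m₁ := 1) (n₁ := (q : k) • 1) (m₂ := 0) (n₂ := 1) ?_ ?_ ?_
    · rw [twist_of_not_lt q hg4]; simp
    all_goals simp

lemma exists_class_elements0 (i : Index0) :
    ∃ c, Cohomology.IsClassOf (restrictHH q 0 c) (elements0 q i) := by
  rcases i with ⟨i, j, h⟩ | ⟨i, j, h⟩ | ⟨i, j, h⟩ | ⟨i, j, h⟩
  · simpa [conjSign, elements0, sym0, bas_zero, bas_one, bas_two] using
      exists_class_sym0 q i j (g := 0) (by decide)
  · simpa [conjSign, elements0, sym0, bas_zero, bas_one, bas_two] using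
      exists_class_sym0 q i j (g := 1) (by decide)
  · simpa [conjSign, elements0, sym0, bas_zero, bas_one, bas_two] using
      exists_class_sym0 q i j (g := 2) (by decide)
  · obtain ⟨c, hc⟩ := exists_class_sym0 q i j (g := 3) (by decide)
    refine ⟨c, ?_⟩
    convert hc using 1
    simp only [elements0, alt0, bas_three, conjSign_three]
    module

lemma exists_class_elements1 (i : Index1) :
    ∃ c, Cohomology.IsClassOf (restrictHH q 1 c) (elements1 q i) := by
  rcases i with ⟨i, j⟩ | ⟨i, j⟩ | ⟨i, j⟩ | ⟨i, j⟩
  · simpa [conjSign, elements1, sym1, bas_zero, bas_one, bas_two] using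
      exists_class_sym1 q i j (g := 0) (by decide)
  · simpa [conjSign, elements1, sym1, bas_zero, bas_one, bas_two] using
      exists_class_sym1 q i j (g := 1) (by decide)
  · simpa [conjSign, elements1, sym1, bas_zero, bas_one, bas_two] using
      exists_class_sym1 q i j (g := 2) (by decide)
  · obtain ⟨c, hc⟩ := exists_class_sym1 q i j (g := 3) (by decide)
    refine ⟨c, ?_⟩
    convert hc using 1
    simp only [elements1, alt1, bas_three, conjSign_three]
    module

lemma exists_class_elements2 (i : Index2) :
    ∃ c, Cohomology.IsClassOf (restrictHH q 2 c) (elements2 q i) := by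
  rcases i with ⟨i, j, h⟩ | ⟨i, j, h⟩ | ⟨i, j, h⟩ | ⟨i, j, h⟩ | _ | _ | _ | _ | _
  · simpa [conjSign, elements2, alt2, bas_zero, bas_one, bas_two] using
      exists_class_alt2 q i j (g := 0) (by decide)
  · simpa [conjSign, elements2, alt2, bas_zero, bas_one, bas_two] using
      exists_class_alt2 q i j (g := 1) (by decide)
  · simpa [conjSign, elements2, alt2, bas_zero, bas_one, bas_two] using
      exists_class_alt2 q i j (g := 2) (by decide)
  · obtain ⟨c, hc⟩ := exists_class_alt2 q i j (g := 3) (by decide)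
    refine ⟨c, ?_⟩
    convert hc using 1
    simp only [elements2, sym2, bas_three, conjSign_three]
    module
  · exact exists_class_extra q (g := 0) (by decide) rfl
  · exact exists_class_extra q (g := 1) (by decide) rfl
  · exact exists_class_extra q (g := 2) (by decide) rfl
  · exact exists_class_extra q (g := 4) (by decide) rfl
  · exact exists_class_extra q (g := 5) (by decide) rfl

/-- Invariant classes are represented by combinations of the listed elements. -/
lemma exists_mem_span_of_invariant {n : ℕ} {ι : Type*} {e : ι → Kos q}
    (hinv : ∀ ζ ∈ kosZ q n, (∀ h : KP k, kosAct q h ζ - KP.counitHom h • ζ ∈ kosB q n) →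
      ζ ∈ kosB q n ⊔ Submodule.span k (Set.range e))
    (he : ∀ i, e i ∈ kosZ q n) {c : KosH q n} (hc : c ∈ kosInvariants q n) :
    ∃ w ∈ Submodule.span k (Set.range e), Cohomology.IsClassOf c w := by
  obtain ⟨⟨ζ, hζ⟩, h, rfl⟩ := hc
  have h' (g : KP k) : kosAct q g ζ - KP.counitHom g • ζ ∈ kosB q n := (Submodule.mem_iInf _).1 h g
  obtain ⟨β, hβ, w, hw, rfl⟩ := Submodule.mem_sup.1 (hinv ζ hζ h')
  have hwZ : w ∈ kosZ q n := Submodule.span_le.2 (by rintro _ ⟨i, rfl⟩; exact he i) hw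
  refine ⟨w, hw, hwZ, (Submodule.Quotient.eq _).2 ?_⟩
  change β + w - w ∈ kosB q n
  rwa [add_sub_cancel_right]

lemma mem_range_of_mem_span {n : ℕ} {ι : Type*} {e : ι → Kos q}
    (he : ∀ i, ∃ c, Cohomology.IsClassOf (restrictHH q n c) (e i)) {w : Kos q}
    (hw : w ∈ Submodule.span k (Set.range e)) :
    ∃ c, Cohomology.IsClassOf (restrictHH q n c) w := by
  induction hw using Submodule.span_induction with
  | mem w hw =>
    obtain ⟨i, rfl⟩ := hw
    exact he i
  | zero => exact ⟨0, zero_mem _, by rw [map_zero]; rfl⟩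
  | add v w _ _ hv hw =>
    obtain ⟨y, h1, h2⟩ := hv
    obtain ⟨z, h3, h4⟩ := hw
    exact ⟨y + z, add_mem h1 h3, by rw [map_add, h2, h4]; rfl⟩
  | smul a w _ hw =>
    obtain ⟨z, h3, h4⟩ := hw
    exact ⟨a • z, Submodule.smul_mem _ _ h3, by rw [map_smul, h4]; rfl⟩

/-- The image of the restriction is the space of invariants, and the listed elements give a basis. -/
lemma range_eq_and_exists_basis {n : ℕ} (hn : n ≤ 2) {ι : Type*} {e : ι → Kos q}
    (f : ι → Kos q →ₗ[k] k)
    (hB : ∀ i, ∀ b ∈ kosB q n, f i b = 0) (hdiag : ∀ i, f i (e i) ≠ 0)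
    (hoff : ∀ i j, i ≠ j → f i (e j) = 0)
    (hpre : ∀ i, ∃ c, Cohomology.IsClassOf (restrictHH q n c) (e i))
    (hmem : ∀ c, restrictHH q n c ∈ kosInvariants q n)
    (hinv : ∀ ζ ∈ kosZ q n, (∀ h : KP k, kosAct q h ζ - KP.counitHom h • ζ ∈ kosB q n) →
      ζ ∈ kosB q n ⊔ Submodule.span k (Set.range e)) :
    LinearMap.range (restrictHH q n) = kosInvariants q n ∧
    ∃ b : Module.Basis ι k (HH k (KPSmash q) n),
      ∀ i, Cohomology.IsClassOf (restrictHH q n (b i)) (e i) := by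
  have hspan {c : KosH q n} (hc : c ∈ kosInvariants q n) :
      ∃ w ∈ Submodule.span k (Set.range e), Cohomology.IsClassOf c w :=
    exists_mem_span_of_invariant q hinv (fun i => (hpre i).choose_spec.1) hc
  refine ⟨le_antisymm ?_ ?_, ?_⟩
  · rintro _ ⟨c, rfl⟩
    exact hmem c
  · intro c hc
    obtain ⟨w, hw, _, h⟩ := hspan hc
    obtain ⟨c', _, h'⟩ := mem_range_of_mem_span q hpre hw
    exact ⟨c', h'.trans h.symm⟩
  · exact Cohomology.exists_basis (restrictHH q n) (restrictHH_injective q hn) e f hB hdiag hoff hpre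
      fun c => hspan (hmem c)

end Main

theorem mainTheorem6 {k : Type*} [Field k] [NeZero (2 : k)] (q : kˣ) :
    (∀ n ≤ 2, Function.Injective (restrictHH q n) ∧
      LinearMap.range (restrictHH q n) = kosInvariants q n) ∧
    (∃ b : Module.Basis Index0 k (HH k (KPSmash q) 0),
      ∀ i, Cohomology.IsClassOf (restrictHH q 0 (b i)) (elements0 q i)) ∧
    (∃ b : Module.Basis Index1 k (HH k (KPSmash q) 1),
      ∀ i, Cohomology.IsClassOf (restrictHH q 1 (b i)) (elements1 q i)) ∧
    (∃ b : Module.Basis Index2 k (HH k (KPSmash q) 2),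
      ∀ i, Cohomology.IsClassOf (restrictHH q 2 (b i)) (elements2 q i)) := by
  have h0 := range_eq_and_exists_basis q (n := 0) (by norm_num) (dual0 q) (fun i _ => dual0_kosB q i)
    (dual0_diag q) (fun _ _ => dual0_offdiag q) (exists_class_elements0 q) (restrictHH_mem_zero q)
    (fun _ => invariant_mem_zero q)
  have h1 := range_eq_and_exists_basis q (n := 1) (by norm_num) (dual1 q) (fun i _ => dual1_kosB q i)
    (dual1_diag q) (fun _ _ => dual1_offdiag q) (exists_class_elements1 q) (restrictHH_mem_one q)
    (fun _ => invariant_mem_one q)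
  have h2 := range_eq_and_exists_basis q (n := 2) le_rfl (dual2 q) (fun i _ => dual2_kosB q i)
    (dual2_diag q) (fun _ _ => dual2_offdiag q) (exists_class_elements2 q) (restrictHH_mem_two q)
    (fun _ => invariant_mem_two q)
  refine ⟨fun n hn => ⟨restrictHH_injective q hn, ?_⟩, h0.2, h1.2, h2.2⟩
  interval_cases n
  exacts [h0.1, h1.1, h2.1]
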